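/- **Setting.** Let $\gamma,\xi$ be $\{0,1,2,\dots\}$-valued random variables (target in-degree and target out-degree) with $0<\mathbb E\gamma=\mathbb E\xi<\infty$. Let $a,b>1$ and suppose that $\gamma$ and $\xi$ are stochastically bounded from above by probability distributions on $\mathbb R$ whose tails vary regularly at infinity with index $-a$ and $-b$, respectively (the variances may be infinite). Put $\kappa=\min\{1-1/a,\,1-1/b,\,1/2\}$ and fix $0<\delta<\kappa$. An *erased configuration model (ECM) graph* on the vertex set $V_n$ with $|V_n|=n$ is generated as follows. (1) Sample $n$ independent copies $\gamma_i$ of $\gamma$ and, independently, $n$ independent copies $\xi_i$ of $\xi$, and put $\Delta=\sum_i\gamma_i-\sum_i\xi_i$; repeat this step until $|\Delta|\le n^{1-\kappa+\delta}$. (2) Choose a uniformly random set of $|\Delta|$ vertices; give each chosen vertex one additional outbound stub if $\Delta\ge 0$, and one additional inbound stub if $\Delta<0$, so that vertex $i$ has $\gamma_i$ (possibly plus one) inbound stubs and $\xi_i$ (possibly plus one) outbound stubs. (3) Pair the outbound stubs with the inbound stubs by a uniformly random bijection; each pair is a directed edge. (4) Remove self-loops and merge multiple edges. For the resulting simple directed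 graph $G=(V,E)$ let $D^+(v)$ and $D^-(v)$ be the out- and the in-degree of $v$ in $G$, and for $e=(v,w)$ let $\pi_*e=v$, $\pi^*e=w$. For $\alpha,\beta\in\{+,-\}$ let $$R^\alpha\pi_*e=\sum_{f\in E}1\{D^\alpha\pi_*f+U_f\ge D^\alpha\pi_*e+U_e\},\qquad R^\beta\pi^*e=\sum_{f\in E}1\{D^\beta\pi^*f+W_f\ge D^\beta\pi^*e+W_e\},$$ where $(U_e)_{e\in V^2}$, $(W_e)_{e\in V^2}$ are independent families of independent uniform variables on $[0,1)$, independent of $G$, and for $\pi\in\{\pi_*,\pi^*\}$ $$\overline R^\alpha\pi e=\tfrac12+\sum_{f\in E}\Big(1\{D^\alpha\pi f>D^\alpha\pi e\}+\tfrac12\,1\{D^\alpha\pi f=D^\alpha\pi e\}\Big).$$ Define $$\rho_\alpha^\beta(G)=\frac{12\sum_{e\in E}R^\alpha\pi_*e\;R^\beta\pi^*e-3|E|(|E|+1)^2}{|E|^3-|E|},$$ $$\overline\rho_\alpha^\beta(G)=\frac{4\sum_{e\in E}\overline R^\alpha\pi_*e\;\overline R^\beta\pi^*e-|E|(|E|+1)^2}{\sqrt{4\sum_{e\in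 E}(\overline R^\alpha\pi_*e)^2-|E|(|E|+1)^2}\,\sqrt{4\sum_{e\in E}(\overline R^\beta\pi^*e)^2-|E|(|E|+1)^2}},$$ $$\tau_\alpha^\beta(G)=\frac{2(\mathcal N_C-\mathcal N_D)}{|E|(|E|-1)},$$ where $\mathcal N_C$ (resp. $\mathcal N_D$) is the number of unordered pairs $\{e,f\}$ of edges for which $(D^\alpha\pi_*e-D^\alpha\pi_*f)(D^\beta\pi^*e-D^\beta\pi^*f)$ is $>0$ (resp. $<0$). Let $\mathcal D^+_*$ and $\mathcal D^-_*$ have the laws $\mathbb P(\mathcal D^+_*=k)=k\,\mathbb P(\xi=k)/\mathbb E\xi$ and $\mathbb P(\mathcal D^-_*=k)=\mathbb P(\gamma=k)$, and let $\mathcal D^{+}_{\circ}$ and $\mathcal D^{-}_{\circ}$ have the laws $\mathbb P(\mathcal D^{+}_{\circ}=k)=\mathbb P(\xi=k)$ and $\mathbb P(\mathcal D^{-}_{\circ}=k)=k\,\mathbb P(\gamma=k)/\mathbb E\gamma$. **Theorem.** Let $\{G_n\}_{n\in\mathbb N}$ be a sequence of random graphs on a common probability space such that, for all sufficiently large $n$,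 $G_n$ is an ECM graph on $n$ vertices, and let $\alpha,\beta\in\{+,-\}$. Then, as $n\to\infty$, $$\rho_\alpha^\beta(G_n)\to 0\quad\text{and}\quad\tau_\alpha^\beta(G_n)\to 0\quad\text{in probability},$$ and, provided that neither $\mathcal D^\alpha_*$ nor $\mathcal D^\beta_\circ$ is concentrated in a single point, also $$\overline\rho_\alpha^\beta(G_n)\to 0\quad\text{in probability}.$$ No assumption is made on the joint law of the graphs for different $n$. -/

import Mathlib

open MeasureTheory ProbabilityTheory Filter Topology
open scoped ENNReal

namespace ECM

/-! ### Degrees and rank correlations of a simple directed graph -/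

/-- The two degree types: `plus` is the out-degree, `minus` is the in-degree. -/
inductive DegreeType : Type
  | plus : DegreeType
  | minus : DegreeType

section RankCorrelations

variable {V : Type*} [DecidableEq V]

/-- The degree of type `α` of the vertex `v` in the simple directed graph with edge set `E`;
the pair `(v, w)` is the edge from `v` to `w`. -/
def degree (E : Finset (V × V)) : DegreeType → V → ℕ
  | .plus, v => (E.filter fun e => e.1 = v).card
  | .minus, v => (E.filter fun e => e.2 = v).card

/-- `D^α` of the source of the edge `e`. -/
def sourceDegree (E : Finset (V × V)) (α : DegreeType) (e : V × V) : ℕ := degree E α e.1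

/-- `D^β` of the target of the edge `e`. -/
def targetDegree (E : Finset (V × V)) (β : DegreeType) (e : V × V) : ℕ := degree E β e.2

/-- The rank of `e` for the values `D` on `E`, ties being resolved by the numbers `u`. -/
noncomputable def uniformRank (E : Finset (V × V)) (D : V × V → ℕ) (u : V × V → ℝ)
    (e : V × V) : ℝ :=
  ∑ f ∈ E, if (D e : ℝ) + u e ≤ (D f : ℝ) + u f then 1 else 0

/-- The average rank of `e` for the values `D` on `E`. -/
noncomputable def averageRank (E : Finset (V × V)) (D : V × V → ℕ) (e : V × V) : ℝ :=
  1 / 2 + ∑ f ∈ E, ((if D e < D f then 1 else 0) + 1 / 2 * (if D f = D e then 1 else 0))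

/-- Spearman's rho of the edges, ties resolved by `u` at the sources and by `w` at the targets. -/
noncomputable def spearman (E : Finset (V × V)) (u w : V × V → ℝ) (α β : DegreeType) : ℝ :=
  (12 * ∑ e ∈ E, uniformRank E (sourceDegree E α) u e * uniformRank E (targetDegree E β) w e
      - 3 * (E.card : ℝ) * ((E.card : ℝ) + 1) ^ 2)
    / ((E.card : ℝ) ^ 3 - (E.card : ℝ))

/-- The normalisation of average ranks: `√(4 ∑ R̄(e)² - |E| (|E| + 1)²)`. -/
noncomputable def averageRankDeviation (E : Finset (V × V)) (D : V × V → ℕ) : ℝ :=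
  Real.sqrt (4 * ∑ e ∈ E, averageRank E D e ^ 2 - (E.card : ℝ) * ((E.card : ℝ) + 1) ^ 2)

/-- Spearman's rho of the edges, with average ranks. -/
noncomputable def spearmanAverage (E : Finset (V × V)) (α β : DegreeType) : ℝ :=
  (4 * ∑ e ∈ E, averageRank E (sourceDegree E α) e * averageRank E (targetDegree E β) e
      - (E.card : ℝ) * ((E.card : ℝ) + 1) ^ 2)
    / (averageRankDeviation E (sourceDegree E α) * averageRankDeviation E (targetDegree E β))

/-- `(D^α(source e) - D^α(source f)) (D^β(target e) - D^β(target f))`. -/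
def pairSign (E : Finset (V × V)) (α β : DegreeType) (e f : V × V) : ℤ :=
  ((sourceDegree E α e : ℤ) - sourceDegree E α f) * ((targetDegree E β e : ℤ) - targetDegree E β f)

/-- The number of concordant (unordered) pairs of edges; each is counted by two ordered pairs. -/
noncomputable def concordantPairs (E : Finset (V × V)) (α β : DegreeType) : ℝ :=
  (((E ×ˢ E).filter fun p => 0 < pairSign E α β p.1 p.2).card : ℝ) / 2

/-- The number of discordant (unordered) pairs of edges; each is counted by two ordered pairs. -/
noncomputable def discordantPairs (E : Finset (V × V)) (α β : DegreeType) : ℝ :=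
  (((E ×ˢ E).filter fun p => pairSign E α β p.1 p.2 < 0).card : ℝ) / 2

/-- Kendall's tau of the edges. -/
noncomputable def kendall (E : Finset (V × V)) (α β : DegreeType) : ℝ :=
  2 * (concordantPairs E α β - discordantPairs E α β) / ((E.card : ℝ) * ((E.card : ℝ) - 1))

end RankCorrelations

/-! ### Target degree distributions -/

/-- The mean of a distribution on the natural numbers. -/
noncomputable def mean (p : PMF ℕ) : ℝ≥0∞ := ∑' k : ℕ, (k : ℝ≥0∞) * p k

/-- The distribution `p` is stochastically bounded from above by a regularly varying distribution
`ν`: the tail of `ν` varies regularly with index `-a` and dominates the tail of `p`. -/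
def BoundedByRegularlyVarying (p : PMF ℕ) (a : ℝ) : Prop :=
  ∃ ν : Measure ℝ, IsProbabilityMeasure ν ∧
    (∀ t : ℝ, 0 < t →
      Tendsto (fun x : ℝ => ν.real (Set.Ioi (t * x)) / ν.real (Set.Ioi x)) atTop (𝓝 (t ^ (-a)))) ∧
    ∀ x : ℝ, p.toMeasure {k : ℕ | x < (k : ℝ)} ≤ ν (Set.Ioi x)

/-- The exponent `κ = min {1 - 1/a, 1 - 1/b, 1/2}`. -/
noncomputable def kappa (a b : ℝ) : ℝ := min (min (1 - a⁻¹) (1 - b⁻¹)) (1 / 2)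

/-- The distribution with weights proportional to `k * p k`. -/
noncomputable def sizeBiased (p : PMF ℕ) (k : ℕ) : ℝ≥0∞ := (k : ℝ≥0∞) * p k / mean p

/-- The limiting distribution of the degree of type `α` at the source of a uniformly chosen edge,
for the target distributions `pIn` and `pOut` of the in- and out-degrees. -/
noncomputable def sourceLimit (pIn pOut : PMF ℕ) : DegreeType → ℕ → ℝ≥0∞
  | .plus, k => sizeBiased pOut k
  | .minus, k => pIn k

/-- The limiting distribution of the degree of type `β` at the target of a uniformly chosen edge,
for the target distributions `pIn` and `pOut` of the in- and out-degrees. -/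
noncomputable def targetLimit (pIn pOut : PMF ℕ) : DegreeType → ℕ → ℝ≥0∞
  | .plus, k => pOut k
  | .minus, k => sizeBiased pIn k

/-! ### The erased directed configuration model -/

/-- In-degrees (first component) and out-degrees (second component) of `n` vertices. -/
abbrev BiDegrees (n : ℕ) : Type := (Fin n → ℕ) × (Fin n → ℕ)

/-- The sum of the in-degrees minus the sum of the out-degrees. -/
def discrepancy {n : ℕ} (d : BiDegrees n) : ℤ := ∑ i, (d.1 i : ℤ) - ∑ i, (d.2 i : ℤ)

/-- The independent sequences of independent copies of the in- and of the out-degree. -/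
noncomputable def iidLaw (pIn pOut : PMF ℕ) (n : ℕ) : Measure (BiDegrees n) :=
  (Measure.pi fun _ : Fin n => pIn.toMeasure).prod (Measure.pi fun _ : Fin n => pOut.toMeasure)

/-- A sampled pair of sequences is accepted if its discrepancy is at most `n ^ (1 - κ + δ)`. -/
def accepted (a b δ : ℝ) (n : ℕ) : Set (BiDegrees n) :=
  {d | |(discrepancy d : ℝ)| ≤ (n : ℝ) ^ (1 - kappa a b + δ)}

/-- Sampling the pair of sequences until it is accepted. -/
noncomputable def acceptedLaw (pIn pOut : PMF ℕ) (a b δ : ℝ) (n : ℕ) : Measure (BiDegrees n) :=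
  ProbabilityTheory.cond (iidLaw pIn pOut n) (accepted a b δ n)

/-- Add one outbound stub (if the discrepancy is nonnegative) or one inbound stub (if it is
negative) to every vertex of `S`. -/
def balance {n : ℕ} (d : BiDegrees n) (S : Finset (Fin n)) : BiDegrees n :=
  (fun i => d.1 i + if discrepancy d < 0 ∧ i ∈ S then 1 else 0,
   fun i => d.2 i + if 0 ≤ discrepancy d ∧ i ∈ S then 1 else 0)

/-- The bi-degree sequence of stubs: a uniformly random set of vertices, of the size of the
discrepancy, is used to balance an accepted pair of sequences. -/
noncomputable def stubLaw (pIn pOut : PMF ℕ) (a b δ : ℝ) (n : ℕ) : Measure (BiDegrees n) :=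
  (acceptedLaw pIn pOut a b δ n).bind fun d =>
    (uniformOn {S : Finset (Fin n) | S.card = (discrepancy d).natAbs}).map (balance d)

/-- The inbound stubs. -/
abbrev InStub {n : ℕ} (d : BiDegrees n) : Type := Σ v : Fin n, Fin (d.1 v)

/-- The outbound stubs. -/
abbrev OutStub {n : ℕ} (d : BiDegrees n) : Type := Σ v : Fin n, Fin (d.2 v)

/-- A pairing of the outbound with the inbound stubs. -/
def Pairing {n : ℕ} (d : BiDegrees n) : Type := OutStub d ≃ InStub d

instance {n : ℕ} (d : BiDegrees n) : MeasurableSpace (Pairing d) := ⊤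

/-- The simple graph obtained from a pairing of the stubs: multiple edges are merged (a set holds
each edge at most once) and self-loops are removed. -/
def erase {n : ℕ} (d : BiDegrees n) (σ : Pairing d) : Finset (Fin n × Fin n) :=
  (Finset.univ.image fun s : OutStub d => (s.1, (σ.toFun s).1)).filter fun e => e.1 ≠ e.2

/-- The law of the edge set of an erased configuration model graph on `n` vertices: generate the
bi-degree sequence, pair the stubs uniformly at random, and erase. -/
noncomputable def graphLaw (pIn pOut : PMF ℕ) (a b δ : ℝ) (n : ℕ) :
    Measure (Finset (Fin n × Fin n)) :=
  (stubLaw pIn pOut a b δ n).bind fun d =>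
    (uniformOn (Set.univ : Set (Pairing d))).map (erase d)

/-- The law of a vector of independent uniform variables on `[0, 1)`, indexed by the pairs of
vertices. -/
noncomputable def tieLaw (n : ℕ) : Measure (Fin n × Fin n → ℝ) :=
  Measure.pi fun _ => (volume : Measure ℝ).restrict (Set.Ico 0 1)

end ECM

/-! Apart from the random ties, the three statistics are functionals of the joint empirical law of
the pair (source degree, target degree) of the edges. They vanish in the limit because this law
converges in probability to a product `f ⊗ g`: a uniform pairing makes the two ends of an edge
asymptotically independent (`tendsto_graph_counts`).

Ranks. Pointwise convergence of the empirical weights is convergence in `ℓ¹` by Scheffé's lemma, so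
the normalised average ranks converge uniformly to `midSurvival f` and `midSurvival g`, each of mean
`1/2`. Under the product law the mean product of the ranks is `1/4`, which the centring removes, and
the mean sign of a pair of edges is `0`. The average-rank version also divides by the spreads of the
ranks; their limits are positive exactly because neither limit law is a point mass
(`one_quarter_lt_tsum_midSurvival_sq`). Given the graph, random ties perturb the sum of the rank
products by a centred error plus terms of the same size, of second moment `O(|E|^5)`, negligible
against the square of `|E|^3 - |E|` (`integral_rank_products_sub_sq_le`).

Graph. Tails dominated by regularly varying ones give moments of every order `q` in `[1, a)` or `[1,
b)`. With `1 / (1 - κ + δ) < q < min a b` and `q ≤ 2`, truncation and Chebyshev's inequality show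
that samples are accepted with probability tending to one, so conditioning does no harm and the law
of large numbers survives. Balancing touches only `o(n)` vertices. The number of stubs with
prescribed degrees at both ends has variance at most the number of stubs (`avg_card_sub_sq_le`),
hence concentrates at the product form. Erasure removes `o(n)` edges: vertices with more than `K`
stubs carry a fraction of the stubs that vanishes as `K → ∞`, and the expected number of collisions
among the others is bounded for fixed `K` (`tendsto_erasedCount`).

Convergence in probability is expressed as `Tendsto` along the filter `whp`, nested once for each
stage of the randomness; only the law for each single `n` enters. -/

namespace ECM

/-! ### Events of asymptotic probability one -/

/-- The events that hold with high probability for a family of measures, along a filter of the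
indices. Convergence in probability is convergence along this filter. -/
def whp {J : Type*} (l : Filter J) {X : J → Type*} [∀ j, MeasurableSpace (X j)]
    (μ : ∀ j, Measure (X j)) : Filter (Σ j, X j) where
  -- `A` need not be measurable: the measure acts as an outer measure, and monotonicity and
  -- subadditivity are all that the filter axioms require.
  sets := {A | Tendsto (fun j => μ j {x | (⟨j, x⟩ : Σ j, X j) ∉ A}) l (𝓝 0)}
  univ_sets := by simp [tendsto_const_nhds]
  sets_of_superset := by
    intro A B hA hAB
    exact tendsto_of_tendsto_of_tendsto_of_le_of_le tendsto_const_nhds hA (fun _ => zero_le)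
      fun n => measure_mono fun x hx h => hx (hAB h)
  inter_sets := by
    intro A B hA hB
    have hsum := Tendsto.add hA hB
    rw [add_zero] at hsum
    refine tendsto_of_tendsto_of_tendsto_of_le_of_le tendsto_const_nhds hsum (fun _ => zero_le)
      fun n => ?_
    refine (measure_mono ?_).trans (measure_union_le _ _)
    intro x hx
    by_contra h
    simp only [Set.mem_union, Set.mem_ofPred_eq, not_or, not_not] at h
    exact hx h

section Family

variable {J : Type*} {l : Filter J} {X : J → Type*} [∀ j, MeasurableSpace (X j)]
  {μ : ∀ j, Measure (X j)}

theorem eventually_whp {p : (Σ j, X j) → Prop} :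
    (∀ᶠ z in whp l μ, p z) ↔ Tendsto (fun j => μ j {x | ¬ p ⟨j, x⟩}) l (𝓝 0) := Iff.rfl

/-- Lifts limits from one stage of the randomness to the next: a statement about the earlier stage
alone has an empty or full exceptional set at each index. -/
theorem tendsto_fst_whp : Tendsto (fun z : Σ j, X j => z.1) (whp l μ) l := by
  intro s hs
  change ∀ᶠ z in whp l μ, z.1 ∈ s
  rw [eventually_whp]
  refine tendsto_const_nhds.congr' ?_
  filter_upwards [hs] with j hj
  simp [hj]

theorem eventually_whp_map {Y : J → Type*} [∀ j, MeasurableSpace (Y j)]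
    [∀ j, DiscreteMeasurableSpace (X j)] [∀ j, DiscreteMeasurableSpace (Y j)]
    (φ : ∀ j, X j → Y j) {p : (Σ j, Y j) → Prop} (h : ∀ᶠ z in whp l μ, p ⟨z.1, φ z.1 z.2⟩) :
    ∀ᶠ z in whp l (fun j => (μ j).map (φ j)), p z := by
  rw [eventually_whp] at h ⊢
  refine h.congr fun j => ?_
  rw [Measure.map_apply (Measurable.of_discrete) MeasurableSet.of_discrete]
  rfl

end Family

section Whp

variable {X : ℕ → Type*} [∀ n, MeasurableSpace (X n)] {μ : ∀ n, Measure (X n)}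

theorem tendsto_natCast_fst_whp :
    Tendsto (fun z : Σ n, X n => (z.1 : ℝ)) (whp atTop μ) atTop :=
  tendsto_natCast_atTop_atTop.comp tendsto_fst_whp

/-- A bounded function converging to zero in probability converges to zero in mean. -/
theorem tendsto_lintegral_of_tendsto_whp (hμ : ∀ n, μ n Set.univ ≤ 1) (f : ∀ n, X n → ℝ≥0∞)
    (hf : ∀ n x, f n x ≤ 1) (h : Tendsto (fun z : Σ n, X n => f z.1 z.2) (whp atTop μ) (𝓝 0)) :
    Tendsto (fun n => ∫⁻ x, f n x ∂μ n) atTop (𝓝 0) := by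
  rw [ENNReal.tendsto_nhds_zero]
  intro ε hε
  have hε2 : 0 < ε / 2 := ENNReal.half_pos hε.ne'
  have h1 := (ENNReal.tendsto_nhds_zero.1 h) (ε / 2) hε2
  rw [eventually_whp] at h1
  filter_upwards [(ENNReal.tendsto_nhds_zero.1 h1) (ε / 2) hε2] with n hn
  -- `f n` may fail to be measurable, so the exceptional set is replaced by its measurable hull `T`,
  -- which has the same measure.
  set B := {x | ¬ f n x ≤ ε / 2}
  set T := toMeasurable (μ n) B
  have hle : ∀ x, f n x ≤ ε / 2 + T.indicator (fun _ => 1) x := by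
    intro x
    by_cases hx : x ∈ T
    · simpa [hx] using (hf n x).trans le_add_self
    · have : x ∉ B := fun h => hx (subset_toMeasurable _ _ h)
      simp only [B, Set.mem_ofPred_eq, not_not] at this
      simpa [hx] using this
  calc ∫⁻ x, f n x ∂μ n ≤ ∫⁻ x, (ε / 2 + T.indicator (fun _ => 1) x) ∂μ n := lintegral_mono hle
    _ = ε / 2 * μ n Set.univ + μ n T := by
        rw [lintegral_add_left measurable_const, lintegral_const,
          lintegral_indicator (measurableSet_toMeasurable _ _)]
        simp [T]
    _ ≤ ε / 2 * 1 + ε / 2 := by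
        gcongr
        · exact hμ n
        · rwa [measure_toMeasurable]
    _ = ε := by rw [mul_one, ENNReal.add_halves]

/-- Transfer of events of high probability through a sequence of kernels. -/
theorem eventually_whp_bind [∀ n, Countable (X n)] [∀ n, MeasurableSingletonClass (X n)]
    {Y : ℕ → Type*} [∀ n, MeasurableSpace (Y n)] [∀ n, DiscreteMeasurableSpace (Y n)]
    (hμ : ∀ n, μ n Set.univ ≤ 1) (κ : ∀ n, X n → Measure (Y n)) (hκ : ∀ n x, κ n x Set.univ ≤ 1)
    (p : (Σ n, Y n) → Prop)
    (h : ∀ᶠ y in whp (whp atTop μ) (fun z => κ z.1 z.2), p ⟨y.1.1, y.2⟩) :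
    ∀ᶠ z in whp atTop (fun n => (μ n).bind (κ n)), p z := by
  rw [eventually_whp]
  -- The failure probability under `bind` is the mean of the failure probabilities of the kernels,
  -- which are at most one and tend to zero in probability.
  have := tendsto_lintegral_of_tendsto_whp hμ (fun n x => κ n x {y | ¬ p ⟨n, y⟩})
    (fun n x => (measure_mono (Set.subset_univ _)).trans (hκ n x)) h
  refine this.congr fun n => ?_
  rw [Measure.bind_apply (MeasurableSet.of_discrete) (measurable_of_countable _).aemeasurable]

/-- Mass at most one is used in place of mass one throughout: conditioning on a null event, or a
uniform choice from an empty type of pairings, yields the zero measure. -/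
theorem bind_univ_le {α β : Type*} [MeasurableSpace α] [MeasurableSpace β] {m : Measure α}
    (hm : m Set.univ ≤ 1) (κ : α → Measure β) (hκ : ∀ x, κ x Set.univ ≤ 1) :
    m.bind κ Set.univ ≤ 1 := by
  refine (Measure.bind_apply_le κ MeasurableSet.univ).trans ?_
  calc ∫⁻ x, κ x Set.univ ∂m ≤ ∫⁻ _, 1 ∂m := lintegral_mono hκ
    _ ≤ 1 := by simpa using hm

theorem cond_univ_le {α : Type*} [MeasurableSpace α] (m : Measure α) {s : Set α}
    (hs : MeasurableSet s) : ProbabilityTheory.cond m s Set.univ ≤ 1 := by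
  rw [cond_apply hs, Set.inter_univ]
  exact ENNReal.inv_mul_le_one _

theorem map_univ_le {α β : Type*} [MeasurableSpace α] [MeasurableSpace β] {m : Measure α}
    (hm : m Set.univ ≤ 1) (f : α → β) : m.map f Set.univ ≤ 1 := by
  by_cases hf : AEMeasurable f m
  · rwa [Measure.map_apply_of_aemeasurable hf MeasurableSet.univ, Set.preimage_univ]
  · simp [Measure.map_of_not_aemeasurable hf]

/-- Transfer of limits in probability through a sequence of kernels. -/
theorem tendsto_whp_bind_map [∀ n, Countable (X n)] [∀ n, MeasurableSingletonClass (X n)]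
    {Y : ℕ → Type*} [∀ n, MeasurableSpace (Y n)] [∀ n, DiscreteMeasurableSpace (Y n)]
    {W : (Σ n, X n) → Type*} [∀ z, MeasurableSpace (W z)] [∀ z, DiscreteMeasurableSpace (W z)]
    (hμ : ∀ n, μ n Set.univ ≤ 1) (τ : ∀ z, Measure (W z)) (hτ : ∀ z, τ z Set.univ ≤ 1)
    (ψ : ∀ z : Σ n, X n, W z → Y z.1) {R : Type*} {l : Filter R} (F : ∀ n, Y n → R)
    (h : Tendsto (fun y : Σ z, W z => F y.1.1 (ψ y.1 y.2)) (whp (whp atTop μ) τ) l) :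
    Tendsto (fun z : Σ n, Y n => F z.1 z.2)
      (whp atTop fun n => (μ n).bind fun x => (τ ⟨n, x⟩).map (ψ ⟨n, x⟩)) l := by
  intro s hs
  have key : ∀ᶠ y in whp (whp atTop μ) (fun z => (τ z).map (ψ z)), F y.1.1 y.2 ∈ s :=
    eventually_whp_map (Y := fun z : Σ n, X n => Y z.1) (p := fun y => F y.1.1 y.2 ∈ s) ψ (h hs)
  exact eventually_whp_bind hμ (fun n x => (τ ⟨n, x⟩).map (ψ ⟨n, x⟩))
    (fun n x => map_univ_le (hτ _) _) (fun z => F z.1 z.2 ∈ s) key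

/-- Conditioning on events of high probability preserves high probability. -/
theorem whp_cond_le (s : ∀ n, Set (X n)) (hs : ∀ n, MeasurableSet (s n))
    (hμ : ∀ n, IsProbabilityMeasure (μ n)) (h : ∀ᶠ z in whp atTop μ, z.2 ∈ s z.1) :
    whp atTop (fun n => ProbabilityTheory.cond (μ n) (s n)) ≤ whp atTop μ := by
  intro A hA
  change Tendsto _ _ _
  rw [eventually_whp] at h
  -- Once the conditioning event has mass at least `1/2`, conditioning at most doubles
  -- probabilities.
  have hlow : ∀ᶠ n in atTop, 2⁻¹ ≤ μ n (s n) := by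
    filter_upwards [(ENNReal.tendsto_nhds_zero.1 h) 2⁻¹ (by simp)] with n hn
    have h1 : μ n (s n)ᶜ ≤ 2⁻¹ := hn
    have h2 := prob_add_prob_compl (μ := μ n) (hs n)
    by_contra hc
    have : μ n (s n) + μ n (s n)ᶜ < 2⁻¹ + 2⁻¹ := ENNReal.add_lt_add_of_lt_of_le
      (measure_ne_top _ _) (not_le.1 hc) h1
    rw [h2, ENNReal.inv_two_add_inv_two] at this
    exact lt_irrefl _ this
  have hA' : Tendsto (fun n => 2 * μ n {x | (⟨n, x⟩ : Σ n, X n) ∉ A}) atTop (𝓝 0) := by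
    have := ENNReal.Tendsto.const_mul (a := 2) (show Tendsto _ _ _ from hA) (Or.inr (by simp))
    rwa [mul_zero] at this
  refine tendsto_of_tendsto_of_tendsto_of_le_of_le' tendsto_const_nhds hA'
    (Eventually.of_forall fun _ => zero_le) ?_
  filter_upwards [hlow] with n hn
  rw [cond_apply (hs n)]
  gcongr
  · rw [ENNReal.inv_le_iff_inv_le]; exact hn
  · exact Set.inter_subset_right

/-- Convergence along `whp` of the laws gives convergence in measure. -/
theorem tendstoInMeasure_of_whp {Ω : Type*} [MeasurableSpace Ω] {P : Measure Ω}
    (Z : ∀ n, Ω → X n) (hZ : ∀ᶠ n in atTop, HasLaw (Z n) (μ n) P) (F : ∀ n, X n → ℝ) (c : ℝ)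
    (h : Tendsto (fun z : Σ n, X n => F z.1 z.2) (whp atTop μ) (𝓝 c)) :
    TendstoInMeasure P (fun n ω => F n (Z n ω)) atTop (fun _ => c) := by
  intro ε hε
  have h1 : ∀ᶠ z in whp atTop μ, edist (F z.1 z.2) c < ε := by
    have := h (Metric.eball_mem_nhds c hε)
    exact this
  rw [eventually_whp] at h1
  refine tendsto_of_tendsto_of_tendsto_of_le_of_le' tendsto_const_nhds h1
    (Eventually.of_forall fun _ => zero_le) ?_
  filter_upwards [hZ] with n hn
  -- This inequality holds for every set, so no measurability of `F n` is needed.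
  have := Measure.le_map_apply hn.aemeasurable {x | ¬ edist (F n x) c < ε}
  rw [hn.map_eq] at this
  refine le_trans (le_of_eq ?_) this
  simp [Set.preimage]

end Whp

/-! ### Convergence of empirical distributions -/

/-- Scheffé's lemma for probability weights, along an arbitrary filter. -/
theorem tendsto_tsum_abs_sub {J X : Type*} {l : Filter J} {H : J → X → ℝ} {h : X → ℝ}
    (hH : ∀ᶠ j in l, (∀ x, 0 ≤ H j x) ∧ HasSum (H j) 1) (hh : ∀ x, 0 ≤ h x) (hs : HasSum h 1)
    (hlim : ∀ x, Tendsto (fun j => H j x) l (𝓝 (h x))) :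
    Tendsto (fun j => ∑' x, |H j x - h x|) l (𝓝 0) := by
  -- The positive part of `h - H j` is dominated by `h`, and dominated convergence for sums works
  -- along any filter. As both weights sum to one, the `ℓ¹` distance is twice the sum of these
  -- positive parts.
  have h1 : Tendsto (fun j => ∑' x, max (h x - H j x) 0) l (𝓝 (∑' _ : X, (0 : ℝ))) := by
    refine tendsto_tsum_of_dominated_convergence hs.summable (fun x => ?_) ?_
    · have : Tendsto (fun j => max (h x - H j x) 0) l (𝓝 (max (h x - h x) 0)) :=
        ((tendsto_const_nhds.sub (hlim x)).max tendsto_const_nhds)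
      simpa using this
    · filter_upwards [hH] with j hj x
      rw [Real.norm_of_nonneg (le_max_right _ _)]
      exact max_le (by linarith [hj.1 x]) (hh x)
  rw [tsum_zero] at h1
  have h2 := h1.const_mul 2
  rw [mul_zero] at h2
  refine h2.congr' ?_
  filter_upwards [hH] with j hj
  have hsm : Summable fun x => max (h x - H j x) 0 := by
    refine Summable.of_nonneg_of_le (fun x => le_max_right _ _) (fun x => ?_) hs.summable
    exact max_le (by linarith [hj.1 x]) (hh x)
  have h3 := (hsm.hasSum.mul_left 2).add (hj.2.sub hs)
  rw [sub_self, add_zero] at h3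
  rw [← h3.tsum_eq]
  congr 1
  funext x
  rcases le_total (h x) (H j x) with hx | hx
  · rw [max_eq_right (by linarith), abs_of_nonneg (by linarith)]; ring
  · rw [max_eq_left (by linarith), abs_of_nonpos (by linarith)]; ring

theorem hasSum_empirical {κ X : Type*} [DecidableEq X] (E : Finset κ) (D : κ → X) (φ : X → ℝ) :
    HasSum (fun x => ((E.filter fun e => D e = x).card : ℝ) / E.card * φ x)
      ((∑ e ∈ E, φ (D e)) / E.card) := by
  have h : HasSum (fun x => ∑ e ∈ E, if x = D e then φ (D e) / E.card else 0)
      (∑ e ∈ E, φ (D e) / E.card) :=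
    hasSum_sum fun e _ => hasSum_ite_eq (D e) (φ (D e) / E.card)
  rw [Finset.sum_div]
  convert h using 2 with x
  rw [← Finset.sum_filter, Finset.sum_congr (g := fun _ => φ x / E.card) (s₂ := E.filter fun e => D e = x)]
  · rw [Finset.sum_const, nsmul_eq_mul]; ring
  · ext e; simp [eq_comm]
  · intro e he
    rw [(Finset.mem_filter.1 he).2]

/-- Empirical averages of functions bounded by one converge uniformly if the empirical
distributions converge pointwise to probability weights. -/
theorem exists_uniform_empirical {J X : Type*} [DecidableEq X] {l : Filter J} {κ : J → Type*}
    (E : ∀ j, Finset (κ j)) (D : ∀ j, κ j → X) {h : X → ℝ} (hh : ∀ x, 0 ≤ h x) (hs : HasSum h 1)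
    (hcard : Tendsto (fun j => ((E j).card : ℝ)) l atTop)
    (hlim : ∀ x, Tendsto (fun j => (((E j).filter fun e => D j e = x).card : ℝ) / (E j).card) l
      (𝓝 (h x))) :
    ∃ δ : J → ℝ, Tendsto δ l (𝓝 0) ∧ ∀ᶠ j in l, ∀ φ : X → ℝ, (∀ x, |φ x| ≤ 1) →
      |(∑ e ∈ E j, φ (D j e)) / (E j).card - ∑' x, h x * φ x| ≤ δ j := by
  have hH : ∀ᶠ j in l, (∀ x, 0 ≤ (((E j).filter fun e => D j e = x).card : ℝ) / (E j).card) ∧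
      HasSum (fun x => (((E j).filter fun e => D j e = x).card : ℝ) / (E j).card) 1 := by
    filter_upwards [hcard.eventually_gt_atTop 0] with j hj
    refine ⟨fun x => by positivity, ?_⟩
    have := hasSum_empirical (E j) (D j) (fun _ => 1)
    simp only [mul_one, Finset.sum_const, nsmul_eq_mul, div_self hj.ne'] at this
    exact this
  -- The error is the `ℓ¹` distance of the empirical weights from `h`. It does not depend on `φ`,
  -- which matters because the test functions used for ranks vary with the edge.
  refine ⟨_, tendsto_tsum_abs_sub hH hh hs hlim, ?_⟩
  filter_upwards [hH] with j hj φ hφ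
  have hsφ : Summable fun x => h x * φ x := by
    refine Summable.of_norm_bounded hs.summable fun x => ?_
    rw [norm_mul, Real.norm_of_nonneg (hh x)]
    exact mul_le_of_le_one_right (hh x) (hφ x)
  have h1 := (hasSum_empirical (E j) (D j) φ).sub hsφ.hasSum
  have h2 : Summable fun x => |(((E j).filter fun e => D j e = x).card : ℝ) / (E j).card - h x| :=
    (hj.2.sub hs).summable.abs
  have h3 := tsum_of_norm_bounded h2.hasSum (f := fun x =>
    (((E j).filter fun e => D j e = x).card : ℝ) / (E j).card * φ x - h x * φ x) fun x => by
      rw [← sub_mul, norm_mul]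
      exact mul_le_of_le_one_right (norm_nonneg _) (hφ x)
  rw [h1.tsum_eq] at h3
  exact h3

theorem abs_tsum_mul_le_one {X : Type*} {h φ : X → ℝ} (hh : ∀ x, 0 ≤ h x) (hs : HasSum h 1)
    (hφ : ∀ x, |φ x| ≤ 1) : |∑' x, h x * φ x| ≤ 1 := by
  refine tsum_of_norm_bounded (E := ℝ) hs fun x => ?_
  rw [norm_mul, Real.norm_of_nonneg (hh x)]
  exact mul_le_of_le_one_right (hh x) (hφ x)

theorem summable_mul_of_abs_le_one {X : Type*} {h φ : X → ℝ} (hh : ∀ x, 0 ≤ h x)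
    (hs : Summable h) (hφ : ∀ x, |φ x| ≤ 1) : Summable fun x => h x * φ x := by
  refine Summable.of_norm_bounded hs fun x => ?_
  rw [norm_mul, Real.norm_of_nonneg (hh x)]
  exact mul_le_of_le_one_right (hh x) (hφ x)

/-- Meant for quantities `A`, `B` attached to an edge that depend on the whole graph, such as
normalised ranks, once they are uniformly close to fixed functions of the degrees. -/
theorem tendsto_empirical_mul {J X : Type*} [DecidableEq X] {l : Filter J} {κ : J → Type*}
    (E : ∀ j, Finset (κ j)) (D : ∀ j, κ j → X) {h : X → ℝ} (hh : ∀ x, 0 ≤ h x) (hs : HasSum h 1)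
    (hcard : Tendsto (fun j => ((E j).card : ℝ)) l atTop)
    (hlim : ∀ x, Tendsto (fun j => (((E j).filter fun e => D j e = x).card : ℝ) / (E j).card) l
      (𝓝 (h x)))
    {a b : X → ℝ} (ha : ∀ x, |a x| ≤ 1) (hb : ∀ x, |b x| ≤ 1) (A B : ∀ j, κ j → ℝ)
    (ε ε' : J → ℝ) (hε : Tendsto ε l (𝓝 0)) (hε' : Tendsto ε' l (𝓝 0))
    (hA : ∀ᶠ j in l, ∀ e ∈ E j, |A j e - a (D j e)| ≤ ε j)
    (hB : ∀ᶠ j in l, ∀ e ∈ E j, |B j e - b (D j e)| ≤ ε' j) :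
    Tendsto (fun j => (∑ e ∈ E j, A j e * B j e) / (E j).card) l
      (𝓝 (∑' x, h x * (a x * b x))) := by
  obtain ⟨δ, hδ, hδ'⟩ := exists_uniform_empirical E D hh hs hcard hlim
  rw [tendsto_iff_norm_sub_tendsto_zero]
  have hbound : Tendsto (fun j => ε j * (1 + ε' j) + ε' j + δ j) l (𝓝 0) := by
    have := ((hε.mul ((tendsto_const_nhds (x := (1 : ℝ))).add hε')).add hε').add hδ
    simpa using this
  refine squeeze_zero' (Eventually.of_forall fun _ => norm_nonneg _) ?_ hbound
  filter_upwards [hA, hB, hδ', hcard.eventually_gt_atTop 0] with j hAj hBj hj hm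
  have h1 := hj (fun x => a x * b x) fun x => by
    rw [abs_mul]; exact mul_le_one₀ (ha x) (abs_nonneg _) (hb x)
  have h2 : |(∑ e ∈ E j, A j e * B j e) / (E j).card
      - (∑ e ∈ E j, a (D j e) * b (D j e)) / (E j).card| ≤ ε j * (1 + ε' j) + ε' j := by
    rw [← sub_div, ← Finset.sum_sub_distrib, abs_div, abs_of_pos hm, div_le_iff₀ hm]
    refine (Finset.abs_sum_le_sum_abs _ _).trans ?_
    have : ∀ e ∈ E j, |A j e * B j e - a (D j e) * b (D j e)| ≤ ε j * (1 + ε' j) + ε' j := by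
      intro e he
      have e1 : A j e * B j e - a (D j e) * b (D j e)
          = (A j e - a (D j e)) * B j e + a (D j e) * (B j e - b (D j e)) := by ring
      have e2 : |B j e| ≤ 1 + ε' j := by
        have := abs_add_le (b (D j e)) (B j e - b (D j e))
        rw [add_sub_cancel] at this
        linarith [hb (D j e), hBj e he]
      rw [e1]
      refine (abs_add_le _ _).trans ?_
      rw [abs_mul, abs_mul]
      refine add_le_add (mul_le_mul (hAj e he) e2 (abs_nonneg _)
        ((abs_nonneg _).trans (hAj e he))) ?_
      calc |a (D j e)| * |B j e - b (D j e)| ≤ 1 * ε' j :=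
            mul_le_mul (ha _) (hBj e he) (abs_nonneg _) zero_le_one
        _ = ε' j := one_mul _
    refine (Finset.sum_le_sum this).trans (le_of_eq ?_)
    rw [Finset.sum_const, nsmul_eq_mul, mul_comm]
  rw [Real.norm_eq_abs]
  refine (abs_sub_le _ ((∑ e ∈ E j, a (D j e) * b (D j e)) / (E j).card) _).trans ?_
  linarith

/-! ### Rank correlations of asymptotically independent degrees -/

/-- The contribution of a value `l` to the average rank of a value `k`. -/
noncomputable def rankWeight (k l : ℕ) : ℝ :=
  (if k < l then 1 else 0) + 1 / 2 * (if l = k then 1 else 0)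

theorem rankWeight_add_comm (k l : ℕ) : rankWeight k l + rankWeight l k = 1 := by
  unfold rankWeight
  rcases lt_trichotomy k l with h | h | h
  · simp [h, h.not_gt, h.ne, h.ne']
  · simp [h]; norm_num
  · simp [h, h.not_gt, h.ne, h.ne']

theorem rankWeight_nonneg (k l : ℕ) : 0 ≤ rankWeight k l := by
  unfold rankWeight; positivity

theorem abs_rankWeight_le_one (k l : ℕ) : |rankWeight k l| ≤ 1 := by
  rw [abs_of_nonneg (rankWeight_nonneg k l)]
  linarith [rankWeight_add_comm k l, rankWeight_nonneg l k]

/-- The sign of `k - l`. -/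
theorem one_sub_two_mul_rankWeight (k l : ℕ) :
    1 - 2 * rankWeight k l = ((((k : ℤ) - l).sign : ℤ) : ℝ) := by
  unfold rankWeight
  rcases lt_trichotomy k l with h | h | h
  · rw [Int.sign_eq_neg_one_of_neg (by omega)]; simp [h, h.ne']; norm_num
  · subst h; simp
  · rw [Int.sign_eq_one_of_pos (by omega)]; simp [h.not_gt, h.ne]

/-- The limiting normalised average rank of the value `k`. -/
noncomputable def midSurvival (f : ℕ → ℝ) (k : ℕ) : ℝ := ∑' l, f l * rankWeight k l

/-! ### Limiting ranks under a probability weight on the natural numbers. -/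

section MidSurvival

variable {f : ℕ → ℝ} (hf : ∀ k, 0 ≤ f k) (hf1 : HasSum f 1)
include hf hf1

theorem abs_midSurvival_le_one (k : ℕ) : |midSurvival f k| ≤ 1 :=
  abs_tsum_mul_le_one hf hf1 fun l => abs_rankWeight_le_one k l

/-- For two independent variables of law `f`, exchanging them turns `rankWeight k l` into `1 -
rankWeight k l`; hence its mean is `1/2`. -/
theorem tsum_mul_midSurvival : ∑' k, f k * midSurvival f k = 1 / 2 := by
  have hs : Summable fun p : ℕ × ℕ => f p.1 * f p.2 :=
    hf1.summable.mul_of_nonneg hf1.summable hf hf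
  have hs1 : Summable fun p : ℕ × ℕ => f p.1 * f p.2 * rankWeight p.1 p.2 :=
    summable_mul_of_abs_le_one (fun p => mul_nonneg (hf _) (hf _)) hs
      fun p => abs_rankWeight_le_one _ _
  have h1 : ∑' k, f k * midSurvival f k = ∑' p : ℕ × ℕ, f p.1 * f p.2 * rankWeight p.1 p.2 := by
    rw [hs1.tsum_prod]
    refine tsum_congr fun k => ?_
    rw [midSurvival, ← tsum_mul_left]
    simp only [mul_assoc]
  have h2 : ∑' p : ℕ × ℕ, f p.1 * f p.2 * rankWeight p.1 p.2
      = ∑' p : ℕ × ℕ, f p.1 * f p.2 * rankWeight p.2 p.1 := by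
    rw [← (Equiv.prodComm ℕ ℕ).tsum_eq]
    refine tsum_congr fun p => ?_
    simp [mul_comm (f p.1)]
  have hs2 : Summable fun p : ℕ × ℕ => f p.1 * f p.2 * rankWeight p.2 p.1 :=
    summable_mul_of_abs_le_one (fun p => mul_nonneg (hf _) (hf _)) hs
      fun p => abs_rankWeight_le_one _ _
  have h3 : ∑' p : ℕ × ℕ, f p.1 * f p.2 * rankWeight p.1 p.2
      + ∑' p : ℕ × ℕ, f p.1 * f p.2 * rankWeight p.2 p.1 = 1 := by
    rw [← hs1.tsum_add hs2]
    have : ∀ p : ℕ × ℕ, f p.1 * f p.2 * rankWeight p.1 p.2 + f p.1 * f p.2 * rankWeight p.2 p.1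
        = f p.1 * f p.2 := fun p => by rw [← mul_add, rankWeight_add_comm, mul_one]
    simp only [this]
    rw [← hf1.summable.tsum_mul_tsum hf1.summable hs, hf1.tsum_eq, one_mul]
  rw [h1]; linarith

/-- Raising the value from `k` to `l` loses at least the half of the atom at `k` that was counted as
a tie. -/
theorem midSurvival_lt_of_lt {k l : ℕ} (hkl : k < l) (hk : 0 < f k) :
    midSurvival f l < midSurvival f k := by
  refine Summable.tsum_lt_tsum (i := k) (fun j => ?_) ?_
    (summable_mul_of_abs_le_one hf hf1.summable fun j => abs_rankWeight_le_one l j)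
    (summable_mul_of_abs_le_one hf hf1.summable fun j => abs_rankWeight_le_one k j)
  · refine mul_le_mul_of_nonneg_left ?_ (hf j)
    unfold rankWeight
    split_ifs <;> first | omega | norm_num
  · refine mul_lt_mul_of_pos_left ?_ hk
    unfold rankWeight
    simp [hkl.ne, hkl.not_gt]

/-- The excess over `1/4` is the variance of the limiting rank, whose mean is `1/2`. Without an atom
of mass one there are two atoms, at which the rank takes different values, so the variance is
positive. -/
theorem one_quarter_lt_tsum_midSurvival_sq (hne : ∀ k, f k ≠ 1) :
    1 / 4 < ∑' k, f k * (midSurvival f k * midSurvival f k) := by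
  have hb := abs_midSurvival_le_one hf hf1
  have hs2 : Summable fun k => f k * (midSurvival f k * midSurvival f k) :=
    summable_mul_of_abs_le_one hf hf1.summable fun k => by
      rw [abs_mul]; exact mul_le_one₀ (hb k) (abs_nonneg _) (hb k)
  have hs1 := summable_mul_of_abs_le_one hf hf1.summable hb
  have hsum : HasSum (fun k => f k * (midSurvival f k - 1 / 2) ^ 2)
      (∑' k, f k * (midSurvival f k * midSurvival f k) - 1 * (1 / 2) + 1 / 4 * 1) := by
    have := (hs2.hasSum.sub (hs1.hasSum.mul_left 1)).add (hf1.mul_left (1 / 4))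
    rw [tsum_mul_midSurvival hf hf1] at this
    have heq : (fun k => f k * (midSurvival f k - 1 / 2) ^ 2) = fun k =>
        f k * (midSurvival f k * midSurvival f k) - 1 * (f k * midSurvival f k) + 1 / 4 * f k := by
      funext k; ring
    rw [heq]
    exact this
  have hatoms : ∃ k l, k < l ∧ 0 < f k ∧ 0 < f l := by
    have h1 : ∃ k, f k ≠ 0 := by
      by_contra! h
      have := hf1.unique (show HasSum f 0 from (by simp [funext h, hasSum_zero]))
      norm_num at this
    obtain ⟨k, hk⟩ := h1
    have h2 : ∃ l, l ≠ k ∧ f l ≠ 0 := by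
      by_contra! h
      exact hne k ((hasSum_single k h).unique hf1)
    obtain ⟨l, hlk, hl⟩ := h2
    have hk' := (hf k).lt_of_ne' hk
    have hl' := (hf l).lt_of_ne' hl
    rcases lt_or_gt_of_ne hlk with h | h
    · exact ⟨l, k, h, hl', hk'⟩
    · exact ⟨k, l, h, hk', hl'⟩
  obtain ⟨k, l, hkl, hk, hl⟩ := hatoms
  have hlt := midSurvival_lt_of_lt hf hf1 hkl hk
  have hpos : 0 < ∑' k, f k * (midSurvival f k - 1 / 2) ^ 2 := by
    by_cases hz : midSurvival f k = 1 / 2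
    · refine hsum.summable.tsum_pos (fun j => mul_nonneg (hf j) (sq_nonneg _)) l ?_
      have : midSurvival f l - 1 / 2 ≠ 0 := by linarith
      positivity
    · refine hsum.summable.tsum_pos (fun j => mul_nonneg (hf j) (sq_nonneg _)) k ?_
      have : midSurvival f k - 1 / 2 ≠ 0 := sub_ne_zero.2 hz
      positivity
  rw [hsum.tsum_eq] at hpos
  linarith

end MidSurvival

/-! ### Rank statistics along a filter when the joint law of the two values tends to a product. -/

section Limits

variable {J : Type*} {l : Filter J} {V : J → Type*} (E : ∀ j, Finset (V j × V j))
  (D D' : ∀ j, V j × V j → ℕ) {f g : ℕ → ℝ}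
  (hf : ∀ k, 0 ≤ f k) (hf1 : HasSum f 1) (hg : ∀ k, 0 ≤ g k) (hg1 : HasSum g 1)
  (hcard : Tendsto (fun j => ((E j).card : ℝ)) l atTop)
  (hlim : ∀ x : ℕ × ℕ, Tendsto (fun j =>
    (((E j).filter fun e => (D j e, D' j e) = x).card : ℝ) / (E j).card) l (𝓝 (f x.1 * g x.2)))

include hf hf1 hg hg1

theorem hasSum_prod_weights : HasSum (fun x : ℕ × ℕ => f x.1 * g x.2) 1 := by
  have hs := hf1.summable.mul_of_nonneg hg1.summable hf hg
  have := hs.hasSum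
  rwa [← hf1.summable.tsum_mul_tsum hg1.summable hs, hf1.tsum_eq, hg1.tsum_eq, one_mul] at this

theorem tsum_prod_weights_mul {a b : ℕ → ℝ} (ha : ∀ k, |a k| ≤ 1) (hb : ∀ k, |b k| ≤ 1) :
    ∑' x : ℕ × ℕ, f x.1 * g x.2 * (a x.1 * b x.2) = (∑' k, f k * a k) * ∑' k, g k * b k := by
  have hs : Summable fun x : ℕ × ℕ => f x.1 * g x.2 * (a x.1 * b x.2) :=
    summable_mul_of_abs_le_one (fun x => mul_nonneg (hf _) (hg _))
      (hasSum_prod_weights hf hf1 hg hg1).summable fun x => by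
        rw [abs_mul]; exact mul_le_one₀ (ha _) (abs_nonneg _) (hb _)
  have heq : (fun x : ℕ × ℕ => f x.1 * g x.2 * (a x.1 * b x.2))
      = fun x : ℕ × ℕ => f x.1 * a x.1 * (g x.2 * b x.2) := by funext x; ring
  rw [heq] at hs ⊢
  exact ((summable_mul_of_abs_le_one hf hf1.summable ha).tsum_mul_tsum
    (summable_mul_of_abs_le_one hg hg1.summable hb) hs).symm

theorem tsum_prod_weights_fst {a : ℕ → ℝ} (ha : ∀ k, |a k| ≤ 1) :
    ∑' x : ℕ × ℕ, f x.1 * g x.2 * a x.1 = ∑' k, f k * a k := by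
  have := tsum_prod_weights_mul hf hf1 hg hg1 ha (b := fun _ => 1) (by simp)
  simpa [hg1.tsum_eq] using this

include hcard hlim

/-- Normalised average ranks at the sources converge uniformly. -/
theorem exists_averageRank_bound_fst : ∃ ε : J → ℝ, Tendsto ε l (𝓝 0) ∧ ∀ᶠ j in l,
    ∀ e ∈ E j, |averageRank (E j) (D j) e / (E j).card - midSurvival f (D j e)| ≤ ε j := by
  obtain ⟨δ, hδ, hδ'⟩ := exists_uniform_empirical E (fun j e => (D j e, D' j e))
    (fun x => mul_nonneg (hf x.1) (hg x.2)) (hasSum_prod_weights hf hf1 hg hg1) hcard hlim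
  -- The first term comes from the additive `1/2` in the average rank, the second from the empirical
  -- average of `rankWeight`, uniformly in the value of `e`.
  refine ⟨fun j => (1 / 2) / (E j).card + δ j, ?_, ?_⟩
  · simpa using (hcard.const_div_atTop (1 / 2)).add hδ
  · filter_upwards [hδ'] with j hj e _
    have h1 := hj (fun x => rankWeight (D j e) x.1) fun x => abs_rankWeight_le_one _ _
    rw [tsum_prod_weights_fst hf hf1 hg hg1 fun k => abs_rankWeight_le_one _ k] at h1
    have h2 : averageRank (E j) (D j) e / (E j).card = (1 / 2) / (E j).card
        + (∑ e' ∈ E j, rankWeight (D j e) (D j e')) / (E j).card := by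
      rw [averageRank, add_div]; rfl
    rw [h2, add_sub_assoc]
    refine (abs_add_le _ _).trans (add_le_add (le_of_eq (abs_of_nonneg (by positivity))) h1)

/-- Normalised average ranks at the targets converge uniformly. -/
theorem exists_averageRank_bound_snd : ∃ ε : J → ℝ, Tendsto ε l (𝓝 0) ∧ ∀ᶠ j in l,
    ∀ e ∈ E j, |averageRank (E j) (D' j) e / (E j).card - midSurvival g (D' j e)| ≤ ε j := by
  refine exists_averageRank_bound_fst E D' D hg hg1 hf hf1 hcard fun x => ?_
  have := hlim x.swap
  simp only [Prod.fst_swap, Prod.snd_swap] at this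
  rw [mul_comm]
  refine this.congr fun j => ?_
  congr 3
  ext e
  simp [Prod.ext_iff, and_comm]

/-- Under the product law the mean of the product is the product of the means, each `1/2`. Four
times this limit cancels the leading term of `|E| (|E| + 1)²`. -/
theorem tendsto_averageRank_mul :
    Tendsto (fun j => (∑ e ∈ E j, averageRank (E j) (D j) e / (E j).card
      * (averageRank (E j) (D' j) e / (E j).card)) / (E j).card) l (𝓝 (1 / 4)) := by
  obtain ⟨ε, hε, hA⟩ := exists_averageRank_bound_fst E D D' hf hf1 hg hg1 hcard hlim
  obtain ⟨ε', hε', hB⟩ := exists_averageRank_bound_snd E D D' hf hf1 hg hg1 hcard hlim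
  have := tendsto_empirical_mul E (fun j e => (D j e, D' j e))
    (fun x => mul_nonneg (hf x.1) (hg x.2)) (hasSum_prod_weights hf hf1 hg hg1) hcard hlim
    (fun x => abs_midSurvival_le_one hf hf1 x.1) (fun x => abs_midSurvival_le_one hg hg1 x.2)
    _ _ ε ε' hε hε' hA hB
  rw [tsum_prod_weights_mul hf hf1 hg hg1 (abs_midSurvival_le_one hf hf1)
    (abs_midSurvival_le_one hg hg1), tsum_mul_midSurvival hf hf1, tsum_mul_midSurvival hg hg1]
    at this
  convert this using 2
  norm_num

theorem tendsto_averageRank_sq :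
    Tendsto (fun j => (∑ e ∈ E j, averageRank (E j) (D j) e / (E j).card
      * (averageRank (E j) (D j) e / (E j).card)) / (E j).card) l
      (𝓝 (∑' k, f k * (midSurvival f k * midSurvival f k))) := by
  obtain ⟨ε, hε, hA⟩ := exists_averageRank_bound_fst E D D' hf hf1 hg hg1 hcard hlim
  have hb := abs_midSurvival_le_one hf hf1
  have := tendsto_empirical_mul E (fun j e => (D j e, D' j e))
    (fun x => mul_nonneg (hf x.1) (hg x.2)) (hasSum_prod_weights hf hf1 hg hg1) hcard hlim
    (fun x => hb x.1) (fun x => hb x.1)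
    _ _ ε ε hε hε hA hA
  rwa [tsum_prod_weights_fst hf hf1 hg hg1
    (a := fun k => midSurvival f k * midSurvival f k) fun k => by
      rw [abs_mul]; exact mul_le_one₀ (hb k) (abs_nonneg _) (hb k)] at this

/-- The limit of the normalised squared deviation of the average ranks. -/
theorem tendsto_averageRankDeviation_fst :
    Tendsto (fun j => averageRankDeviation (E j) (D j) / Real.sqrt ((E j).card ^ 3)) l
      (𝓝 (Real.sqrt (4 * ∑' k, f k * (midSurvival f k * midSurvival f k) - 1))) := by
  have h1 := tendsto_averageRank_sq E D D' hf hf1 hg hg1 hcard hlim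
  have hinv : Tendsto (fun j => (1 + 1 / ((E j).card : ℝ)) ^ 2) l (𝓝 1) := by
    have := ((hcard.const_div_atTop 1).const_add 1).pow 2
    simpa using this
  refine ((h1.const_mul 4).sub hinv).sqrt.congr' ?_
  filter_upwards [hcard.eventually_gt_atTop 0] with j hj
  rw [averageRankDeviation, ← Real.sqrt_div' _ (by positivity)]
  congr 1
  have : ∑ e ∈ E j, averageRank (E j) (D j) e / (E j).card
      * (averageRank (E j) (D j) e / (E j).card)
      = (∑ e ∈ E j, averageRank (E j) (D j) e ^ 2) / (E j).card ^ 2 := by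
    rw [Finset.sum_div]; exact Finset.sum_congr rfl fun e _ => by ring
  rw [this]
  field_simp

theorem tendsto_averageRankDeviation_snd :
    Tendsto (fun j => averageRankDeviation (E j) (D' j) / Real.sqrt ((E j).card ^ 3)) l
      (𝓝 (Real.sqrt (4 * ∑' k, g k * (midSurvival g k * midSurvival g k) - 1))) := by
  refine tendsto_averageRankDeviation_fst E D' D hg hg1 hf hf1 hcard fun x => ?_
  have := hlim x.swap
  simp only [Prod.fst_swap, Prod.snd_swap] at this
  rw [mul_comm]
  refine this.congr fun j => ?_
  congr 3
  ext e
  simp [Prod.ext_iff, and_comm]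

theorem tendsto_averageRank_mul_sub :
    Tendsto (fun j => (4 * ∑ e ∈ E j, averageRank (E j) (D j) e * averageRank (E j) (D' j) e
      - ((E j).card : ℝ) * ((E j).card + 1) ^ 2) / (E j).card ^ 3) l (𝓝 0) := by
  have h1 := tendsto_averageRank_mul E D D' hf hf1 hg hg1 hcard hlim
  have hinv : Tendsto (fun j => (1 + 1 / ((E j).card : ℝ)) ^ 2) l (𝓝 1) := by
    have := ((hcard.const_div_atTop 1).const_add 1).pow 2
    simpa using this
  have h2 := (h1.const_mul 4).sub hinv
  norm_num only at h2
  refine h2.congr' ?_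
  filter_upwards [hcard.eventually_gt_atTop 0] with j hj
  have : ∑ e ∈ E j, averageRank (E j) (D j) e / (E j).card
      * (averageRank (E j) (D' j) e / (E j).card)
      = (∑ e ∈ E j, averageRank (E j) (D j) e * averageRank (E j) (D' j) e)
        / (E j).card ^ 2 := by
    rw [Finset.sum_div]; exact Finset.sum_congr rfl fun e _ => by ring
  rw [this]
  field_simp

theorem tendsto_averageRank_correlation (hf_ne : ∀ k, f k ≠ 1) (hg_ne : ∀ k, g k ≠ 1) :
    Tendsto (fun j => (4 * ∑ e ∈ E j, averageRank (E j) (D j) e * averageRank (E j) (D' j) e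
      - ((E j).card : ℝ) * ((E j).card + 1) ^ 2)
        / (averageRankDeviation (E j) (D j) * averageRankDeviation (E j) (D' j))) l (𝓝 0) := by
  have h1 := tendsto_averageRankDeviation_fst E D D' hf hf1 hg hg1 hcard hlim
  have h2 := tendsto_averageRankDeviation_snd E D D' hf hf1 hg hg1 hcard hlim
  have h3 := tendsto_averageRank_mul_sub E D D' hf hf1 hg hg1 hcard hlim
  have h4 := one_quarter_lt_tsum_midSurvival_sq hf hf1 hf_ne
  have h5 := one_quarter_lt_tsum_midSurvival_sq hg hg1 hg_ne
  -- Both spreads have positive limits by the absence of an atom of mass one; the two factors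
  -- `√(|E|³)` cancel the `|E|³` of the numerator.
  have h6 := h3.div (h1.mul h2) (mul_pos (Real.sqrt_pos.2 (by linarith))
    (Real.sqrt_pos.2 (by linarith))).ne'
  rw [zero_div] at h6
  refine h6.congr' ?_
  filter_upwards [hcard.eventually_gt_atTop 0] with j hj
  have hp : (0 : ℝ) < (E j).card ^ 3 := by positivity
  simp only [Pi.div_apply]
  rw [div_mul_div_comm, Real.mul_self_sqrt hp.le, div_div_div_cancel_right₀ hp.ne']

/-- For a fixed edge the average over the other one is uniformly close to `(1 - 2 * midSurvival f) *
(1 - 2 * midSurvival g)` at its degrees, a product of functions of mean zero. No spread is divided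
by, so point masses are harmless here. -/
theorem tendsto_sum_sign_mul_sign :
    Tendsto (fun j => (∑ e ∈ E j, ∑ e' ∈ E j, (1 - 2 * rankWeight (D j e) (D j e'))
      * (1 - 2 * rankWeight (D' j e) (D' j e'))) / (E j).card ^ 2) l (𝓝 0) := by
  obtain ⟨δ, hδ, hδ'⟩ := exists_uniform_empirical E (fun j e => (D j e, D' j e))
    (fun x => mul_nonneg (hf x.1) (hg x.2)) (hasSum_prod_weights hf hf1 hg hg1) hcard hlim
  have habs : ∀ k k', |1 - 2 * rankWeight k k'| ≤ 1 := fun k k' => by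
    have h1 := rankWeight_nonneg k k'
    have h2 := rankWeight_nonneg k' k
    have h3 := rankWeight_add_comm k k'
    rw [abs_le]; constructor <;> linarith
  have hmean : ∀ {h : ℕ → ℝ}, (∀ k, 0 ≤ h k) → HasSum h 1 → ∀ k,
      ∑' k', h k' * (1 - 2 * rankWeight k k') = 1 - 2 * midSurvival h k := by
    intro h hh hs k
    have := (hs.sub ((summable_mul_of_abs_le_one hh hs.summable
      (abs_rankWeight_le_one k)).hasSum.mul_left 2)).tsum_eq
    rw [midSurvival, ← this]
    exact tsum_congr fun k' => by ring
  have hmean0 : ∀ {h : ℕ → ℝ}, (∀ k, 0 ≤ h k) → HasSum h 1 →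
      ∑' k, h k * (1 - 2 * midSurvival h k) = 0 := by
    intro h hh hs
    have := (hs.sub ((summable_mul_of_abs_le_one hh hs.summable
      (abs_midSurvival_le_one hh hs)).hasSum.mul_left 2)).tsum_eq
    rw [tsum_mul_midSurvival hh hs] at this
    rw [show (0 : ℝ) = 1 - 2 * (1 / 2) by norm_num, ← this]
    exact tsum_congr fun k' => by ring
  have habs' : ∀ {h : ℕ → ℝ}, (∀ k, 0 ≤ h k) → HasSum h 1 → ∀ k,
      |1 - 2 * midSurvival h k| ≤ 1 := fun hh hs k => by
    rw [← hmean hh hs]; exact abs_tsum_mul_le_one hh hs (habs k)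
  -- The inner average plays the role of `A`, and the constant one that of `B`.
  have := tendsto_empirical_mul E (fun j e => (D j e, D' j e))
    (fun x => mul_nonneg (hf x.1) (hg x.2)) (hasSum_prod_weights hf hf1 hg hg1) hcard hlim
    (a := fun x => (1 - 2 * midSurvival f x.1) * (1 - 2 * midSurvival g x.2)) (b := fun _ => 1)
    (fun x => by
      rw [abs_mul]; exact mul_le_one₀ (habs' hf hf1 _) (abs_nonneg _) (habs' hg hg1 _))
    (by simp)
    (fun j e => (∑ e' ∈ E j, (1 - 2 * rankWeight (D j e) (D j e'))
      * (1 - 2 * rankWeight (D' j e) (D' j e'))) / (E j).card) (fun _ _ => 1) δ 0 hδ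
    tendsto_const_nhds ?_ (by simp)
  · simp only [mul_one] at this
    rw [tsum_prod_weights_mul hf hf1 hg hg1 (habs' hf hf1) (habs' hg hg1), hmean0 hf hf1,
      zero_mul] at this
    refine this.congr fun j => ?_
    rw [← Finset.sum_div, div_div, sq]
  · filter_upwards [hδ'] with j hj e _
    have h1 := hj (fun x => (1 - 2 * rankWeight (D j e) x.1) * (1 - 2 * rankWeight (D' j e) x.2))
      fun x => by rw [abs_mul]; exact mul_le_one₀ (habs _ _) (abs_nonneg _) (habs _ _)
    rwa [tsum_prod_weights_mul hf hf1 hg hg1 (habs _) (habs _), hmean hf hf1, hmean hg hg1] at h1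

end Limits

/-- The difference of the two indicators is the sign of `pairSign`, and signs are multiplicative.
The factor `2` undoes the halving of ordered pairs, and diagonal pairs have sign zero. -/
theorem kendall_eq {V : Type*} [DecidableEq V] (E : Finset (V × V)) (α β : DegreeType) :
    kendall E α β = (∑ e ∈ E, ∑ e' ∈ E,
      (1 - 2 * rankWeight (sourceDegree E α e) (sourceDegree E α e'))
        * (1 - 2 * rankWeight (targetDegree E β e) (targetDegree E β e')))
      / ((E.card : ℝ) * ((E.card : ℝ) - 1)) := by
  rw [kendall, concordantPairs, discordantPairs]
  congr 1
  rw [← Finset.sum_product', ← sub_div, mul_div_cancel₀ _ two_ne_zero, Finset.card_filter,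
    Finset.card_filter]
  push_cast
  rw [← Finset.sum_sub_distrib]
  refine Finset.sum_congr rfl fun p _ => ?_
  rw [one_sub_two_mul_rankWeight, one_sub_two_mul_rankWeight, ← Int.cast_mul, ← Int.sign_mul]
  change _ = (((pairSign E α β p.1 p.2).sign : ℤ) : ℝ)
  rcases lt_trichotomy (pairSign E α β p.1 p.2) 0 with h | h | h
  · rw [Int.sign_eq_neg_one_of_neg h]; simp [h, h.not_gt]
  · simp [h]
  · rw [Int.sign_eq_one_of_pos h]; simp [h, h.not_gt]

section Degrees

variable {J : Type*} {l : Filter J} {V : J → Type*} [∀ j, DecidableEq (V j)]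
  (E : ∀ j, Finset (V j × V j)) (α β : DegreeType) {f g : ℕ → ℝ}
  (hf : ∀ k, 0 ≤ f k) (hf1 : HasSum f 1) (hg : ∀ k, 0 ≤ g k) (hg1 : HasSum g 1)
  (hcard : Tendsto (fun j => ((E j).card : ℝ)) l atTop)
  (hlim : ∀ x : ℕ × ℕ, Tendsto (fun j => (((E j).filter fun e =>
    (sourceDegree (E j) α e, targetDegree (E j) β e) = x).card : ℝ) / (E j).card) l
      (𝓝 (f x.1 * g x.2)))
include hf hf1 hg hg1 hcard hlim

theorem tendsto_spearmanAverage (hf_ne : ∀ k, f k ≠ 1) (hg_ne : ∀ k, g k ≠ 1) :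
    Tendsto (fun j => spearmanAverage (E j) α β) l (𝓝 0) :=
  tendsto_averageRank_correlation E _ _ hf hf1 hg hg1 hcard hlim hf_ne hg_ne

theorem tendsto_kendall : Tendsto (fun j => kendall (E j) α β) l (𝓝 0) := by
  have h1 := tendsto_sum_sign_mul_sign E _ _ hf hf1 hg hg1 hcard hlim
  have h2 : Tendsto (fun j => 1 - 1 / ((E j).card : ℝ)) l (𝓝 1) := by
    simpa using (hcard.const_div_atTop 1).const_sub 1
  have h3 := h1.div h2 one_ne_zero
  rw [zero_div] at h3
  refine h3.congr' ?_
  filter_upwards [hcard.eventually_gt_atTop 1] with j hj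
  have hj1 : ((E j).card : ℝ) - 1 ≠ 0 := by linarith
  have hj0 : ((E j).card : ℝ) ≠ 0 := by linarith
  simp only [Pi.div_apply]
  rw [kendall_eq]
  field_simp

theorem tendsto_averageRank_spearman :
    Tendsto (fun j => (12 * ∑ e ∈ E j, averageRank (E j) (sourceDegree (E j) α) e
        * averageRank (E j) (targetDegree (E j) β) e
      - 3 * ((E j).card : ℝ) * ((E j).card + 1) ^ 2) / (((E j).card : ℝ) ^ 3 - (E j).card)) l
      (𝓝 0) := by
  -- The numerator is three times the centred sum already treated, and `|E|^3 - |E|` is of order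
  -- `|E|^3` whatever the degrees are; no spread has to be bounded from below.
  have h1 := (tendsto_averageRank_mul_sub E _ _ hf hf1 hg hg1 hcard hlim).const_mul 3
  have h2 : Tendsto (fun j => 1 - (1 / ((E j).card : ℝ)) ^ 2) l (𝓝 1) := by
    simpa using ((hcard.const_div_atTop 1).pow 2).const_sub 1
  have h3 := h1.div h2 one_ne_zero
  rw [mul_zero, zero_div] at h3
  refine h3.congr' ?_
  filter_upwards [hcard.eventually_gt_atTop 1] with j hj
  have hj0 : ((E j).card : ℝ) ≠ 0 := by linarith
  have hj1 : ((E j).card : ℝ) ^ 2 - 1 ≠ 0 := by nlinarith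
  have hj2 : ((E j).card : ℝ) ^ 3 - (E j).card ≠ 0 := by
    rw [show ((E j).card : ℝ) ^ 3 - (E j).card = (E j).card * (((E j).card : ℝ) ^ 2 - 1) by ring]
    exact mul_ne_zero hj0 hj1
  simp only [Pi.div_apply]
  field_simp
  ring

end Degrees

/-! ### Uniform resolution of ties -/

/-- The uniform distribution on `[0, 1)`. -/
noncomputable abbrev unitLaw : Measure ℝ := (volume : Measure ℝ).restrict (Set.Ico 0 1)

instance : IsProbabilityMeasure unitLaw := ⟨by simp⟩

instance (n : ℕ) : IsProbabilityMeasure (tieLaw n) := by unfold tieLaw; infer_instance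

theorem ae_mem_Ico_unitLaw : ∀ᵐ x ∂unitLaw, x ∈ Set.Ico (0 : ℝ) 1 :=
  ae_restrict_mem measurableSet_Ico

theorem measurableSet_fst_le_snd (c d : ℝ) : MeasurableSet {p : ℝ × ℝ | c + p.1 ≤ d + p.2} :=
  measurableSet_le (by fun_prop) (by fun_prop)

theorem unitLaw_prod_real_le : (unitLaw.prod unitLaw).real {p | p.1 ≤ p.2} = 1 / 2 := by
  have h0 : MeasurableSet {p : ℝ × ℝ | p.1 ≤ p.2} := measurableSet_le (by fun_prop) (by fun_prop)
  have h0' : MeasurableSet {p : ℝ × ℝ | p.2 ≤ p.1} := measurableSet_le (by fun_prop) (by fun_prop)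
  have h1 : (unitLaw.prod unitLaw).real {p | p.2 ≤ p.1}
      = (unitLaw.prod unitLaw).real {p | p.1 ≤ p.2} := by
    have := (Measure.measurePreserving_swap (μ := unitLaw) (ν := unitLaw)).measureReal_preimage
      h0.nullMeasurableSet
    rw [← this]; rfl
  have h2 : (unitLaw.prod unitLaw).real ({p | p.1 ≤ p.2} ∩ {p | p.2 ≤ p.1}) = 0 := by
    rw [measureReal_eq_zero_iff, Measure.measure_prod_null (h0.inter h0')]
    refine Eventually.of_forall fun x => ?_
    refine measure_mono_null (t := {x}) ?_ (by simp)
    rintro y ⟨hy1, hy2⟩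
    exact le_antisymm hy2 hy1
  have h3 := measureReal_union_add_inter (μ := unitLaw.prod unitLaw) (s := {p | p.1 ≤ p.2}) h0'
  have h4 : ({p | p.1 ≤ p.2} ∪ {p | p.2 ≤ p.1} : Set (ℝ × ℝ)) = Set.univ := by
    ext p; simpa using le_total p.1 p.2
  rw [h4, h2, h1, probReal_univ] at h3
  linarith

/-- Distinct integers differ by at least one, which variables in `[0, 1)` cannot reverse; equal ones
are ordered by a fair coin. Hence `rankWeight` is the mean of the randomised comparison. -/
theorem unitLaw_prod_real_rank (k l : ℕ) :
    (unitLaw.prod unitLaw).real {p | (k : ℝ) + p.1 ≤ (l : ℝ) + p.2} = rankWeight k l := by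
  have hae : ∀ᵐ p ∂unitLaw.prod unitLaw, p.1 ∈ Set.Ico (0 : ℝ) 1 ∧ p.2 ∈ Set.Ico (0 : ℝ) 1 :=
    (Measure.quasiMeasurePreserving_fst.ae ae_mem_Ico_unitLaw).and
      (Measure.quasiMeasurePreserving_snd.ae ae_mem_Ico_unitLaw)
  unfold rankWeight
  rcases lt_trichotomy k l with h | h | h
  · have h' : (k : ℝ) + 1 ≤ l := by exact_mod_cast h
    have : (unitLaw.prod unitLaw).real {p | (k : ℝ) + p.1 ≤ (l : ℝ) + p.2}
        = (unitLaw.prod unitLaw).real Set.univ := by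
      refine measureReal_congr ?_
      filter_upwards [hae] with p hp
      refine propext ⟨fun _ => trivial, fun _ => ?_⟩
      change (k : ℝ) + p.1 ≤ (l : ℝ) + p.2
      linarith [hp.1.2, hp.2.1]
    rw [this]; simp [h, h.ne']
  · subst h
    simpa using unitLaw_prod_real_le
  · have h' : (l : ℝ) + 1 ≤ k := by exact_mod_cast h
    have : (unitLaw.prod unitLaw).real {p | (k : ℝ) + p.1 ≤ (l : ℝ) + p.2}
        = (unitLaw.prod unitLaw).real ∅ := by
      refine measureReal_congr ?_
      filter_upwards [hae] with p hp
      refine propext ⟨fun hc => ?_, fun hc => hc.elim⟩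
      replace hc : (k : ℝ) + p.1 ≤ (l : ℝ) + p.2 := hc
      exact absurd hc (by linarith [hp.2.2, hp.1.1])
    rw [this]; simp [h.not_gt, h.ne]

theorem iIndepFun_tieLaw (n : ℕ) :
    iIndepFun (fun (e : Fin n × Fin n) (u : Fin n × Fin n → ℝ) => u e) (tieLaw n) :=
  iIndepFun_pi (X := fun _ x => x) fun _ => aemeasurable_id

theorem map_pair_tieLaw {n : ℕ} {e f : Fin n × Fin n} (hef : e ≠ f) :
    (tieLaw n).map (fun u => (u e, u f)) = unitLaw.prod unitLaw := by
  have h := (iIndepFun_tieLaw n).indepFun hef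
  rw [indepFun_iff_map_prod_eq_prod_map_map (measurable_pi_apply _).aemeasurable
    (measurable_pi_apply _).aemeasurable] at h
  have he : ∀ e : Fin n × Fin n, (tieLaw n).map (fun u => u e) = unitLaw := fun e =>
    (measurePreserving_eval (fun _ : Fin n × Fin n => unitLaw) e).map_eq
  rw [h, he, he]

section Ties

variable {n : ℕ} (E : Finset (Fin n × Fin n)) (D D' : Fin n × Fin n → ℕ)

/-- The effect of the ties between `e` and `f` on the rank of `e`. -/
noncomputable def tieError (e f : Fin n × Fin n) (u : Fin n × Fin n → ℝ) : ℝ :=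
  (if (D e : ℝ) + u e ≤ (D f : ℝ) + u f then 1 else 0) - rankWeight (D e) (D f)

/-- The effect of the ties on the rank of `e`. -/
noncomputable def rankError (e : Fin n × Fin n) (u : Fin n × Fin n → ℝ) : ℝ :=
  ∑ f ∈ E.erase e, tieError D e f u

/-- Comparing `e` with itself contributes `1` to the uniform rank but `1/2` to the sum of
`rankWeight`; the difference is the additive `1/2` of the average rank. This is why the error runs
over `E.erase e` only. -/
theorem uniformRank_eq {e : Fin n × Fin n} (he : e ∈ E) (u : Fin n × Fin n → ℝ) :
    uniformRank E D u e = averageRank E D e + rankError E D e u := by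
  have h1 : uniformRank E D u e - ∑ f ∈ E, rankWeight (D e) (D f)
      = ∑ f ∈ E, tieError D e f u := by
    rw [uniformRank, ← Finset.sum_sub_distrib]; rfl
  have h2 : ∑ f ∈ E, tieError D e f u = 1 / 2 + rankError E D e u := by
    rw [← Finset.add_sum_erase _ _ he, rankError]
    congr 1
    simp [tieError, rankWeight]
    norm_num
  have h3 : averageRank E D e = 1 / 2 + ∑ f ∈ E, rankWeight (D e) (D f) := rfl
  linarith

theorem abs_tieError_le_one (e f : Fin n × Fin n) (u : Fin n × Fin n → ℝ) :
    |tieError D e f u| ≤ 1 := by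
  have h1 := rankWeight_nonneg (D e) (D f)
  have h2 := (abs_le.1 (abs_rankWeight_le_one (D e) (D f))).2
  unfold tieError
  rw [abs_le]
  split_ifs <;> constructor <;> linarith

@[fun_prop]
theorem measurable_tieError (e f : Fin n × Fin n) : Measurable (tieError D e f) := by
  unfold tieError
  refine Measurable.sub_const ?_ _
  exact Measurable.ite (measurableSet_le (by fun_prop) (by fun_prop)) measurable_const
    measurable_const

theorem abs_rankError_le (e : Fin n × Fin n) (u : Fin n × Fin n → ℝ) :
    |rankError E D e u| ≤ E.card := by
  refine (Finset.abs_sum_le_sum_abs _ _).trans ?_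
  refine (Finset.sum_le_card_nsmul _ _ 1 fun f _ => abs_tieError_le_one D e f u).trans ?_
  rw [nsmul_eq_mul, mul_one]
  exact_mod_cast Finset.card_erase_le

@[fun_prop]
theorem measurable_rankError (e : Fin n × Fin n) : Measurable (rankError E D e) := by
  unfold rankError
  fun_prop

theorem integrable_tieError_mul (e f e' f' : Fin n × Fin n) :
    Integrable (fun u => tieError D e f u * tieError D e' f' u) (tieLaw n) := by
  refine Integrable.of_bound (by fun_prop) 1 (Eventually.of_forall fun u => ?_)
  rw [norm_mul]
  exact mul_le_one₀ (abs_tieError_le_one _ _ _ _) (abs_nonneg _) (abs_tieError_le_one _ _ _ _)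

theorem integral_tieError {e f : Fin n × Fin n} (hef : e ≠ f) :
    ∫ u, tieError D e f u ∂tieLaw n = 0 := by
  have hs := measurableSet_fst_le_snd (D e : ℝ) (D f)
  have h1 : ∀ u, tieError D e f u
      = ({p : ℝ × ℝ | (D e : ℝ) + p.1 ≤ (D f : ℝ) + p.2}.indicator (fun _ => (1 : ℝ))) (u e, u f)
        - rankWeight (D e) (D f) := fun u => rfl
  have hpair : Measurable fun u : Fin n × Fin n → ℝ => (u e, u f) := by fun_prop
  have h2 : Integrable ({p : ℝ × ℝ | (D e : ℝ) + p.1 ≤ (D f : ℝ) + p.2}.indicator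
      (fun _ => (1 : ℝ))) (unitLaw.prod unitLaw) := (integrable_const 1).indicator hs
  simp only [h1]
  rw [integral_sub, ← integral_map (f := {p : ℝ × ℝ | (D e : ℝ) + p.1 ≤ (D f : ℝ) + p.2}.indicator
      (fun _ => (1 : ℝ))) hpair.aemeasurable, map_pair_tieLaw hef, integral_indicator_const _ hs,
    unitLaw_prod_real_rank]
  · simp
  · rw [map_pair_tieLaw hef]; exact h2.aestronglyMeasurable
  · exact Integrable.comp_measurable (by rwa [map_pair_tieLaw hef]) hpair
  · exact integrable_const _

/-- The two factors involve disjoint sets of uniform variables, so they are independent, and one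
centred factor is enough. -/
theorem integral_tieError_mul_eq_zero {e f e' f' : Fin n × Fin n} (hef : e ≠ f) (he : e ≠ e')
    (hef' : e ≠ f') (hfe : f ≠ e') (hf : f ≠ f') :
    ∫ u, tieError D e f u * tieError D e' f' u ∂tieLaw n = 0 := by
  have h1 := (iIndepFun_tieLaw n).indepFun_prodMk_prodMk (fun e => by fun_prop) e f e' f'
    he hef' hfe hf
  have hm : ∀ k l : ℕ, Measurable fun p : ℝ × ℝ =>
      (if (k : ℝ) + p.1 ≤ (l : ℝ) + p.2 then (1 : ℝ) else 0) - rankWeight k l := fun k l =>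
    (Measurable.ite (measurableSet_fst_le_snd _ _) measurable_const measurable_const).sub_const _
  have h2 := h1.comp (hm (D e) (D f)) (hm (D e') (D f'))
  have h3 := h2.integral_fun_mul_eq_mul_integral
    ((hm (D e) (D f)).comp (by fun_prop)).aestronglyMeasurable
    ((hm (D e') (D f')).comp (by fun_prop)).aestronglyMeasurable
  have h4 := integral_tieError D hef
  refine h3.trans ?_
  change (∫ u, tieError D e f u ∂tieLaw n) * _ = 0
  rw [h4, zero_mul]

/-- The covariance of the effects of the ties on two ranks. -/
noncomputable def rankCov (e e' : Fin n × Fin n) : ℝ :=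
  ∫ u, rankError E D e u * rankError E D e' u ∂tieLaw n

theorem abs_rankCov_self_le (e : Fin n × Fin n) : |rankCov E D e e| ≤ (E.card : ℝ) ^ 2 := by
  rw [← Real.norm_eq_abs, rankCov]
  refine (norm_integral_le_of_norm_le_const (μ := tieLaw n) (C := (E.card : ℝ) ^ 2)
    (Eventually.of_forall fun u => ?_)).trans (le_of_eq (by rw [probReal_univ, mul_one]))
  rw [norm_mul, sq]
  exact mul_le_mul (abs_rankError_le E D e u) (abs_rankError_le E D e u) (abs_nonneg _)
    (Nat.cast_nonneg _)

/-- Of the pairs `(f, f')` only those with `f = e'`, `f' = e` or `f = f'` can have a nonzero mean.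
Each of these three conditions leaves at most `|E|` pairs, and each mean is at most one in absolute
value. -/
theorem abs_rankCov_le {e e' : Fin n × Fin n} (hee : e ≠ e') :
    |rankCov E D e e'| ≤ 3 * E.card := by
  have h1 : rankCov E D e e' = ∑ f ∈ E.erase e, ∑ f' ∈ E.erase e',
      ∫ u, tieError D e f u * tieError D e' f' u ∂tieLaw n := by
    unfold rankCov rankError
    simp only [Finset.sum_mul_sum]
    rw [integral_finsetSum _ fun f _ => integrable_finsetSum _ fun f' _ =>
      integrable_tieError_mul D e f e' f']
    exact Finset.sum_congr rfl fun f _ => integral_finsetSum _ fun f' _ =>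
      integrable_tieError_mul D e f e' f'
  have h2 : ∀ f ∈ E.erase e, ∀ f' ∈ E.erase e',
      |∫ u, tieError D e f u * tieError D e' f' u ∂tieLaw n|
        ≤ (if f = e' then 1 else 0) + (if f' = e then 1 else 0) + (if f = f' then (1 : ℝ) else 0) := by
    intro f hf f' hf'
    have hle : |∫ u, tieError D e f u * tieError D e' f' u ∂tieLaw n| ≤ 1 := by
      rw [← Real.norm_eq_abs]
      refine (norm_integral_le_of_norm_le_const (μ := tieLaw n) (C := 1)
        (Eventually.of_forall fun u => ?_)).trans (le_of_eq (by rw [probReal_univ, mul_one]))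
      rw [norm_mul]
      exact mul_le_one₀ (abs_tieError_le_one _ _ _ _) (abs_nonneg _) (abs_tieError_le_one _ _ _ _)
    by_cases c1 : f = e'
    · rw [if_pos c1]
      have : (0 : ℝ) ≤ (if f' = e then 1 else 0) := by positivity
      have : (0 : ℝ) ≤ (if f = f' then 1 else 0) := by positivity
      linarith
    by_cases c2 : f' = e
    · rw [if_pos c2, if_neg c1]
      have : (0 : ℝ) ≤ (if f = f' then 1 else 0) := by positivity
      linarith
    by_cases c3 : f = f'
    · rw [if_pos c3, if_neg c1, if_neg c2]; linarith
    rw [integral_tieError_mul_eq_zero D (Finset.ne_of_mem_erase hf).symm hee (Ne.symm c2) c1 c3]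
    simp [c1, c2, c3]
  rw [h1]
  calc |∑ f ∈ E.erase e, ∑ f' ∈ E.erase e', ∫ u, tieError D e f u * tieError D e' f' u ∂tieLaw n|
      ≤ ∑ f ∈ E.erase e, ∑ f' ∈ E.erase e', ((if f = e' then 1 else 0) + (if f' = e then 1 else 0)
        + (if f = f' then (1 : ℝ) else 0)) := by
        refine (Finset.abs_sum_le_sum_abs _ _).trans (Finset.sum_le_sum fun f hf => ?_)
        exact (Finset.abs_sum_le_sum_abs _ _).trans (Finset.sum_le_sum fun f' hf' => h2 f hf f' hf')
    _ ≤ ∑ f ∈ E, ∑ f' ∈ E, ((if f = e' then 1 else 0) + (if f' = e then 1 else 0)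
        + (if f = f' then (1 : ℝ) else 0)) := by
        refine (Finset.sum_le_sum fun f _ => Finset.sum_le_sum_of_subset_of_nonneg
          (Finset.erase_subset _ _) fun _ _ _ => by positivity).trans ?_
        exact Finset.sum_le_sum_of_subset_of_nonneg (Finset.erase_subset _ _)
          fun _ _ _ => Finset.sum_nonneg fun _ _ => by positivity
    _ ≤ 3 * E.card := by
        simp only [Finset.sum_add_distrib, Finset.sum_const, Finset.sum_ite_eq', Finset.sum_ite_eq,
          nsmul_eq_mul, ← Finset.mul_sum]
        have a1 : (if e' ∈ E then (1 : ℝ) else 0) ≤ 1 := by split_ifs <;> norm_num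
        have a2 : (if e ∈ E then (1 : ℝ) else 0) ≤ 1 := by split_ifs <;> norm_num
        have a3 : ∑ f ∈ E, (if f ∈ E then (1 : ℝ) else 0) = E.card := by
          simp
        have hc : (0 : ℝ) ≤ E.card := Nat.cast_nonneg _
        rw [a3]
        nlinarith [mul_le_mul_of_nonneg_left a1 hc, mul_le_mul_of_nonneg_left a2 hc]

theorem integrable_rankError_mul (e e' : Fin n × Fin n) :
    Integrable (fun u => rankError E D e u * rankError E D e' u) (tieLaw n) := by
  refine Integrable.of_bound (by fun_prop) ((E.card : ℝ) * E.card) (Eventually.of_forall fun u => ?_)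
  rw [norm_mul]
  exact mul_le_mul (abs_rankError_le _ _ _ _) (abs_rankError_le _ _ _ _) (abs_nonneg _)
    (Nat.cast_nonneg _)

/-- A double sum dominated by `A` on the diagonal and by `B` off the diagonal. -/
theorem sum_sum_le_of_diag {κ : Type*} [DecidableEq κ] (s : Finset κ) (c : κ → κ → ℝ) {A B : ℝ}
    (hB : 0 ≤ B) (hd : ∀ e ∈ s, c e e ≤ A) (ho : ∀ e ∈ s, ∀ e' ∈ s, e ≠ e' → c e e' ≤ B) :
    ∑ e ∈ s, ∑ e' ∈ s, c e e' ≤ s.card * A + s.card ^ 2 * B := by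
  calc ∑ e ∈ s, ∑ e' ∈ s, c e e' ≤ ∑ e ∈ s, (A + s.card * B) := by
        refine Finset.sum_le_sum fun e he => ?_
        rw [← Finset.add_sum_erase _ _ he]
        refine add_le_add (hd e he) ?_
        refine (Finset.sum_le_card_nsmul _ _ B fun e' he' => ho e he e' (Finset.mem_of_mem_erase he')
          (Finset.ne_of_mem_erase he').symm).trans ?_
        rw [nsmul_eq_mul]
        exact mul_le_mul_of_nonneg_right (by exact_mod_cast Finset.card_erase_le) hB
    _ = s.card * A + s.card ^ 2 * B := by
        rw [Finset.sum_const, nsmul_eq_mul]; ring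

/-- The diagonal gives `|E|` terms of size `|E|²`, the rest at most `|E|²` terms of size `3 |E|`;
together `4 |E|³`. -/
theorem integral_linear_rankError_sq_le (a : Fin n × Fin n → ℝ) {A : ℝ} (ha : ∀ e ∈ E, |a e| ≤ A) :
    ∫ u, (∑ e ∈ E, a e * rankError E D e u) ^ 2 ∂tieLaw n ≤ 4 * A ^ 2 * (E.card : ℝ) ^ 3 := by
  have h1 : ∀ u, (∑ e ∈ E, a e * rankError E D e u) ^ 2
      = ∑ e ∈ E, ∑ e' ∈ E, a e * a e' * (rankError E D e u * rankError E D e' u) := fun u => by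
    rw [sq, Finset.sum_mul_sum]
    exact Finset.sum_congr rfl fun e _ => Finset.sum_congr rfl fun e' _ => by ring
  simp only [h1]
  rw [integral_finsetSum _ fun f _ => integrable_finsetSum _ fun f' _ =>
      (integrable_rankError_mul E D f f').const_mul _,
    Finset.sum_congr rfl fun f _ => integral_finsetSum _ fun f' _ =>
      (integrable_rankError_mul E D f f').const_mul _]
  simp only [integral_const_mul]
  change ∑ e ∈ E, ∑ e' ∈ E, a e * a e' * rankCov E D e e' ≤ _
  have hmul : ∀ e ∈ E, ∀ e' ∈ E, ∀ c C : ℝ, |c| ≤ C → a e * a e' * c ≤ A ^ 2 * C := by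
    intro e he e' he' c C hc
    have hA : 0 ≤ A := (abs_nonneg _).trans (ha e he)
    refine (le_abs_self _).trans ?_
    rw [abs_mul, abs_mul, sq]
    exact mul_le_mul (mul_le_mul (ha e he) (ha e' he') (abs_nonneg _) hA) hc (abs_nonneg _)
      (by positivity)
  refine (sum_sum_le_of_diag E _ (A := A ^ 2 * (E.card : ℝ) ^ 2) (B := A ^ 2 * (3 * E.card))
    (by positivity) (fun e he => hmul e he e he _ _ (abs_rankCov_self_le E D e))
    fun e he e' he' hne => hmul e he e' he' _ _ (abs_rankCov_le E D hne)).trans (le_of_eq ?_)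
  ring

/-- The two families of ties are independent, so covariances multiply: the diagonal contributes at
most `|E| · |E|⁴` and the rest at most `|E|² · 9 |E|² ≤ 9 |E|⁵`. -/
theorem integral_rankError_mul_sq_le :
    ∫ p, (∑ e ∈ E, rankError E D e p.1 * rankError E D' e p.2) ^ 2 ∂(tieLaw n).prod (tieLaw n)
      ≤ 10 * (E.card : ℝ) ^ 5 := by
  have h1 : ∀ p : (Fin n × Fin n → ℝ) × (Fin n × Fin n → ℝ),
      (∑ e ∈ E, rankError E D e p.1 * rankError E D' e p.2) ^ 2
      = ∑ e ∈ E, ∑ e' ∈ E, (rankError E D e p.1 * rankError E D e' p.1)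
        * (rankError E D' e p.2 * rankError E D' e' p.2) := fun u => by
    rw [sq, Finset.sum_mul_sum]
    exact Finset.sum_congr rfl fun e _ => Finset.sum_congr rfl fun e' _ => by ring
  have h2 : ∀ e e', Integrable (fun p : (Fin n × Fin n → ℝ) × (Fin n × Fin n → ℝ) =>
      (rankError E D e p.1 * rankError E D e' p.1)
        * (rankError E D' e p.2 * rankError E D' e' p.2)) ((tieLaw n).prod (tieLaw n)) :=
    fun e e' => (integrable_rankError_mul E D e e').mul_prod (integrable_rankError_mul E D' e e')
  simp only [h1]
  rw [integral_finsetSum _ fun f _ => integrable_finsetSum _ fun f' _ => h2 f f',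
    Finset.sum_congr rfl fun f _ => integral_finsetSum _ fun f' _ => h2 f f']
  rw [Finset.sum_congr rfl fun e _ => Finset.sum_congr rfl fun e' _ => integral_prod_mul
    (fun u => rankError E D e u * rankError E D e' u)
    (fun u => rankError E D' e u * rankError E D' e' u)]
  change ∑ e ∈ E, ∑ e' ∈ E, rankCov E D e e' * rankCov E D' e e' ≤ _
  have hmul : ∀ c c' C : ℝ, |c| ≤ C → |c'| ≤ C → c * c' ≤ C ^ 2 := by
    intro c c' C hc hc'
    refine (le_abs_self _).trans ?_
    rw [abs_mul, sq]
    exact mul_le_mul hc hc' (abs_nonneg _) ((abs_nonneg _).trans hc)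
  have hint : (E.card : ℝ) ^ 4 ≤ (E.card : ℝ) ^ 5 := by
    rcases Nat.eq_zero_or_pos E.card with h | h
    · simp [h]
    · exact pow_le_pow_right₀ (by exact_mod_cast h) (by norm_num)
  refine (sum_sum_le_of_diag E _ (A := ((E.card : ℝ) ^ 2) ^ 2) (B := (3 * (E.card : ℝ)) ^ 2)
    (by positivity)
    (fun e _ => hmul _ _ _ (abs_rankCov_self_le E D e) (abs_rankCov_self_le E D' e))
    fun e _ e' _ hne => hmul _ _ _ (abs_rankCov_le E D hne) (abs_rankCov_le E D' hne)).trans ?_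
  nlinarith

theorem abs_averageRank_le (e : Fin n × Fin n) (hE : 1 ≤ E.card) :
    |averageRank E D e| ≤ 2 * E.card := by
  have h1 : (1 : ℝ) ≤ E.card := by exact_mod_cast hE
  have h3 : averageRank E D e = 1 / 2 + ∑ f ∈ E, rankWeight (D e) (D f) := rfl
  have h4 : |∑ f ∈ E, rankWeight (D e) (D f)| ≤ E.card := by
    refine (Finset.abs_sum_le_sum_abs _ _).trans ?_
    refine (Finset.sum_le_card_nsmul _ _ 1 fun f _ => abs_rankWeight_le_one _ _).trans ?_
    simp
  rw [h3]
  refine (abs_add_le _ _).trans ?_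
  norm_num
  linarith

/-- The difference of products splits into two terms linear in the rank errors, with coefficients at
most `2 |E|`, and one bilinear term. With `(x + y + z)² ≤ 3 (x² + y² + z²)` the constant is `3 (16 +
16 + 10) = 126`. -/
theorem integral_rank_products_sub_sq_le (hE : 1 ≤ E.card) :
    ∫ p, (∑ e ∈ E, uniformRank E D p.1 e * uniformRank E D' p.2 e
        - ∑ e ∈ E, averageRank E D e * averageRank E D' e) ^ 2 ∂(tieLaw n).prod (tieLaw n)
      ≤ 126 * (E.card : ℝ) ^ 5 := by
  set m : ℝ := (E.card : ℝ)
  have hdec : ∀ p : (Fin n × Fin n → ℝ) × (Fin n × Fin n → ℝ),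
      ∑ e ∈ E, uniformRank E D p.1 e * uniformRank E D' p.2 e
        - ∑ e ∈ E, averageRank E D e * averageRank E D' e
      = ∑ e ∈ E, averageRank E D' e * rankError E D e p.1
        + ∑ e ∈ E, averageRank E D e * rankError E D' e p.2
        + ∑ e ∈ E, rankError E D e p.1 * rankError E D' e p.2 := by
    intro p
    rw [← Finset.sum_sub_distrib, ← Finset.sum_add_distrib, ← Finset.sum_add_distrib]
    refine Finset.sum_congr rfl fun e he => ?_
    rw [uniformRank_eq E D he, uniformRank_eq E D' he]
    ring
  have habs : ∀ (s : Finset (Fin n × Fin n)) (F : Fin n × Fin n → ℝ) (C : ℝ),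
      (∀ e ∈ s, |F e| ≤ C) → ‖(∑ e ∈ s, F e) ^ 2‖ ≤ (s.card * C) ^ 2 := by
    intro s F C h
    rw [norm_pow]
    refine pow_le_pow_left₀ (norm_nonneg _) ?_ 2
    refine (Finset.abs_sum_le_sum_abs _ _).trans ?_
    simpa using Finset.sum_le_card_nsmul _ _ C h
  have i1 : Integrable (fun p : (Fin n × Fin n → ℝ) × (Fin n × Fin n → ℝ) =>
      (∑ e ∈ E, averageRank E D' e * rankError E D e p.1) ^ 2) ((tieLaw n).prod (tieLaw n)) := by
    refine Integrable.of_bound (Measurable.aestronglyMeasurable (by fun_prop)) _ (Eventually.of_forall fun p =>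
      habs E _ (2 * m * m) fun e _ => ?_)
    rw [abs_mul]
    exact mul_le_mul (abs_averageRank_le E D' e hE) (abs_rankError_le _ _ _ _) (abs_nonneg _)
      (by positivity)
  have i2 : Integrable (fun p : (Fin n × Fin n → ℝ) × (Fin n × Fin n → ℝ) =>
      (∑ e ∈ E, averageRank E D e * rankError E D' e p.2) ^ 2) ((tieLaw n).prod (tieLaw n)) := by
    refine Integrable.of_bound (Measurable.aestronglyMeasurable (by fun_prop)) _ (Eventually.of_forall fun p =>
      habs E _ (2 * m * m) fun e _ => ?_)
    rw [abs_mul]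
    exact mul_le_mul (abs_averageRank_le E D e hE) (abs_rankError_le _ _ _ _) (abs_nonneg _)
      (by positivity)
  have i3 : Integrable (fun p : (Fin n × Fin n → ℝ) × (Fin n × Fin n → ℝ) =>
      (∑ e ∈ E, rankError E D e p.1 * rankError E D' e p.2) ^ 2) ((tieLaw n).prod (tieLaw n)) := by
    refine Integrable.of_bound (Measurable.aestronglyMeasurable (by fun_prop)) _ (Eventually.of_forall fun p =>
      habs E _ (m * m) fun e _ => ?_)
    rw [abs_mul]
    exact mul_le_mul (abs_rankError_le _ _ _ _) (abs_rankError_le _ _ _ _) (abs_nonneg _)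
      (by positivity)
  have b1 : ∫ p, (∑ e ∈ E, averageRank E D' e * rankError E D e p.1) ^ 2
      ∂(tieLaw n).prod (tieLaw n) ≤ 16 * m ^ 5 := by
    have h := integral_fun_fst (μ := tieLaw n) (ν := tieLaw n)
      (fun u => (∑ e ∈ E, averageRank E D' e * rankError E D e u) ^ 2)
    rw [h, probReal_univ, one_smul]
    refine (integral_linear_rankError_sq_le E D _ fun e _ =>
      abs_averageRank_le E D' e hE).trans (le_of_eq (by ring))
  have b2 : ∫ p, (∑ e ∈ E, averageRank E D e * rankError E D' e p.2) ^ 2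
      ∂(tieLaw n).prod (tieLaw n) ≤ 16 * m ^ 5 := by
    have h := integral_fun_snd (μ := tieLaw n) (ν := tieLaw n)
      (fun u => (∑ e ∈ E, averageRank E D e * rankError E D' e u) ^ 2)
    rw [h, probReal_univ, one_smul]
    refine (integral_linear_rankError_sq_le E D' _ fun e _ =>
      abs_averageRank_le E D e hE).trans (le_of_eq (by ring))
  have b3 := integral_rankError_mul_sq_le E D D'
  simp only [hdec]
  refine (integral_mono_of_nonneg (Eventually.of_forall fun _ => sq_nonneg _)
    (((i1.add i2).add i3).const_mul 3) (Eventually.of_forall fun p => ?_)).trans ?_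
  · simp only [Pi.add_apply]
    generalize ∑ e ∈ E, averageRank E D' e * rankError E D e p.1 = x
    generalize ∑ e ∈ E, averageRank E D e * rankError E D' e p.2 = y
    generalize ∑ e ∈ E, rankError E D e p.1 * rankError E D' e p.2 = z
    nlinarith [sq_nonneg (x - y), sq_nonneg (y - z), sq_nonneg (x - z)]
  · rw [integral_const_mul, integral_add' (i1.add i2) i3, integral_add' i1 i2]
    linarith

@[fun_prop]
theorem measurable_uniformRank (e : Fin n × Fin n) :
    Measurable fun u => uniformRank E D u e := by
  unfold uniformRank
  refine Finset.measurable_sum _ fun f _ => ?_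
  exact Measurable.ite (measurableSet_le (by fun_prop) (by fun_prop)) measurable_const
    measurable_const

@[fun_prop]
theorem measurable_spearman (α β : DegreeType) :
    Measurable fun p : (Fin n × Fin n → ℝ) × (Fin n × Fin n → ℝ) => spearman E p.1 p.2 α β := by
  unfold spearman
  fun_prop

end Ties

theorem measure_le_of_integral_sq_le {Ω : Type*} [MeasurableSpace Ω] {μ : Measure Ω}
    [IsFiniteMeasure μ] {f : Ω → ℝ} (hf : Integrable (fun x => f x ^ 2) μ) {B c : ℝ}
    (hB : ∫ x, f x ^ 2 ∂μ ≤ B) (hc : 0 < c) :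
    μ {x | c ≤ |f x|} ≤ ENNReal.ofReal (B / c ^ 2) := by
  have h := mul_meas_ge_le_integral_of_nonneg (Eventually.of_forall fun x => sq_nonneg (f x)) hf
    (c ^ 2)
  have hset : {x | c ≤ |f x|} = {x | c ^ 2 ≤ f x ^ 2} := by
    ext x
    simp only [Set.mem_ofPred_eq]
    rw [← sq_abs (f x)]
    exact (pow_le_pow_iff_left₀ hc.le (abs_nonneg _) two_ne_zero).symm
  rw [hset, ← ENNReal.ofReal_toReal (measure_ne_top μ _)]
  refine ENNReal.ofReal_le_ofReal ?_
  rw [le_div_iff₀ (by positivity), mul_comm]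
  exact h.trans hB

theorem tieLaw_spearman_le {n : ℕ} (E : Finset (Fin n × Fin n)) (α β : DegreeType)
    (hE : 2 ≤ E.card) {c : ℝ} (hc : 0 < c) :
    ((tieLaw n).prod (tieLaw n)) {p | c ≤ |spearman E p.1 p.2 α β
      - (12 * ∑ e ∈ E, averageRank E (sourceDegree E α) e * averageRank E (targetDegree E β) e
      - 3 * (E.card : ℝ) * (E.card + 1) ^ 2) / ((E.card : ℝ) ^ 3 - E.card)|}
      ≤ ENNReal.ofReal (126 * (E.card : ℝ) ^ 5 / (c * ((E.card : ℝ) ^ 3 - E.card) / 12) ^ 2) := by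
  set m : ℝ := (E.card : ℝ)
  have hm : 2 ≤ m := Nat.ofNat_le_cast.2 hE
  have hpos : 0 < m ^ 3 - m := by nlinarith [mul_self_nonneg m]
  set D := sourceDegree E α
  set D' := targetDegree E β
  have hR : ∀ (D : Fin n × Fin n → ℕ) u, ∀ e ∈ E, |uniformRank E D u e| ≤ 3 * m := by
    intro D u e he
    rw [uniformRank_eq E D he]
    refine (abs_add_le _ _).trans ?_
    linarith [abs_averageRank_le E D e (by omega), abs_rankError_le E D e u]
  have hint : Integrable (fun p : (Fin n × Fin n → ℝ) × (Fin n × Fin n → ℝ) =>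
      (∑ e ∈ E, uniformRank E D p.1 e * uniformRank E D' p.2 e
        - ∑ e ∈ E, averageRank E D e * averageRank E D' e) ^ 2) ((tieLaw n).prod (tieLaw n)) := by
    refine Integrable.of_bound (Measurable.aestronglyMeasurable (by fun_prop))
      ((m * (3 * m * (3 * m)) + |∑ e ∈ E, averageRank E D e * averageRank E D' e|) ^ 2)
      (Eventually.of_forall fun p => ?_)
    rw [norm_pow]
    refine pow_le_pow_left₀ (norm_nonneg _) ((norm_sub_le _ _).trans (add_le_add ?_ le_rfl)) 2
    refine (Finset.abs_sum_le_sum_abs _ _).trans ?_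
    refine (Finset.sum_le_card_nsmul _ _ (3 * m * (3 * m)) fun e he => ?_).trans ?_
    · rw [abs_mul]
      exact mul_le_mul (hR D _ e he) (hR D' _ e he) (abs_nonneg _) (by positivity)
    · rw [nsmul_eq_mul]
  refine (measure_mono fun p hp => ?_).trans (measure_le_of_integral_sq_le hint
    (integral_rank_products_sub_sq_le E D D' (by omega)) (c := c * (m ^ 3 - m) / 12) (by positivity))
  simp only [Set.mem_ofPred_eq] at hp ⊢
  have heq : spearman E p.1 p.2 α β
      - (12 * ∑ e ∈ E, averageRank E D e * averageRank E D' e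
      - 3 * m * (m + 1) ^ 2) / (m ^ 3 - m)
      = 12 * (∑ e ∈ E, uniformRank E D p.1 e * uniformRank E D' p.2 e
        - ∑ e ∈ E, averageRank E D e * averageRank E D' e) / (m ^ 3 - m) := by
    rw [spearman]
    change (12 * ∑ e ∈ E, uniformRank E D p.1 e * uniformRank E D' p.2 e
      - 3 * m * (m + 1) ^ 2) / (m ^ 3 - m) - _ = _
    rw [← sub_div]
    congr 1
    ring
  rw [heq, abs_div, abs_of_pos hpos, le_div_iff₀ hpos, abs_mul, abs_of_pos (by norm_num)] at hp
  linarith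

/-- Ties at random do not change the limit of Spearman's rho. -/
theorem tendsto_spearman_of_averageRank (μ : ∀ n, Measure (Finset (Fin n × Fin n)))
    (hμ : ∀ n, μ n Set.univ ≤ 1) (α β : DegreeType)
    (hcard : Tendsto (fun z : Σ n, Finset (Fin n × Fin n) => (z.2.card : ℝ)) (whp atTop μ) atTop)
    (h : Tendsto (fun z : Σ n, Finset (Fin n × Fin n) =>
      (12 * ∑ e ∈ z.2, averageRank z.2 (sourceDegree z.2 α) e
        * averageRank z.2 (targetDegree z.2 β) e - 3 * (z.2.card : ℝ) * (z.2.card + 1) ^ 2)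
        / ((z.2.card : ℝ) ^ 3 - z.2.card)) (whp atTop μ) (𝓝 0)) :
    Tendsto (fun z : Σ n, Finset (Fin n × Fin n) × ((Fin n × Fin n → ℝ) × (Fin n × Fin n → ℝ)) =>
      spearman z.2.1 z.2.2.1 z.2.2.2 α β)
      (whp atTop fun n => (μ n).prod ((tieLaw n).prod (tieLaw n))) (𝓝 0) := by
  rw [Metric.tendsto_nhds]
  intro ε hε
  rw [eventually_whp]
  have hmeas : ∀ n, Measurable fun z : Finset (Fin n × Fin n) × ((Fin n × Fin n → ℝ) ×
      (Fin n × Fin n → ℝ)) => spearman z.1 z.2.1 z.2.2 α β := fun n =>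
    measurable_from_prod_countable_right fun E => by
      dsimp only
      exact measurable_spearman E α β
  have hset : ∀ n, MeasurableSet {z : Finset (Fin n × Fin n) × ((Fin n × Fin n → ℝ) ×
      (Fin n × Fin n → ℝ)) | ¬ dist (spearman z.1 z.2.1 z.2.2 α β) 0 < ε} := fun n =>
    (measurableSet_lt ((hmeas n).dist measurable_const) measurable_const).compl
  refine (tendsto_lintegral_of_tendsto_whp hμ
    (fun n E => ((tieLaw n).prod (tieLaw n)) {p | ¬ dist (spearman E p.1 p.2 α β) 0 < ε})
    (fun n E => prob_le_one) ?_).congr fun n => ?_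
  · have hε2 : 0 < ε / 2 := by positivity
    -- This is the Chebyshev bound of `tieLaw_spearman_le` at `c = ε / 2`, rewritten in powers of `1
    -- / |E|`; `18144 = 126 · 12²`.
    have hlim : Tendsto (fun z : Σ n, Finset (Fin n × Fin n) =>
        ENNReal.ofReal ((18144 / (ε / 2) ^ 2 * (1 / (z.2.card : ℝ)))
          / (1 - (1 / (z.2.card : ℝ)) ^ 2) ^ 2)) (whp atTop μ) (𝓝 0) := by
      have h1 := hcard.const_div_atTop 1
      have h2 := (h1.const_mul (18144 / (ε / 2) ^ 2)).div (((h1.pow 2).const_sub 1).pow 2)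
        (by norm_num)
      have h3 := ENNReal.tendsto_ofReal h2
      simpa using h3
    refine tendsto_of_tendsto_of_tendsto_of_le_of_le' tendsto_const_nhds hlim
      (Eventually.of_forall fun _ => zero_le) ?_
    filter_upwards [hcard.eventually_ge_atTop 2, (Metric.tendsto_nhds.1 h) (ε / 2) hε2]
      with z hz hz'
    have hz2 : 2 ≤ z.2.card := by exact_mod_cast hz
    refine (measure_mono fun p hp => ?_).trans
      ((tieLaw_spearman_le z.2 α β hz2 hε2).trans (le_of_eq ?_))
    · simp only [Set.mem_ofPred_eq, not_lt, Real.dist_eq, sub_zero] at hp hz' ⊢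
      have := abs_sub_abs_le_abs_sub (spearman z.2 p.1 p.2 α β) ((12 * ∑ e ∈ z.2,
        averageRank z.2 (sourceDegree z.2 α) e * averageRank z.2 (targetDegree z.2 β) e
        - 3 * (z.2.card : ℝ) * (z.2.card + 1) ^ 2) / ((z.2.card : ℝ) ^ 3 - z.2.card))
      linarith
    · congr 1
      have h0 : (z.2.card : ℝ) ≠ 0 := by linarith
      have h1 : (z.2.card : ℝ) ^ 2 - 1 ≠ 0 := by nlinarith
      have h2 : (z.2.card : ℝ) ^ 3 - z.2.card ≠ 0 := by
        rw [show (z.2.card : ℝ) ^ 3 - z.2.card = z.2.card * ((z.2.card : ℝ) ^ 2 - 1) by ring]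
        exact mul_ne_zero h0 h1
      rw [show (z.2.card : ℝ) ^ 3 - z.2.card = z.2.card * ((z.2.card : ℝ) ^ 2 - 1) by ring]
      field_simp
      norm_num
  · rw [Measure.prod_apply (hset n)]
    rfl

/-! ### Uniformly random bijections -/

/-- The mean of `F` over a finite type. -/
noncomputable def avg {Ω : Type*} [Fintype Ω] (F : Ω → ℝ) : ℝ := (∑ ω, F ω) / Fintype.card Ω

section Avg

variable {Ω : Type*} [Fintype Ω]

theorem avg_sum {κ : Type*} (s : Finset κ) (F : κ → Ω → ℝ) :
    avg (fun ω => ∑ i ∈ s, F i ω) = ∑ i ∈ s, avg (F i) := by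
  simp only [avg]
  rw [Finset.sum_comm, Finset.sum_div]

theorem avg_add (F G : Ω → ℝ) : avg (fun ω => F ω + G ω) = avg F + avg G := by
  simp only [avg]
  rw [Finset.sum_add_distrib, add_div]

theorem avg_const_mul (c : ℝ) (F : Ω → ℝ) : avg (fun ω => c * F ω) = c * avg F := by
  simp only [avg]
  rw [← Finset.mul_sum, mul_div_assoc]

theorem avg_const [Nonempty Ω] (c : ℝ) : avg (fun _ : Ω => c) = c := by
  simp [avg]

/-- Markov's inequality for the uniform distribution on a finite type. -/
theorem uniformOn_univ_le [MeasurableSpace Ω] [DiscreteMeasurableSpace Ω] {F : Ω → ℝ}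
    (hF : ∀ ω, 0 ≤ F ω) {c : ℝ} (hc : 0 < c) :
    uniformOn (Set.univ : Set Ω) {ω | c ≤ F ω} ≤ ENNReal.ofReal (avg F / c) := by
  classical
  rcases isEmpty_or_nonempty Ω with h | h
  · simp [Set.eq_empty_of_isEmpty]
  rw [uniformOn_univ]
  have hcnt : Measure.count {ω | c ≤ F ω} = ((Finset.univ.filter fun ω => c ≤ F ω).card : ℝ≥0∞) := by
    rw [← Measure.count_apply_finset]; congr 1; ext; simp
  have hN : (0 : ℝ) < Fintype.card Ω := by exact_mod_cast Fintype.card_pos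
  rw [hcnt, ENNReal.div_le_iff (by simp [Fintype.card_ne_zero]) (by simp)]
  rw [← ENNReal.ofReal_natCast, ← ENNReal.ofReal_natCast, ← ENNReal.ofReal_mul'
    (Nat.cast_nonneg _)]
  refine ENNReal.ofReal_le_ofReal ?_
  rw [avg, div_div, mul_comm _ c, ← div_div, div_mul_cancel₀ _ hN.ne', le_div_iff₀ hc,
    ← nsmul_eq_mul]
  refine (Finset.card_nsmul_le_sum (Finset.univ.filter fun ω => c ≤ F ω) F c
    fun ω hω => (Finset.mem_filter.1 hω).2).trans ?_
  exact Finset.sum_le_sum_of_subset_of_nonneg (Finset.subset_univ _) fun ω _ _ => hF ω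

/-- The mean of a function of a variable which is uniform on a finite set. -/
theorem avg_comp_of_card_fiber_eq [Nonempty Ω] {T : Type*} [DecidableEq T] (X : Ω → T)
    (S : Finset T) (hX : ∀ ω, X ω ∈ S)
    (hc : ∀ t ∈ S, ∀ t' ∈ S, (Finset.univ.filter fun ω => X ω = t).card
      = (Finset.univ.filter fun ω => X ω = t').card) (g : T → ℝ) :
    avg (fun ω => g (X ω)) = (∑ t ∈ S, g t) / S.card := by
  obtain ⟨ω₀⟩ := ‹Nonempty Ω›
  set c := (Finset.univ.filter fun ω => X ω = X ω₀).card
  have h1 : ∀ g : T → ℝ, ∑ ω, g (X ω) = c * ∑ t ∈ S, g t := by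
    intro g
    rw [← Finset.sum_fiberwise_of_maps_to (fun ω _ => hX ω), Finset.mul_sum]
    refine Finset.sum_congr rfl fun t ht => ?_
    rw [Finset.sum_congr rfl (g := fun _ => g t) fun ω hω => by rw [(Finset.mem_filter.1 hω).2],
      Finset.sum_const, nsmul_eq_mul, hc t ht _ (hX ω₀)]
  have h2 := h1 fun _ => 1
  simp only [Finset.sum_const, nsmul_eq_mul, mul_one, Finset.card_univ] at h2
  have hc0 : (c : ℝ) ≠ 0 := by
    have : 0 < c := Finset.card_pos.2 ⟨ω₀, by simp⟩
    positivity
  rw [avg, h1, h2, mul_div_mul_left _ _ hc0]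

end Avg

section Bijections

/-- Double transitivity of the permutations. Composition with such a permutation matches the fibres
of `σ ↦ (σ s, σ s')`, so this pair is uniform on the off-diagonal. -/
theorem exists_perm_apply_eq {B : Type*} [DecidableEq B] {t u t' u' : B} (h : t ≠ u) (h' : t' ≠ u') :
    ∃ π : Equiv.Perm B, π t = t' ∧ π u = u' := by
  refine ⟨(Equiv.swap t t').trans (Equiv.swap (Equiv.swap t t' u) u'), ?_, by simp⟩
  simp only [Equiv.trans_apply, Equiv.swap_apply_left]
  refine Equiv.swap_apply_of_ne_of_ne (fun hc => h ?_) h'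
  apply (Equiv.swap t t').injective
  rw [← hc, Equiv.swap_apply_left]

variable {A B : Type*} [Fintype A] [Fintype B] [DecidableEq A] [DecidableEq B]

theorem avg_equiv_apply [Nonempty (A ≃ B)] (s : A) (g : B → ℝ) :
    avg (fun σ : A ≃ B => g (σ s)) = (∑ t, g t) / Fintype.card B := by
  rw [avg_comp_of_card_fiber_eq (fun σ : A ≃ B => σ s) Finset.univ (by simp), Finset.card_univ]
  intro t _ t' _
  refine Finset.card_bij (fun σ _ => σ.trans (Equiv.swap t t')) ?_ ?_ ?_
  · intro σ hσ
    simp only [Finset.mem_filter, Finset.mem_univ, true_and] at hσ ⊢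
    simp [hσ]
  · intro σ _ σ' _ h
    simpa [Equiv.ext_iff] using h
  · intro σ hσ
    simp only [Finset.mem_filter, Finset.mem_univ, true_and] at hσ
    refine ⟨σ.trans (Equiv.swap t t'), by simp [hσ], ?_⟩
    ext; simp

theorem avg_equiv_apply_pair [Nonempty (A ≃ B)] {s s' : A} (hs : s ≠ s') (g : B × B → ℝ) :
    avg (fun σ : A ≃ B => g (σ s, σ s'))
      = (∑ p ∈ Finset.univ.offDiag, g p) / (Fintype.card B * (Fintype.card B - 1)) := by
  rw [avg_comp_of_card_fiber_eq (fun σ : A ≃ B => (σ s, σ s')) Finset.univ.offDiag (by simp [hs]),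
    Finset.offDiag_card, Finset.card_univ]
  · congr 1
    rw [Nat.cast_sub (Nat.le_mul_self _)]
    push_cast; ring
  intro p hp p' hp'
  simp only [Finset.mem_offDiag, Finset.mem_univ, true_and] at hp hp'
  obtain ⟨π, h1, h2⟩ := exists_perm_apply_eq hp hp'
  refine Finset.card_bij (fun σ _ => σ.trans π) ?_ ?_ ?_
  · intro σ hσ
    simp only [Finset.mem_filter, Finset.mem_univ, true_and] at hσ ⊢
    rw [Prod.ext_iff] at hσ ⊢
    simp only at hσ ⊢
    exact ⟨by simpa [hσ.1] using h1, by simpa [hσ.2] using h2⟩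
  · intro σ _ σ' _ h
    simpa [Equiv.ext_iff] using h
  · intro σ hσ
    simp only [Finset.mem_filter, Finset.mem_univ, true_and] at hσ
    rw [Prod.ext_iff] at hσ
    refine ⟨σ.trans π.symm, ?_, by ext; simp⟩
    simp only [Finset.mem_filter, Finset.mem_univ, true_and]
    rw [Prod.ext_iff]
    simp only at hσ ⊢
    exact ⟨by simp [hσ.1, ← h1], by simp [hσ.2, ← h2]⟩

/-- The number of elements of `S` that a random bijection sends to `T` has variance at most the
number of all elements. -/
theorem avg_card_sub_sq_le [Nonempty (A ≃ B)] (S : Finset A) (T : Finset B)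
    (hB : 2 ≤ Fintype.card B) :
    avg (fun σ : A ≃ B => (((S.filter fun s => σ s ∈ T).card : ℝ)
      - S.card * T.card / Fintype.card B) ^ 2) ≤ Fintype.card B := by
  obtain ⟨σ₀⟩ := ‹Nonempty (A ≃ B)›
  have hne : Nonempty (A ≃ B) := ⟨σ₀⟩
  set M : ℝ := (Fintype.card B : ℝ)
  have hM : 2 ≤ M := Nat.ofNat_le_cast.2 hB
  have hSM : (S.card : ℝ) ≤ M := by
    have := Finset.card_le_univ S
    rw [Fintype.card_congr σ₀] at this
    exact Nat.cast_le.2 this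
  have hTM : (T.card : ℝ) ≤ M := Nat.cast_le.2 (Finset.card_le_univ T)
  set x : ℝ := (S.card : ℝ)
  set y : ℝ := (T.card : ℝ)
  have hx : 0 ≤ x := Nat.cast_nonneg _
  have hy : 0 ≤ y := Nat.cast_nonneg _
  set b : B → ℝ := fun t => if t ∈ T then 1 else 0
  have hbsum : ∑ t, b t = y := by simp [b, y]
  have hN : ∀ σ : A ≃ B, ((S.filter fun s => σ s ∈ T).card : ℝ) = ∑ s ∈ S, b (σ s) := by
    intro σ; simp [b]
  have hmean : avg (fun σ : A ≃ B => ∑ s ∈ S, b (σ s)) = x * y / M := by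
    rw [avg_sum]
    simp only [avg_equiv_apply, hbsum, Finset.sum_const, nsmul_eq_mul]
    rw [mul_div_assoc]
  have hoff : ∑ p ∈ (Finset.univ : Finset B).offDiag, b p.1 * b p.2 = y * y - y := by
    have h1 : ∑ p ∈ (Finset.univ : Finset B).offDiag, b p.1 * b p.2 = T.offDiag.card := by
      rw [Finset.card_eq_sum_ones, Nat.cast_sum,
        ← Finset.sum_subset (Finset.offDiag_mono (Finset.subset_univ T))]
      · refine Finset.sum_congr rfl fun p hp => ?_
        rw [Finset.mem_offDiag] at hp
        simp [b, hp.1, hp.2.1]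
      · intro p hp hp'
        simp only [Finset.mem_offDiag, Finset.mem_univ, true_and] at hp hp'
        simp only [b]
        by_cases c1 : p.1 ∈ T
        · have c2 : p.2 ∉ T := fun c2 => hp' ⟨c1, c2, hp⟩
          simp [c2]
        · simp [c1]
    rw [h1, Finset.offDiag_card, Nat.cast_sub (Nat.le_mul_self _)]
    push_cast; rfl
  have hsq : avg (fun σ : A ≃ B => (∑ s ∈ S, b (σ s)) ^ 2) ≤ x * y / M + (x * y / M) ^ 2 := by
    have h1 : ∀ σ : A ≃ B, (∑ s ∈ S, b (σ s)) ^ 2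
        = ∑ s ∈ S, b (σ s) + ∑ p ∈ S.offDiag, b (σ p.1) * b (σ p.2) := by
      intro σ
      rw [sq, Finset.sum_mul_sum, ← Finset.sum_product', ← Finset.diag_union_offDiag,
        Finset.sum_union (Finset.disjoint_diag_offDiag S)]
      congr 1
      rw [Finset.sum_diag]
      refine Finset.sum_congr rfl fun s _ => ?_
      simp only [b]; split_ifs <;> simp
    simp only [h1]
    rw [avg_add, hmean, avg_sum]
    have h2 : ∀ p ∈ S.offDiag, avg (fun σ : A ≃ B => b (σ p.1) * b (σ p.2))
        = (y * y - y) / (M * (M - 1)) := by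
      intro p hp
      rw [← hoff]
      exact avg_equiv_apply_pair (Finset.mem_offDiag.1 hp).2.2 fun q => b q.1 * b q.2
    rw [Finset.sum_congr rfl h2, Finset.sum_const, nsmul_eq_mul, Finset.offDiag_card,
      Nat.cast_sub (Nat.le_mul_self _)]
    push_cast
    refine add_le_add le_rfl ?_
    change (x * x - x) * ((y * y - y) / (M * (M - 1))) ≤ _
    rcases Nat.eq_zero_or_pos T.card with h0 | h0
    · have : y = 0 := by simp [y, h0]
      simp [this]
    have hy1 : 1 ≤ y := Nat.one_le_cast.2 h0
    -- Equivalent to `x ≤ M`. Hence the off-diagonal part of the second moment is at most the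
    -- squared mean, and the variance is at most the mean.
    have e1 : (x * x - x) / (M - 1) ≤ x * x / M := by
      rw [div_le_div_iff₀ (by linarith) (by linarith)]
      nlinarith
    have e2 : (y * y - y) / M ≤ y * y / M :=
      div_le_div_of_nonneg_right (by linarith) (by linarith)
    have e3 : 0 ≤ (y * y - y) / M := div_nonneg (by nlinarith) (by linarith)
    calc (x * x - x) * ((y * y - y) / (M * (M - 1)))
        = (x * x - x) / (M - 1) * ((y * y - y) / M) := by
          rw [mul_comm M, ← mul_div_assoc, mul_div_mul_comm]
      _ ≤ x * x / M * (y * y / M) := mul_le_mul e1 e2 e3 (by positivity)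
      _ = (x * y / M) ^ 2 := by ring
  have hexp : ∀ σ : A ≃ B, (((S.filter fun s => σ s ∈ T).card : ℝ) - x * y / M) ^ 2
      = (∑ s ∈ S, b (σ s)) ^ 2 + ((-2 * (x * y / M)) * (∑ s ∈ S, b (σ s)) + (x * y / M) ^ 2) := by
    intro σ
    rw [hN]; ring
  simp only [hexp]
  rw [avg_add, avg_add, avg_const_mul, hmean, avg_const]
  have hfin : x * y / M ≤ M := by
    rw [div_le_iff₀ (by linarith)]
    exact mul_le_mul hSM hTM hy (by linarith)
  nlinarith

end Bijections

/-! ### Erasure -/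

section Erasure

variable {n : ℕ} (d : BiDegrees n)

/-- The number of stubs of type `α` of a vertex. -/
def stubDegree : DegreeType → Fin n → ℕ
  | .plus, v => d.2 v
  | .minus, v => d.1 v

instance : Fintype (Pairing d) := inferInstanceAs (Fintype (OutStub d ≃ InStub d))

instance : DiscreteMeasurableSpace (Pairing d) := ⟨fun _ => trivial⟩

theorem sum_outStub {M : Type*} [AddCommMonoid M] (φ : Fin n → M) :
    ∑ s : OutStub d, φ s.1 = ∑ v, d.2 v • φ v := by
  rw [Fintype.sum_sigma]
  simp

theorem sum_inStub {M : Type*} [AddCommMonoid M] (φ : Fin n → M) :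
    ∑ s : InStub d, φ s.1 = ∑ v, d.1 v • φ v := by
  rw [Fintype.sum_sigma]
  simp

theorem card_outStub : Fintype.card (OutStub d) = ∑ v, d.2 v := by simp

theorem card_inStub : Fintype.card (InStub d) = ∑ v, d.1 v := by simp

theorem card_outStub_filter (p : Fin n → Prop) [DecidablePred p] :
    (Finset.univ.filter fun s : OutStub d => p s.1).card = ∑ v with p v, d.2 v := by
  rw [Finset.card_filter, sum_outStub d fun v => if p v then 1 else 0, Finset.sum_filter]
  simp

theorem card_inStub_filter (p : Fin n → Prop) [DecidablePred p] :
    (Finset.univ.filter fun s : InStub d => p s.1).card = ∑ v with p v, d.1 v := by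
  rw [Finset.card_filter, sum_inStub d fun v => if p v then 1 else 0, Finset.sum_filter]
  simp

variable {d} (σ : Pairing d)

/-- The pairing as an equivalence. -/
def Pairing.equiv : OutStub d ≃ InStub d := σ

/-- The edge carried by an outbound stub. -/
def stubEdge (s : OutStub d) : Fin n × Fin n := (s.1, (σ.equiv s).1)

theorem erase_eq : erase d σ = (Finset.univ.image (stubEdge σ)).filter fun e => e.1 ≠ e.2 := rfl

theorem card_filter_target (p : Fin n → Prop) [DecidablePred p] :
    (Finset.univ.filter fun s : OutStub d => p (stubEdge σ s).2).card = ∑ v with p v, d.1 v := by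
  rw [← card_inStub_filter]
  refine Finset.card_equiv σ.equiv fun s => ?_
  simp only [Finset.mem_filter, Finset.mem_univ, true_and]
  rfl

theorem card_filter_erase_le (p : Fin n × Fin n → Prop) [DecidablePred p] :
    ((erase d σ).filter p).card ≤ (Finset.univ.filter fun s => p (stubEdge σ s)).card := by
  refine (Finset.card_le_card (t := (Finset.univ.filter fun s => p (stubEdge σ s)).image
    (stubEdge σ)) ?_).trans Finset.card_image_le
  intro e he
  rw [erase_eq] at he
  simp only [Finset.mem_filter, Finset.mem_image, Finset.mem_univ, true_and] at he ⊢
  obtain ⟨⟨⟨s, rfl⟩, _⟩, hp⟩ := he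
  exact ⟨s, hp, rfl⟩

theorem degree_le_stubDegree (α : DegreeType) (v : Fin n) :
    degree (erase d σ) α v ≤ stubDegree d α v := by
  cases α
  · refine (card_filter_erase_le σ fun e => e.1 = v).trans ?_
    have := card_outStub_filter d fun w => w = v
    simp only [Finset.sum_filter, Finset.sum_ite_eq', Finset.mem_univ, if_true] at this
    exact this.le
  · refine (card_filter_erase_le σ fun e => e.2 = v).trans ?_
    have := card_filter_target σ fun w => w = v
    simp only [Finset.sum_filter, Finset.sum_ite_eq', Finset.mem_univ, if_true] at this
    exact this.le

theorem sum_degree_filter (E : Finset (Fin n × Fin n)) (S : Finset (Fin n)) :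
    ∑ v ∈ S, degree E .plus v = (E.filter fun e => e.1 ∈ S).card := by
  have h := Finset.card_eq_sum_card_fiberwise (f := Prod.fst)
    (s := E.filter fun e => e.1 ∈ S) (t := S) fun e he => (Finset.mem_filter.1 he).2
  rw [h]
  refine Finset.sum_congr rfl fun v hv => ?_
  simp only [degree]
  congr 1
  ext e
  simp only [Finset.mem_filter]
  constructor
  · rintro ⟨h, rfl⟩; exact ⟨⟨h, hv⟩, rfl⟩
  · rintro ⟨⟨h, _⟩, h'⟩; exact ⟨h, h'⟩

theorem sum_degree_filter_minus (E : Finset (Fin n × Fin n)) (S : Finset (Fin n)) :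
    ∑ v ∈ S, degree E .minus v = (E.filter fun e => e.2 ∈ S).card := by
  have h := Finset.card_eq_sum_card_fiberwise (f := Prod.snd)
    (s := E.filter fun e => e.2 ∈ S) (t := S) fun e he => (Finset.mem_filter.1 he).2
  rw [h]
  refine Finset.sum_congr rfl fun v hv => ?_
  simp only [degree]
  congr 1
  ext e
  simp only [Finset.mem_filter]
  constructor
  · rintro ⟨h, rfl⟩; exact ⟨⟨h, hv⟩, rfl⟩
  · rintro ⟨⟨h, _⟩, h'⟩; exact ⟨h, h'⟩

theorem sum_degree (E : Finset (Fin n × Fin n)) (α : DegreeType) : ∑ v, degree E α v = E.card := by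
  cases α
  · simpa using sum_degree_filter E Finset.univ
  · simpa using sum_degree_filter_minus E Finset.univ

/-- The number of erased edges. -/
def erasedCount : ℕ := (∑ v, d.2 v) - (erase d σ).card

theorem card_erase_le : (erase d σ).card ≤ ∑ v, d.2 v := by
  have := card_filter_erase_le σ fun _ => True
  simpa using this

/-- The natural subtraction in `erasedCount` is never truncated. -/
theorem card_erase_add : (erase d σ).card + erasedCount σ = ∑ v, d.2 v :=
  Nat.add_sub_cancel' (card_erase_le σ)

theorem sum_stubDegree_eq (σ : Pairing d) (α : DegreeType) :
    ∑ v, stubDegree d α v = ∑ v, d.2 v := by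
  cases α
  · rfl
  · have := Fintype.card_congr σ.equiv
    rw [card_outStub, card_inStub] at this
    exact this.symm

/-- The vertices whose degree of type `α` is changed by the erasure. -/
def affected (α : DegreeType) : Finset (Fin n) :=
  Finset.univ.filter fun v => degree (erase d σ) α v ≠ stubDegree d α v

/-- An affected vertex has lost at least one unit of degree, and the total loss of either type
equals the number of erased edges. -/
theorem card_affected_le (α : DegreeType) : (affected σ α).card ≤ erasedCount σ := by
  have h1 : ∑ v, degree (erase d σ) α v + (affected σ α).card ≤ ∑ v, stubDegree d α v := by
    rw [affected, Finset.card_filter, ← Finset.sum_add_distrib]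
    refine Finset.sum_le_sum fun v _ => ?_
    have := degree_le_stubDegree σ α v
    split_ifs with h <;> omega
  rw [sum_degree, sum_stubDegree_eq σ] at h1
  have := card_erase_add σ
  omega

/-- The number of stubs of type `α` at vertices with more than `K` of them. -/
def tailSum (d : BiDegrees n) (α : DegreeType) (K : ℕ) : ℕ :=
  ∑ v with K < stubDegree d α v, stubDegree d α v

/-- The cut-off device for all later error terms: with `K` fixed a set of `o(n)` vertices carries
few stubs, up to a tail that is made small by `K` afterwards. -/
theorem sum_stubDegree_le (d : BiDegrees n) (α : DegreeType) (K : ℕ) (S : Finset (Fin n)) :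
    ∑ v ∈ S, stubDegree d α v ≤ K * S.card + tailSum d α K := by
  rw [tailSum, Finset.sum_filter, mul_comm, ← smul_eq_mul, ← Finset.sum_const]
  refine le_trans ?_ (add_le_add le_rfl (Finset.sum_le_sum_of_subset (Finset.subset_univ S)))
  rw [← Finset.sum_add_distrib]
  refine Finset.sum_le_sum fun v _ => ?_
  split_ifs <;> omega

theorem card_filter_source_le (K : ℕ) (S : Finset (Fin n)) :
    ((erase d σ).filter fun e => e.1 ∈ S).card ≤ K * S.card + tailSum d .plus K := by
  rw [← sum_degree_filter]
  exact (Finset.sum_le_sum fun v _ => degree_le_stubDegree σ .plus v).trans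
    (sum_stubDegree_le d .plus K S)

theorem card_filter_target_le (K : ℕ) (S : Finset (Fin n)) :
    ((erase d σ).filter fun e => e.2 ∈ S).card ≤ K * S.card + tailSum d .minus K := by
  rw [← sum_degree_filter_minus]
  exact (Finset.sum_le_sum fun v _ => degree_le_stubDegree σ .minus v).trans
    (sum_stubDegree_le d .minus K S)

/-- The number of stubs with given degrees at the source and at the target. -/
def stubCount (α β : DegreeType) (x : ℕ × ℕ) : ℕ :=
  (Finset.univ.filter fun s => (stubDegree d α (stubEdge σ s).1,
    stubDegree d β (stubEdge σ s).2) = x).card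

/-- The number of edges with given degrees at the source and at the target. -/
def edgeCount (E : Finset (Fin n × Fin n)) (α β : DegreeType) (x : ℕ × ℕ) : ℕ :=
  (E.filter fun e => (sourceDegree E α e, targetDegree E β e) = x).card

/-- Erasing edges changes the joint degree counts only slightly. -/
theorem abs_edgeCount_sub_stubCount_le (α β : DegreeType) (x : ℕ × ℕ) (K : ℕ) :
    |(edgeCount (erase d σ) α β x : ℝ) - stubCount σ α β x|
      ≤ (1 + 2 * K) * erasedCount σ + tailSum d .plus K + tailSum d .minus K := by
  set E := erase d σ
  set p : Fin n × Fin n → Prop := fun e => (stubDegree d α e.1, stubDegree d β e.2) = x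
  have h1 : (E.filter p).card ≤ stubCount σ α β x := card_filter_erase_le σ p
  have h2 : (E.filter fun e => ¬ p e).card ≤
      (Finset.univ.filter fun s => ¬ p (stubEdge σ s)).card :=
    card_filter_erase_le σ fun e => ¬ p e
  have h3 := Finset.card_filter_add_card_filter_not (s := E) p
  have h4 := Finset.card_filter_add_card_filter_not
    (s := (Finset.univ : Finset (OutStub d))) fun s => p (stubEdge σ s)
  rw [Finset.card_univ, card_outStub] at h4
  have h5 : E.card + erasedCount σ = ∑ v, d.2 v := card_erase_add σ
  change stubCount σ α β x + _ = _ at h4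
  have h6 : stubCount σ α β x ≤ (E.filter p).card + erasedCount σ := by omega
  set S := E.filter fun e => e.1 ∈ affected σ α
  set T := E.filter fun e => e.2 ∈ affected σ β
  have h7 : ∀ e ∈ E, e ∉ S → e ∉ T →
      ((sourceDegree E α e, targetDegree E β e) = x ↔ p e) := by
    intro e he hS hT
    have a1 : degree E α e.1 = stubDegree d α e.1 := by
      by_contra hc; exact hS (by simp [S, he, affected]; exact hc)
    have a2 : degree E β e.2 = stubDegree d β e.2 := by
      by_contra hc; exact hT (by simp [T, he, affected]; exact hc)
    simp only [sourceDegree, targetDegree, a1, a2, p]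
  have h8 : edgeCount E α β x ≤ (E.filter p).card + (S.card + T.card) := by
    refine (Finset.card_le_card (t := E.filter p ∪ (S ∪ T)) fun e he => ?_).trans
      ((Finset.card_union_le _ _).trans (add_le_add le_rfl (Finset.card_union_le _ _)))
    rw [Finset.mem_filter] at he
    simp only [Finset.mem_union]
    by_cases hS : e ∈ S
    · exact Or.inr (Or.inl hS)
    by_cases hT : e ∈ T
    · exact Or.inr (Or.inr hT)
    exact Or.inl (Finset.mem_filter.2 ⟨he.1, (h7 e he.1 hS hT).1 he.2⟩)
  have h9 : (E.filter p).card ≤ edgeCount E α β x + (S.card + T.card) := by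
    refine (Finset.card_le_card (t := (E.filter fun e =>
      (sourceDegree E α e, targetDegree E β e) = x) ∪ (S ∪ T)) fun e he => ?_).trans
      ((Finset.card_union_le _ _).trans (add_le_add le_rfl (Finset.card_union_le _ _)))
    rw [Finset.mem_filter] at he
    simp only [Finset.mem_union]
    by_cases hS : e ∈ S
    · exact Or.inr (Or.inl hS)
    by_cases hT : e ∈ T
    · exact Or.inr (Or.inr hT)
    exact Or.inl (Finset.mem_filter.2 ⟨he.1, (h7 e he.1 hS hT).2 he.2⟩)
  have hS : S.card ≤ K * erasedCount σ + tailSum d .plus K :=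
    (card_filter_source_le σ K _).trans
      (add_le_add (Nat.mul_le_mul_left K (card_affected_le σ α)) le_rfl)
  have hT : T.card ≤ K * erasedCount σ + tailSum d .minus K :=
    (card_filter_target_le σ K _).trans
      (add_le_add (Nat.mul_le_mul_left K (card_affected_le σ β)) le_rfl)
  have hS' : (S.card : ℝ) ≤ K * erasedCount σ + tailSum d .plus K := by exact_mod_cast hS
  have hT' : (T.card : ℝ) ≤ K * erasedCount σ + tailSum d .minus K := by exact_mod_cast hT
  have h1' : ((E.filter p).card : ℝ) ≤ stubCount σ α β x := by exact_mod_cast h1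
  have h6' : (stubCount σ α β x : ℝ) ≤ (E.filter p).card + erasedCount σ := by exact_mod_cast h6
  have h8' : (edgeCount E α β x : ℝ) ≤ (E.filter p).card + (S.card + T.card) := by
    exact_mod_cast h8
  have h9' : ((E.filter p).card : ℝ) ≤ edgeCount E α β x + (S.card + T.card) := by
    exact_mod_cast h9
  have hr : (0 : ℝ) ≤ erasedCount σ := Nat.cast_nonneg _
  rw [abs_le]
  constructor <;> linarith

/-- The number of loops and the number of pairs of parallel edges between vertices with at most
`K` stubs of each type. -/
noncomputable def lowCollisions (K : ℕ) (σ : Pairing d) : ℝ :=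
  ∑ s : OutStub d, ((if s.1 = (σ.equiv s).1 ∧ d.1 (σ.equiv s).1 ≤ K then 1 else 0)
    + ∑ s' ∈ Finset.univ.erase s, (if s.1 = s'.1 ∧ d.2 s.1 ≤ K then 1 else 0)
      * (if (σ.equiv s).1 = (σ.equiv s').1 ∧ d.1 (σ.equiv s).1 ≤ K then 1 else 0))

theorem lowCollisions_nonneg (K : ℕ) (σ : Pairing d) : 0 ≤ lowCollisions K σ := by
  unfold lowCollisions
  refine Finset.sum_nonneg fun s _ => add_nonneg (by positivity)
    (Finset.sum_nonneg fun s' _ => by positivity)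

/-- Stubs that are neither loops nor parallel to another stub inject into the surviving edges. Each
remaining stub leaves a vertex of high out-degree, enters one of high in-degree, or is seen by
`lowCollisions`. -/
theorem erasedCount_le (K : ℕ) :
    (erasedCount σ : ℝ) ≤ tailSum d .plus K + tailSum d .minus K + lowCollisions K σ := by
  classical
  set bad : Finset (OutStub d) := Finset.univ.filter fun s =>
    s.1 = (σ.equiv s).1 ∨ ∃ s', s' ≠ s ∧ stubEdge σ s' = stubEdge σ s
  have h1 : (Finset.univ \ bad).card ≤ (erase d σ).card := by
    refine Finset.card_le_card_of_injOn (stubEdge σ) ?_ ?_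
    · intro s hs
      simp only [bad, Finset.coe_sdiff, Set.mem_sdiff, Finset.mem_coe, Finset.mem_univ, true_and,
        Finset.mem_filter, not_or] at hs
      rw [erase_eq, Finset.mem_coe, Finset.mem_filter]
      exact ⟨Finset.mem_image_of_mem _ (Finset.mem_univ _), hs.1⟩
    · intro s hs s' _ h
      simp only [bad, Finset.coe_sdiff, Set.mem_sdiff, Finset.mem_coe, Finset.mem_univ, true_and,
        Finset.mem_filter, not_or, not_exists, not_and] at hs
      by_contra hne
      exact hs.2 s' (Ne.symm hne) h.symm
  have h2 : erasedCount σ ≤ bad.card := by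
    have h3 := Finset.card_sdiff_add_card_inter Finset.univ bad
    rw [Finset.univ_inter, Finset.card_univ, card_outStub] at h3
    have := card_erase_add σ
    omega
  have h3 : (bad.card : ℝ) ≤ ∑ s : OutStub d, ((if K < d.2 s.1 then 1 else 0)
      + (if K < d.1 (stubEdge σ s).2 then 1 else 0)
      + ((if s.1 = (σ.equiv s).1 ∧ d.1 (σ.equiv s).1 ≤ K then 1 else 0)
    + ∑ s' ∈ Finset.univ.erase s, (if s.1 = s'.1 ∧ d.2 s.1 ≤ K then 1 else 0)
      * (if (σ.equiv s).1 = (σ.equiv s').1 ∧ d.1 (σ.equiv s).1 ≤ K then (1 : ℝ) else 0))) := by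
    rw [Finset.card_filter]
    push_cast
    refine Finset.sum_le_sum fun s _ => ?_
    have p1 : (0 : ℝ) ≤ (if K < d.2 s.1 then 1 else 0) := by positivity
    have p2 : (0 : ℝ) ≤ (if K < d.1 (stubEdge σ s).2 then 1 else 0) := by positivity
    have p3 : (0 : ℝ) ≤ (if s.1 = (σ.equiv s).1 ∧ d.1 (σ.equiv s).1 ≤ K then 1 else 0) := by
      positivity
    have p4 : (0 : ℝ) ≤ ∑ s' ∈ Finset.univ.erase s, (if s.1 = s'.1 ∧ d.2 s.1 ≤ K then 1 else 0)
      * (if (σ.equiv s).1 = (σ.equiv s').1 ∧ d.1 (σ.equiv s).1 ≤ K then (1 : ℝ) else 0) :=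
      Finset.sum_nonneg fun s' _ => by positivity
    by_cases c0 : s.1 = (σ.equiv s).1 ∨ ∃ s', s' ≠ s ∧ stubEdge σ s' = stubEdge σ s
    swap
    · rw [if_neg c0]; linarith
    rw [if_pos c0]
    by_cases c1 : K < d.2 s.1
    · rw [if_pos c1]; linarith
    by_cases c2 : K < d.1 (stubEdge σ s).2
    · rw [if_pos c2]; linarith
    rcases c0 with c0 | ⟨s', hs', hss'⟩
    · rw [if_pos (⟨c0, not_lt.1 c2⟩ : s.1 = (σ.equiv s).1 ∧ d.1 (σ.equiv s).1 ≤ K)]; linarith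
    · have hs1 : s'.1 = s.1 := congrArg Prod.fst hss'
      have hs2 : (σ.equiv s').1 = (σ.equiv s).1 := congrArg Prod.snd hss'
      have hle := Finset.single_le_sum (f := fun s' =>
        (if s.1 = s'.1 ∧ d.2 s.1 ≤ K then 1 else 0)
        * (if (σ.equiv s).1 = (σ.equiv s').1 ∧ d.1 (σ.equiv s).1 ≤ K then (1 : ℝ) else 0))
        (s := Finset.univ.erase s) (fun _ _ => by positivity)
        (Finset.mem_erase.2 ⟨hs', Finset.mem_univ _⟩)
      rw [if_pos (⟨hs1.symm, not_lt.1 c1⟩ : s.1 = s'.1 ∧ d.2 s.1 ≤ K),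
        if_pos (⟨hs2.symm, not_lt.1 c2⟩ : (σ.equiv s).1 = (σ.equiv s').1 ∧ d.1 (σ.equiv s).1 ≤ K)]
        at hle
      linarith
  have h4 : ∑ s : OutStub d, (if K < d.2 s.1 then (1 : ℝ) else 0) = tailSum d .plus K := by
    have := card_outStub_filter d fun v => K < d.2 v
    rw [Finset.card_filter] at this
    exact_mod_cast this
  have h5 : ∑ s : OutStub d, (if K < d.1 (stubEdge σ s).2 then (1 : ℝ) else 0)
      = tailSum d .minus K := by
    have := card_filter_target σ fun v => K < d.1 v
    rw [Finset.card_filter] at this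
    exact_mod_cast this
  rw [Finset.sum_add_distrib, Finset.sum_add_distrib, h4, h5] at h3
  refine le_trans ?_ h3
  exact_mod_cast h2

/-- The expected number of collisions between vertices of bounded degrees is bounded. -/
theorem avg_lowCollisions_le [Nonempty (Pairing d)] (K : ℕ) (hM : 2 ≤ ∑ v, d.2 v) :
    avg (lowCollisions (d := d) K) ≤ K + 2 * (K : ℝ) ^ 2 := by
  obtain ⟨σ₀⟩ := ‹Nonempty (Pairing d)›
  have hne : Nonempty (OutStub d ≃ InStub d) := ⟨σ₀⟩
  have hcard : Fintype.card (InStub d) = ∑ v, d.2 v := by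
    rw [← card_outStub]; exact (Fintype.card_congr σ₀.equiv).symm
  set M : ℝ := (Fintype.card (InStub d) : ℝ)
  have hM2 : 2 ≤ M := by
    refine Nat.ofNat_le_cast.2 ?_
    rwa [hcard]
  have hK : (0 : ℝ) ≤ K := Nat.cast_nonneg _
  change avg (fun σ : OutStub d ≃ InStub d => ∑ s : OutStub d,
    ((if s.1 = (σ s).1 ∧ d.1 (σ s).1 ≤ K then 1 else 0)
    + ∑ s' ∈ Finset.univ.erase s, (if s.1 = s'.1 ∧ d.2 s.1 ≤ K then 1 else 0)
      * (if (σ s).1 = (σ s').1 ∧ d.1 (σ s).1 ≤ K then 1 else 0))) ≤ _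
  rw [avg_sum]
  have hloop : ∀ s : OutStub d, avg (fun σ : OutStub d ≃ InStub d =>
      if s.1 = (σ s).1 ∧ d.1 (σ s).1 ≤ K then (1 : ℝ) else 0) ≤ K / M := by
    intro s
    rw [avg_equiv_apply s fun t : InStub d => if s.1 = t.1 ∧ d.1 t.1 ≤ K then (1 : ℝ) else 0,
      sum_inStub d fun v => if s.1 = v ∧ d.1 v ≤ K then (1 : ℝ) else 0]
    refine div_le_div_of_nonneg_right ?_ (Nat.cast_nonneg _)
    rw [Finset.sum_eq_single s.1]
    · split_ifs with h
      · simpa using h.2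
      · simp
    · intro v _ hv; simp [hv.symm]
    · simp
  have hoff : ∑ p ∈ (Finset.univ : Finset (InStub d)).offDiag,
      (if p.1.1 = p.2.1 ∧ d.1 p.1.1 ≤ K then (1 : ℝ) else 0) ≤ M * K := by
    calc ∑ p ∈ (Finset.univ : Finset (InStub d)).offDiag,
          (if p.1.1 = p.2.1 ∧ d.1 p.1.1 ≤ K then (1 : ℝ) else 0)
        ≤ ∑ p : InStub d × InStub d, (if p.1.1 = p.2.1 ∧ d.1 p.1.1 ≤ K then (1 : ℝ) else 0) :=
          Finset.sum_le_sum_of_subset_of_nonneg (Finset.subset_univ _) fun _ _ _ => by positivity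
      _ = ∑ t : InStub d, ∑ t' : InStub d,
          (if t.1 = t'.1 ∧ d.1 t.1 ≤ K then (1 : ℝ) else 0) := Fintype.sum_prod_type _
      _ ≤ ∑ t : InStub d, (K : ℝ) := by
          refine Finset.sum_le_sum fun t _ => ?_
          rw [sum_inStub d fun v => if t.1 = v ∧ d.1 t.1 ≤ K then (1 : ℝ) else 0,
            Finset.sum_eq_single t.1]
          · split_ifs with h
            · simpa using h.2
            · simp
          · intro v _ hv; simp [hv.symm]
          · simp
      _ = M * K := by rw [Finset.sum_const, nsmul_eq_mul, Finset.card_univ]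
  have hpair : ∀ s : OutStub d, ∀ s' ∈ Finset.univ.erase s, avg (fun σ : OutStub d ≃ InStub d =>
      (if s.1 = s'.1 ∧ d.2 s.1 ≤ K then 1 else 0)
      * (if (σ s).1 = (σ s').1 ∧ d.1 (σ s).1 ≤ K then (1 : ℝ) else 0))
      ≤ (if s.1 = s'.1 ∧ d.2 s.1 ≤ K then 1 else 0) * (M * K / (M * (M - 1))) := by
    intro s s' hs'
    rw [avg_const_mul, avg_equiv_apply_pair (Finset.ne_of_mem_erase hs').symm
      fun p : InStub d × InStub d => if p.1.1 = p.2.1 ∧ d.1 p.1.1 ≤ K then (1 : ℝ) else 0]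
    refine mul_le_mul_of_nonneg_left (div_le_div_of_nonneg_right hoff ?_) (by positivity)
    exact mul_nonneg (by linarith) (by linarith)
  have hq : M * K / (M * (M - 1)) ≤ 2 * K / M := by
    rw [div_le_div_iff₀ (mul_pos (by linarith) (by linarith)) (by linarith)]
    have : 0 ≤ (M - 2) * (M * K) := mul_nonneg (by linarith) (by positivity)
    nlinarith
  have hq0 : 0 ≤ M * K / (M * (M - 1)) :=
    div_nonneg (by positivity) (mul_nonneg (by linarith) (by linarith))
  calc ∑ s : OutStub d, avg (fun σ : OutStub d ≃ InStub d =>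
        (if s.1 = (σ s).1 ∧ d.1 (σ s).1 ≤ K then 1 else 0)
        + ∑ s' ∈ Finset.univ.erase s, (if s.1 = s'.1 ∧ d.2 s.1 ≤ K then 1 else 0)
        * (if (σ s).1 = (σ s').1 ∧ d.1 (σ s).1 ≤ K then 1 else 0))
      ≤ ∑ s : OutStub d, (K / M + K * (2 * K / M)) := by
        refine Finset.sum_le_sum fun s _ => ?_
        rw [avg_add, avg_sum]
        refine add_le_add (hloop s) ((Finset.sum_le_sum (hpair s)).trans ?_)
        rw [← Finset.sum_mul]
        refine mul_le_mul ?_ hq hq0 hK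
        refine (Finset.sum_le_sum_of_subset_of_nonneg (Finset.subset_univ _)
          fun _ _ _ => by positivity).trans ?_
        rw [sum_outStub d fun v => if s.1 = v ∧ d.2 s.1 ≤ K then (1 : ℝ) else 0,
          Finset.sum_eq_single s.1]
        · split_ifs with h
          · simpa using h.2
          · simp
        · intro v _ hv; simp [hv.symm]
        · simp
    _ = K + 2 * (K : ℝ) ^ 2 := by
        have hMc : (Fintype.card (OutStub d) : ℝ) = M := by
          rw [Fintype.card_congr σ₀.equiv]
        rw [Finset.sum_const, nsmul_eq_mul, Finset.card_univ, hMc]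
        have : M ≠ 0 := by linarith
        field_simp

end Erasure

/-! ### Erased graphs of well-behaved stub sequences -/

/-- Allows the limit in `j` at a fixed cut-off `K`, followed by `K → ∞`, without choosing `K` as a
function of `j`. -/
theorem tendsto_zero_of_abs_le_family {J : Type*} {l : Filter J} {X : J → ℝ} {Y : ℕ → J → ℝ}
    {y : ℕ → ℝ} (hX : ∀ K, ∀ᶠ j in l, |X j| ≤ Y K j) (hY : ∀ K, Tendsto (Y K) l (𝓝 (y K)))
    (hy : Tendsto y atTop (𝓝 0)) : Tendsto X l (𝓝 0) := by
  rw [Metric.tendsto_nhds]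
  intro ε hε
  obtain ⟨K, hK⟩ := ((tendsto_order.1 hy).2 ε hε).exists
  filter_upwards [hX K, (tendsto_order.1 (hY K)).2 ε hK] with j h1 h2
  rw [Real.dist_eq, sub_zero]
  exact h1.trans_lt h2

theorem tendsto_zero_of_avg {J : Type*} {l : Filter J} {X : J → Type*} [∀ j, Fintype (X j)]
    [∀ j, MeasurableSpace (X j)] [∀ j, DiscreteMeasurableSpace (X j)] (F : ∀ j, X j → ℝ)
    (hF : ∀ j x, 0 ≤ F j x) (h : Tendsto (fun j => avg (F j)) l (𝓝 0)) :
    Tendsto (fun z : Σ j, X j => F z.1 z.2)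
      (whp l fun j => uniformOn (Set.univ : Set (X j))) (𝓝 0) := by
  rw [Metric.tendsto_nhds]
  intro ε hε
  rw [eventually_whp]
  have hlim : Tendsto (fun j => ENNReal.ofReal (avg (F j) / ε)) l (𝓝 0) := by
    simpa using ENNReal.tendsto_ofReal (h.div_const ε)
  refine tendsto_of_tendsto_of_tendsto_of_le_of_le tendsto_const_nhds hlim (fun _ => zero_le)
    fun j => ?_
  refine (measure_mono fun x hx => ?_).trans (uniformOn_univ_le (hF j) hε)
  simpa [Real.dist_eq, abs_of_nonneg (hF j x)] using hx

/-- The count is the number of outbound stubs in one set that the bijection sends into a given set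
of inbound stubs, so the variance bound for random bijections applies. -/
theorem avg_stubCount_sub_sq_le {n : ℕ} {d : BiDegrees n} (α β : DegreeType) (x : ℕ × ℕ)
    (hd : ∑ v, d.1 v = ∑ v, d.2 v) (hM : 2 ≤ ∑ v, d.2 v) :
    avg (fun σ : Pairing d => ((stubCount σ α β x : ℝ)
      - (∑ v with stubDegree d α v = x.1, d.2 v : ℕ) * (∑ v with stubDegree d β v = x.2, d.1 v : ℕ)
        / (∑ v, d.2 v : ℕ)) ^ 2) ≤ (∑ v, d.2 v : ℕ) := by
  have hcard : Fintype.card (InStub d) = ∑ v, d.2 v := by rw [card_inStub, hd]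
  have hne : Nonempty (OutStub d ≃ InStub d) := by
    rw [← Fintype.card_eq, hcard, card_outStub]
  have := avg_card_sub_sq_le (Finset.univ.filter fun s : OutStub d => stubDegree d α s.1 = x.1)
    (Finset.univ.filter fun t : InStub d => stubDegree d β t.1 = x.2) (by rwa [hcard])
  rw [hcard, card_outStub_filter d fun v => stubDegree d α v = x.1,
    card_inStub_filter d fun v => stubDegree d β v = x.2] at this
  refine le_trans (le_of_eq ?_) this
  change avg (fun σ : OutStub d ≃ InStub d => _) = _
  congr 1
  funext σ
  have hcount : stubCount (d := d) σ α β x = ((Finset.univ.filter fun s : OutStub d =>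
      stubDegree d α s.1 = x.1).filter fun s => σ s ∈ Finset.univ.filter fun t : InStub d =>
        stubDegree d β t.1 = x.2).card := by
    unfold stubCount
    rw [Finset.filter_filter]
    congr 1
    ext s
    simp only [Finset.mem_filter, Finset.mem_univ, true_and]
    rw [Prod.ext_iff]
    rfl
  rw [← hcount]

section Limits

variable {ν : ∀ n, Measure (BiDegrees n)} {μ : ℝ} {α β : DegreeType} {f g : ℕ → ℝ}
  {T T' : ℕ → ℝ}
  (hμ : 0 < μ)
  (hbal : ∀ᶠ z in whp atTop ν, ∑ v, z.2.1 v = ∑ v, z.2.2 v)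
  (hM : Tendsto (fun z : Σ n, BiDegrees n => ((∑ v, z.2.2 v : ℕ) : ℝ) / z.1) (whp atTop ν) (𝓝 μ))
  (hS : ∀ k, Tendsto (fun z : Σ n, BiDegrees n =>
    ((∑ v with stubDegree z.2 α v = k, z.2.2 v : ℕ) : ℝ) / z.1) (whp atTop ν) (𝓝 (μ * f k)))
  (hT : ∀ k, Tendsto (fun z : Σ n, BiDegrees n =>
    ((∑ v with stubDegree z.2 β v = k, z.2.1 v : ℕ) : ℝ) / z.1) (whp atTop ν) (𝓝 (μ * g k)))
  (htail : ∀ K, Tendsto (fun z : Σ n, BiDegrees n => (tailSum z.2 .plus K : ℝ) / z.1)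
    (whp atTop ν) (𝓝 (T K)))
  (htail' : ∀ K, Tendsto (fun z : Σ n, BiDegrees n => (tailSum z.2 .minus K : ℝ) / z.1)
    (whp atTop ν) (𝓝 (T' K)))
  (hT0 : Tendsto T atTop (𝓝 0)) (hT0' : Tendsto T' atTop (𝓝 0))

/-- The pairings, with high probability. -/
noncomputable abbrev pairingWhp (ν : ∀ n, Measure (BiDegrees n)) :
    Filter (Σ z : (Σ n, BiDegrees n), Pairing z.2) :=
  whp (whp atTop ν) fun z => uniformOn (Set.univ : Set (Pairing z.2))

include hμ hM in
theorem tendsto_stubs_atTop :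
    Tendsto (fun z : Σ n, BiDegrees n => ((∑ v, z.2.2 v : ℕ) : ℝ)) (whp atTop ν) atTop := by
  have hn : Tendsto (fun z : Σ n, BiDegrees n => (z.1 : ℝ)) (whp atTop ν) atTop :=
    tendsto_natCast_fst_whp
  refine (hM.pos_mul_atTop hμ hn).congr' ?_
  filter_upwards [hn.eventually_gt_atTop 0] with z hz
  field_simp

include hμ hbal hM htail htail' hT0 hT0' in
theorem tendsto_erasedCount :
    Tendsto (fun y : Σ z : (Σ n, BiDegrees n), Pairing z.2 => (erasedCount y.2 : ℝ) / y.1.1)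
      (pairingWhp ν) (𝓝 0) := by
  have hn : Tendsto (fun z : Σ n, BiDegrees n => (z.1 : ℝ)) (whp atTop ν) atTop :=
    tendsto_natCast_fst_whp
  have hlow : ∀ K, Tendsto (fun y : Σ z : (Σ n, BiDegrees n), Pairing z.2 =>
      lowCollisions K y.2 / y.1.1) (pairingWhp ν) (𝓝 0) := by
    intro K
    refine tendsto_zero_of_avg (X := fun z : Σ n, BiDegrees n => Pairing z.2)
      (fun z σ => lowCollisions K σ / z.1)
      (fun z σ => div_nonneg (lowCollisions_nonneg K σ) (Nat.cast_nonneg _)) ?_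
    refine squeeze_zero' (g := fun z : Σ n, BiDegrees n => (K + 2 * (K : ℝ) ^ 2) / z.1) ?_ ?_
      (hn.const_div_atTop _)
    · refine Eventually.of_forall fun z => div_nonneg (Finset.sum_nonneg fun σ _ =>
        div_nonneg (lowCollisions_nonneg K σ) (Nat.cast_nonneg _)) (Nat.cast_nonneg _)
    · filter_upwards [hbal, (tendsto_stubs_atTop hμ hM).eventually_ge_atTop 2] with z h1 h2
      have hne : Nonempty (Pairing z.2) := by
        change Nonempty (OutStub z.2 ≃ InStub z.2)
        rw [← Fintype.card_eq, card_inStub, h1, card_outStub]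
      have h3 := avg_lowCollisions_le (d := z.2) K (by exact_mod_cast h2)
      have h4 : avg (fun σ : Pairing z.2 => lowCollisions K σ / z.1)
          = avg (lowCollisions (d := z.2) K) / z.1 := by
        simp only [div_eq_inv_mul]
        exact avg_const_mul _ _
      rw [h4]
      exact div_le_div_of_nonneg_right h3 (Nat.cast_nonneg _)
  refine tendsto_zero_of_abs_le_family (Y := fun K y => (tailSum y.1.2 .plus K : ℝ) / y.1.1
    + (tailSum y.1.2 .minus K : ℝ) / y.1.1 + lowCollisions K y.2 / y.1.1)
    (y := fun K => T K + T' K + 0) (fun K => Eventually.of_forall fun y => ?_)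
    -- For fixed `K` the collisions have bounded mean and vanish after division by `n`; only the two
    -- tails survive, and they disappear as `K → ∞`.
    (fun K => (((htail K).comp tendsto_fst_whp).add ((htail' K).comp tendsto_fst_whp)).add (hlow K))
    (by simpa using hT0.add hT0')
  rw [abs_of_nonneg (by positivity), ← add_div, ← add_div]
  exact div_le_div_of_nonneg_right (erasedCount_le y.2 K) (Nat.cast_nonneg _)

include hμ hbal hM hS hT in
theorem tendsto_stubCount (x : ℕ × ℕ) :
    Tendsto (fun y : Σ z : (Σ n, BiDegrees n), Pairing z.2 => (stubCount y.2 α β x : ℝ) / y.1.1)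
      (pairingWhp ν) (𝓝 (μ * (f x.1 * g x.2))) := by
  have hn : Tendsto (fun z : Σ n, BiDegrees n => (z.1 : ℝ)) (whp atTop ν) atTop :=
    tendsto_natCast_fst_whp
  set c : (Σ n, BiDegrees n) → ℝ := fun z => (∑ v with stubDegree z.2 α v = x.1, z.2.2 v : ℕ)
    * (∑ v with stubDegree z.2 β v = x.2, z.2.1 v : ℕ) / (∑ v, z.2.2 v : ℕ)
  have hc : Tendsto (fun z => c z / z.1) (whp atTop ν) (𝓝 (μ * (f x.1 * g x.2))) := by
    have h := ((hS x.1).mul (hT x.2)).div hM hμ.ne'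
    have e : μ * f x.1 * (μ * g x.2) / μ = μ * (f x.1 * g x.2) := by field_simp
    rw [e] at h
    refine h.congr' ?_
    filter_upwards [hn.eventually_gt_atTop 0] with z hz
    simp only [Pi.div_apply, c]
    field_simp
  have hdev : Tendsto (fun y : Σ z : (Σ n, BiDegrees n), Pairing z.2 =>
      (((stubCount y.2 α β x : ℝ) - c y.1) / y.1.1) ^ 2) (pairingWhp ν) (𝓝 0) := by
    refine tendsto_zero_of_avg (X := fun z : Σ n, BiDegrees n => Pairing z.2)
      (fun z σ => (((stubCount σ α β x : ℝ) - c z) / z.1) ^ 2) (fun z σ => sq_nonneg _) ?_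
    have hlim : Tendsto (fun z : Σ n, BiDegrees n =>
        ((∑ v, z.2.2 v : ℕ) : ℝ) / z.1 * (1 / z.1)) (whp atTop ν) (𝓝 0) := by
      simpa using hM.mul (hn.const_div_atTop 1)
    refine squeeze_zero' (Eventually.of_forall fun z => div_nonneg
      (Finset.sum_nonneg fun σ _ => sq_nonneg _) (Nat.cast_nonneg _)) ?_ hlim
    filter_upwards [hbal, (tendsto_stubs_atTop hμ hM).eventually_ge_atTop 2] with z h1 h2
    have h3 := avg_stubCount_sub_sq_le (d := z.2) α β x h1 (by exact_mod_cast h2)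
    have h4 : avg (fun σ : Pairing z.2 => (((stubCount σ α β x : ℝ) - c z) / z.1) ^ 2)
        = (1 / (z.1 : ℝ)) ^ 2 * avg (fun σ : Pairing z.2 => ((stubCount σ α β x : ℝ) - c z) ^ 2) := by
      rw [← avg_const_mul]
      congr 1
      funext σ
      ring
    rw [h4]
    refine (mul_le_mul_of_nonneg_left h3 (sq_nonneg _)).trans (le_of_eq (by ring))
  have hdev' : Tendsto (fun y : Σ z : (Σ n, BiDegrees n), Pairing z.2 =>
      ((stubCount y.2 α β x : ℝ) - c y.1) / y.1.1) (pairingWhp ν) (𝓝 0) := by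
    have h := hdev.sqrt
    rw [Real.sqrt_zero] at h
    simp only [Real.sqrt_sq_eq_abs] at h
    exact tendsto_zero_iff_abs_tendsto_zero _ |>.2 h
  have h := hdev'.add (hc.comp tendsto_fst_whp)
  rw [zero_add] at h
  refine h.congr fun y => ?_
  simp only [Function.comp_apply]
  ring

include hμ hbal hM htail htail' hT0 hT0'

theorem tendsto_card_erase :
    Tendsto (fun y : Σ z : (Σ n, BiDegrees n), Pairing z.2 => ((erase y.1.2 y.2).card : ℝ) / y.1.1)
      (pairingWhp ν) (𝓝 μ) := by
  have h := (hM.comp tendsto_fst_whp).sub (tendsto_erasedCount hμ hbal hM htail htail' hT0 hT0')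
  rw [sub_zero] at h
  refine h.congr fun y => ?_
  simp only [Function.comp_apply]
  rw [← card_erase_add y.2]
  push_cast
  ring

theorem tendsto_card_erase_atTop :
    Tendsto (fun y : Σ z : (Σ n, BiDegrees n), Pairing z.2 => ((erase y.1.2 y.2).card : ℝ))
      (pairingWhp ν) atTop := by
  have hn : Tendsto (fun y : Σ z : (Σ n, BiDegrees n), Pairing z.2 => (y.1.1 : ℝ))
    (pairingWhp ν) atTop := tendsto_natCast_fst_whp.comp tendsto_fst_whp
  refine ((tendsto_card_erase hμ hbal hM htail htail' hT0 hT0').pos_mul_atTop hμ hn).congr' ?_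
  filter_upwards [hn.eventually_gt_atTop 0] with y hy
  field_simp

include hS hT

theorem tendsto_edgeCount (x : ℕ × ℕ) :
    Tendsto (fun y : Σ z : (Σ n, BiDegrees n), Pairing z.2 =>
      (edgeCount (erase y.1.2 y.2) α β x : ℝ) / y.1.1)
      (pairingWhp ν) (𝓝 (μ * (f x.1 * g x.2))) := by
  have hr := tendsto_erasedCount hμ hbal hM htail htail' hT0 hT0'
  have hdiff : Tendsto (fun y : Σ z : (Σ n, BiDegrees n), Pairing z.2 =>
      ((edgeCount (erase y.1.2 y.2) α β x : ℝ) - stubCount y.2 α β x) / y.1.1)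
      (pairingWhp ν) (𝓝 0) := by
    -- The factor `1 + 2 K` is harmless, since `K` is fixed while the proportion of erased edges
    -- tends to zero.
    refine tendsto_zero_of_abs_le_family (Y := fun K y => (1 + 2 * (K : ℝ))
      * ((erasedCount y.2 : ℝ) / y.1.1) + (tailSum y.1.2 .plus K : ℝ) / y.1.1
      + (tailSum y.1.2 .minus K : ℝ) / y.1.1)
      (y := fun K => (1 + 2 * (K : ℝ)) * 0 + T K + T' K) (fun K => Eventually.of_forall fun y => ?_)
      (fun K => ((hr.const_mul _).add ((htail K).comp tendsto_fst_whp)).add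
        ((htail' K).comp tendsto_fst_whp))
      (by simpa using hT0.add hT0')
    rw [abs_div, Nat.abs_cast]
    refine (div_le_div_of_nonneg_right (abs_edgeCount_sub_stubCount_le y.2 α β x K)
      (Nat.cast_nonneg _)).trans (le_of_eq (by ring))
  have h := hdiff.add (tendsto_stubCount hμ hbal hM hS hT x)
  rw [zero_add] at h
  exact h.congr fun y => by ring

theorem tendsto_edgeCount_div_card (x : ℕ × ℕ) :
    Tendsto (fun y : Σ z : (Σ n, BiDegrees n), Pairing z.2 =>
      (edgeCount (erase y.1.2 y.2) α β x : ℝ) / (erase y.1.2 y.2).card)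
      (pairingWhp ν) (𝓝 (f x.1 * g x.2)) := by
  have hn : Tendsto (fun y : Σ z : (Σ n, BiDegrees n), Pairing z.2 => (y.1.1 : ℝ))
    (pairingWhp ν) atTop := tendsto_natCast_fst_whp.comp tendsto_fst_whp
  have h := (tendsto_edgeCount hμ hbal hM hS hT htail htail' hT0 hT0' x).div
    (tendsto_card_erase hμ hbal hM htail htail' hT0 hT0') hμ.ne'
  rw [mul_div_cancel_left₀ _ hμ.ne'] at h
  refine h.congr' ?_
  filter_upwards [hn.eventually_gt_atTop 0] with y hy
  simp only [Pi.div_apply]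
  field_simp

end Limits

/-! ### The law of large numbers for stub sequences -/

instance (pIn pOut : PMF ℕ) (n : ℕ) : IsProbabilityMeasure (iidLaw pIn pOut n) := by
  unfold iidLaw; infer_instance

/-- The joint law of the in- and the out-degree of a vertex. -/
noncomputable abbrev pairLaw (pIn pOut : PMF ℕ) : Measure (ℕ × ℕ) :=
  pIn.toMeasure.prod pOut.toMeasure

/-- Realises the samples for all `n` on one space, where the strong law applies. This coupling costs
nothing, since convergence in probability to a constant depends only on the law for each `n`. -/
theorem map_infinitePi_pairLaw (pIn pOut : PMF ℕ) (n : ℕ) :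
    (Measure.infinitePi fun _ : ℕ => pairLaw pIn pOut).map
      (fun ω => ((fun i : Fin n => (ω i).1, fun i : Fin n => (ω i).2) : BiDegrees n))
      = iidLaw pIn pOut n := by
  have h1 : iIndepFun (fun (i : ℕ) (ω : ℕ → ℕ × ℕ) => ω i)
      (Measure.infinitePi fun _ : ℕ => pairLaw pIn pOut) :=
    iIndepFun_infinitePi (X := fun _ x => x) fun _ => measurable_id
  have h2 := h1.precomp (g := (Fin.val : Fin n → ℕ)) Fin.val_injective
  rw [iIndepFun_iff_map_fun_eq_pi_map fun i => (measurable_pi_apply _).aemeasurable] at h2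
  have h3 : ∀ i : ℕ, (Measure.infinitePi fun _ : ℕ => pairLaw pIn pOut).map (fun ω => ω i)
      = pairLaw pIn pOut := fun i => Measure.infinitePi_map_eval _ i
  simp only [h3] at h2
  have h4 := (measurePreserving_arrowProdEquivProdArrow ℕ ℕ (Fin n)
    (fun _ => pIn.toMeasure) (fun _ => pOut.toMeasure)).map_eq
  rw [← h2, Measure.map_map (MeasurableEquiv.measurable _) (by fun_prop)] at h4
  exact h4

/-- The weak law of large numbers. -/
theorem tendsto_average_iid (pIn pOut : PMF ℕ) {φ : ℕ × ℕ → ℝ}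
    (hφ : Integrable φ (pairLaw pIn pOut)) :
    Tendsto (fun z : Σ n, BiDegrees n => (∑ v, φ (z.2.1 v, z.2.2 v)) / z.1)
      (whp atTop (iidLaw pIn pOut)) (𝓝 (∫ x, φ x ∂pairLaw pIn pOut)) := by
  set Q := Measure.infinitePi fun _ : ℕ => pairLaw pIn pOut
  have hmeas : Measurable φ := measurable_of_countable φ
  have heval : ∀ i : ℕ, MeasurePreserving (Function.eval i) Q (pairLaw pIn pOut) := fun i =>
    measurePreserving_eval_infinitePi (fun _ : ℕ => pairLaw pIn pOut) i
  have hind : iIndepFun (fun (i : ℕ) (ω : ℕ → ℕ × ℕ) => φ (ω i)) Q :=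
    iIndepFun_infinitePi (X := fun _ => φ) fun _ => hmeas
  have hslln := strong_law_ae_real (fun (i : ℕ) (ω : ℕ → ℕ × ℕ) => φ (ω i))
    ((heval 0).integrable_comp_of_integrable hφ) (fun i j hij => hind.indepFun hij)
    (fun i => by
      refine ⟨(hmeas.comp (measurable_pi_apply i)).aemeasurable,
        (hmeas.comp (measurable_pi_apply 0)).aemeasurable, ?_⟩
      have h : ∀ i : ℕ, Q.map (fun ω => φ (ω i)) = (pairLaw pIn pOut).map φ := fun i => by
        rw [← (heval i).map_eq, Measure.map_map hmeas (measurable_pi_apply i)]; rfl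
      rw [h, h])
  have hint : ∫ ω, φ (ω 0) ∂Q = ∫ x, φ x ∂pairLaw pIn pOut := by
    rw [← (heval 0).map_eq, integral_map (measurable_pi_apply 0).aemeasurable
      hmeas.aestronglyMeasurable]
  rw [hint] at hslln
  have hmeasure := tendstoInMeasure_of_tendsto_ae (fun n =>
    (Measurable.aestronglyMeasurable (by fun_prop))) hslln
  rw [tendstoInMeasure_iff_dist] at hmeasure
  rw [Metric.tendsto_nhds]
  intro ε hε
  rw [eventually_whp]
  refine (hmeasure ε hε).congr fun n => ?_
  rw [← map_infinitePi_pairLaw, Measure.map_apply (by fun_prop) MeasurableSet.of_discrete]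
  congr 1
  ext ω
  simp only [Set.mem_ofPred_eq, Set.mem_preimage, not_lt]
  rw [Finset.sum_range fun i => φ (ω i)]

/-! ### Balancing -/

section Balance

variable {n : ℕ} (d : BiDegrees n) (S : Finset (Fin n))

theorem sum_balance_eq (hS : S.card = (discrepancy d).natAbs) :
    ∑ v, (balance d S).1 v = ∑ v, (balance d S).2 v := by
  simp only [balance, Finset.sum_add_distrib]
  have hsum : ∀ p : Prop, [Decidable p] → ∑ v, (if p ∧ v ∈ S then 1 else 0)
      = if p then S.card else 0 := by
    intro p _
    split_ifs with h <;> simp [h]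
  rw [hsum, hsum]
  have hd : discrepancy d = ((∑ v, d.1 v : ℕ) : ℤ) - ((∑ v, d.2 v : ℕ) : ℤ) := by
    rw [discrepancy]; push_cast; rfl
  split_ifs <;> omega

theorem balance_apply_of_notMem {v : Fin n} (hv : v ∉ S) :
    (balance d S).1 v = d.1 v ∧ (balance d S).2 v = d.2 v := by
  simp [balance, hv]

theorem balance_apply_add_le (v : Fin n) :
    (balance d S).1 v + (balance d S).2 v ≤ d.1 v + d.2 v + 1 := by
  simp only [balance]
  split_ifs <;> omega

/-- Only vertices of `S` change, each by at most `2 (d.1 v + d.2 v) + 1`; summing over `S` with the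
cut-off `K` for both degrees gives `4 K + 1` and twice the tails. -/
theorem abs_sum_balance_sub_le {φ : ℕ × ℕ → ℝ} (hφ : ∀ x, |φ x| ≤ x.1 + x.2) (K : ℕ) :
    |∑ v, φ ((balance d S).1 v, (balance d S).2 v) - ∑ v, φ (d.1 v, d.2 v)|
      ≤ (4 * K + 1) * S.card + 2 * (tailSum d .minus K + tailSum d .plus K) := by
  rw [← Finset.sum_sub_distrib]
  have h1 : ∀ v, |φ ((balance d S).1 v, (balance d S).2 v) - φ (d.1 v, d.2 v)|
      ≤ if v ∈ S then 2 * ((d.1 v : ℝ) + d.2 v) + 1 else 0 := by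
    intro v
    split_ifs with hv
    · refine (abs_sub _ _).trans ?_
      have a1 := hφ ((balance d S).1 v, (balance d S).2 v)
      have a2 := hφ (d.1 v, d.2 v)
      have a3 : ((balance d S).1 v : ℝ) + (balance d S).2 v ≤ d.1 v + d.2 v + 1 := by
        exact_mod_cast balance_apply_add_le d S v
      simp only at a1 a2
      linarith
    · obtain ⟨e1, e2⟩ := balance_apply_of_notMem d S hv
      simp [e1, e2]
  refine (Finset.abs_sum_le_sum_abs _ _).trans ((Finset.sum_le_sum fun v _ => h1 v).trans ?_)
  rw [← Finset.sum_filter, Finset.filter_mem_eq_inter, Finset.univ_inter,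
    Finset.sum_add_distrib, ← Finset.mul_sum, Finset.sum_add_distrib]
  have h2 : ∑ v ∈ S, (d.1 v : ℝ) ≤ K * S.card + tailSum d .minus K := by
    exact_mod_cast sum_stubDegree_le d .minus K S
  have h3 : ∑ v ∈ S, (d.2 v : ℝ) ≤ K * S.card + tailSum d .plus K := by
    exact_mod_cast sum_stubDegree_le d .plus K S
  rw [Finset.sum_const, nsmul_eq_mul, mul_one]
  linarith

end Balance

/-- The random choices of the vertices that receive an additional stub, with high probability. -/
noncomputable abbrev balanceWhp (ν : ∀ n, Measure (BiDegrees n)) :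
    Filter (Σ z : (Σ n, BiDegrees n), Finset (Fin z.1)) :=
  whp (whp atTop ν) fun z => uniformOn {S : Finset (Fin z.1) | S.card = (discrepancy z.2).natAbs}

theorem eventually_balanceWhp (ν : ∀ n, Measure (BiDegrees n)) :
    ∀ᶠ y in balanceWhp ν, y.2.card = (discrepancy y.1.2).natAbs := by
  rw [eventually_whp]
  refine tendsto_const_nhds.congr fun z => ?_
  rw [uniformOn, cond_apply MeasurableSet.of_discrete]
  have : {S : Finset (Fin z.1) | S.card = (discrepancy z.2).natAbs}
      ∩ {S | ¬ S.card = (discrepancy z.2).natAbs} = ∅ := Set.inter_compl_self _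
  rw [this]; simp

section Stubs

variable {pIn pOut : PMF ℕ} {ν : ∀ n, Measure (BiDegrees n)}
  (hν : whp atTop ν ≤ whp atTop (iidLaw pIn pOut))
  (hdisc : Tendsto (fun z : Σ n, BiDegrees n => |(discrepancy z.2 : ℝ)| / z.1) (whp atTop ν) (𝓝 0))
  (hint : Integrable (fun x : ℕ × ℕ => (x.1 : ℝ) + x.2) (pairLaw pIn pOut))

include hint in
theorem integrable_of_abs_le_add {φ : ℕ × ℕ → ℝ} (hφ : ∀ x, |φ x| ≤ x.1 + x.2) :
    Integrable φ (pairLaw pIn pOut) :=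
  hint.mono' (measurable_of_countable φ).aestronglyMeasurable (Eventually.of_forall hφ)

/-- The limiting size-biased tails. -/
noncomputable def tailMean (pIn pOut : PMF ℕ) : DegreeType → ℕ → ℝ
  | .plus, K => ∫ x, (if K < x.2 then (x.2 : ℝ) else 0) ∂pairLaw pIn pOut
  | .minus, K => ∫ x, (if K < x.1 then (x.1 : ℝ) else 0) ∂pairLaw pIn pOut

include hint in
theorem tendsto_tailMean (α : DegreeType) :
    Tendsto (tailMean pIn pOut α) atTop (𝓝 0) := by
  cases α
  · have := tendsto_integral_of_dominated_convergence (μ := pairLaw pIn pOut)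
      (F := fun (K : ℕ) x => if K < x.2 then (x.2 : ℝ) else 0) (f := fun _ => 0) _
      (fun K => (measurable_of_countable _).aestronglyMeasurable) hint
      (fun K => Eventually.of_forall fun x => ?_) (Eventually.of_forall fun x => ?_)
    · rw [integral_zero] at this; exact this
    · split_ifs
      · rw [Real.norm_of_nonneg (Nat.cast_nonneg _)]
        exact le_add_of_nonneg_left (Nat.cast_nonneg _)
      · rw [norm_zero]; positivity
    · refine tendsto_const_nhds.congr' ?_
      filter_upwards [eventually_ge_atTop x.2] with K hK
      rw [if_neg (not_lt.2 hK)]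
  · have := tendsto_integral_of_dominated_convergence (μ := pairLaw pIn pOut)
      (F := fun (K : ℕ) x => if K < x.1 then (x.1 : ℝ) else 0) (f := fun _ => 0) _
      (fun K => (measurable_of_countable _).aestronglyMeasurable) hint
      (fun K => Eventually.of_forall fun x => ?_) (Eventually.of_forall fun x => ?_)
    · rw [integral_zero] at this; exact this
    · split_ifs
      · rw [Real.norm_of_nonneg (Nat.cast_nonneg _)]
        exact le_add_of_nonneg_right (Nat.cast_nonneg _)
      · rw [norm_zero]; positivity
    · refine tendsto_const_nhds.congr' ?_
      filter_upwards [eventually_ge_atTop x.1] with K hK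
      rw [if_neg (not_lt.2 hK)]

theorem abs_ite_fst_le (p : ℕ × ℕ → Prop) [DecidablePred p] (x : ℕ × ℕ) :
    |if p x then (x.1 : ℝ) else 0| ≤ x.1 + x.2 := by
  split_ifs
  · rw [abs_of_nonneg (Nat.cast_nonneg _)]; exact le_add_of_nonneg_right (Nat.cast_nonneg _)
  · rw [abs_zero]; positivity

theorem abs_ite_snd_le (p : ℕ × ℕ → Prop) [DecidablePred p] (x : ℕ × ℕ) :
    |if p x then (x.2 : ℝ) else 0| ≤ x.1 + x.2 := by
  split_ifs
  · rw [abs_of_nonneg (Nat.cast_nonneg _)]; exact le_add_of_nonneg_left (Nat.cast_nonneg _)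
  · rw [abs_zero]; positivity

include hν hint in
theorem tendsto_tailSum_iid (α : DegreeType) (K : ℕ) :
    Tendsto (fun z : Σ n, BiDegrees n => (tailSum z.2 α K : ℝ) / z.1) (whp atTop ν)
      (𝓝 (tailMean pIn pOut α K)) := by
  cases α
  · refine ((tendsto_average_iid pIn pOut (integrable_of_abs_le_add hint
      (abs_ite_snd_le fun x => K < x.2))).mono_left hν).congr fun z => ?_
    rw [tailSum, Finset.sum_filter]
    push_cast
    rfl
  · refine ((tendsto_average_iid pIn pOut (integrable_of_abs_le_add hint
      (abs_ite_fst_le fun x => K < x.1))).mono_left hν).congr fun z => ?_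
    rw [tailSum, Finset.sum_filter]
    push_cast
    rfl

/-- The law of large numbers for balanced stub sequences. -/
theorem tendsto_average_balance {φ : ℕ × ℕ → ℝ} (hν : whp atTop ν ≤ whp atTop (iidLaw pIn pOut))
    (hdisc : Tendsto (fun z : Σ n, BiDegrees n => |(discrepancy z.2 : ℝ)| / z.1)
      (whp atTop ν) (𝓝 0))
    (hint : Integrable (fun x : ℕ × ℕ => (x.1 : ℝ) + x.2) (pairLaw pIn pOut))
    (hφ : ∀ x, |φ x| ≤ x.1 + x.2) :
    Tendsto (fun y : Σ z : (Σ n, BiDegrees n), Finset (Fin z.1) =>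
      (∑ v, φ ((balance y.1.2 y.2).1 v, (balance y.1.2 y.2).2 v)) / y.1.1)
      (balanceWhp ν) (𝓝 (∫ x, φ x ∂pairLaw pIn pOut)) := by
  have hmain := ((tendsto_average_iid pIn pOut (integrable_of_abs_le_add hint hφ)).mono_left
    hν).comp (tendsto_fst_whp (μ := fun z : Σ n, BiDegrees n =>
      uniformOn {S : Finset (Fin z.1) | S.card = (discrepancy z.2).natAbs}))
  have hdiff : Tendsto (fun y : Σ z : (Σ n, BiDegrees n), Finset (Fin z.1) =>
      (∑ v, φ ((balance y.1.2 y.2).1 v, (balance y.1.2 y.2).2 v)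
        - ∑ v, φ (y.1.2.1 v, y.1.2.2 v)) / y.1.1) (balanceWhp ν) (𝓝 0) := by
    refine tendsto_zero_of_abs_le_family (Y := fun (K : ℕ) y =>
      (4 * (K : ℝ) + 1) * (|(discrepancy y.1.2 : ℝ)| / y.1.1)
        + 2 * ((tailSum y.1.2 .minus K : ℝ) / y.1.1 + (tailSum y.1.2 .plus K : ℝ) / y.1.1))
      (y := fun K => (4 * (K : ℝ) + 1) * 0
        + 2 * (tailMean pIn pOut .minus K + tailMean pIn pOut .plus K)) (fun K => ?_)
      (fun K => ((hdisc.comp tendsto_fst_whp).const_mul _).add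
        ((((tendsto_tailSum_iid hν hint .minus K).comp tendsto_fst_whp).add
          ((tendsto_tailSum_iid hν hint .plus K).comp tendsto_fst_whp)).const_mul 2)) ?_
    · filter_upwards [eventually_balanceWhp ν] with y hy
      rw [abs_div, Nat.abs_cast]
      have hc : (y.2.card : ℝ) = |(discrepancy y.1.2 : ℝ)| := by
        rw [hy, Nat.cast_natAbs, Int.cast_abs]
      rw [← hc]
      refine (div_le_div_of_nonneg_right (abs_sum_balance_sub_le y.1.2 y.2 hφ K)
        (Nat.cast_nonneg _)).trans (le_of_eq (by ring))
    · simpa using ((tendsto_tailMean hint .minus).add (tendsto_tailMean hint .plus)).const_mul 2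
  have h := hdiff.add hmain
  rw [zero_add] at h
  refine h.congr fun y => ?_
  simp only [Function.comp_apply]
  ring

end Stubs

/-! ### Moments of distributions with regularly varying bounds -/

/-- A regularly varying tail is dominated by a power of any smaller index. -/
theorem exists_tail_le_rpow {ν : Measure ℝ} [IsProbabilityMeasure ν] {a r : ℝ} (hr : 0 < r)
    (hra : r < a)
    (hν : ∀ t : ℝ, 0 < t → Tendsto (fun x : ℝ => ν.real (Set.Ioi (t * x)) / ν.real (Set.Ioi x))
      atTop (𝓝 (t ^ (-a)))) :
    ∃ C x₀ : ℝ, 0 < x₀ ∧ ∀ x, x₀ ≤ x → ν.real (Set.Ioi x) ≤ C * x ^ (-r) := by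
  have h2 : (2 : ℝ) ^ (-a) < 2 ^ (-r) :=
    Real.rpow_lt_rpow_of_exponent_lt one_lt_two (neg_lt_neg hra)
  -- Since `r < a`, doubling the argument eventually shrinks the tail by the factor `2 ^ (-r)` at
  -- least; iterating this along dyadic points gives the power bound.
  obtain ⟨y, hy⟩ := eventually_atTop.1 ((tendsto_order.1 (hν 2 two_pos)).2 _ h2)
  set x₀ := max y 1
  have hx₀ : 0 < x₀ := lt_of_lt_of_le one_pos (le_max_right _ _)
  have hstep : ∀ x, x₀ ≤ x → ν.real (Set.Ioi (2 * x)) ≤ 2 ^ (-r) * ν.real (Set.Ioi x) := by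
    intro x hx
    have h := hy x ((le_max_left _ _).trans hx)
    -- If the tail vanishes, the quotient is `0` by convention and says nothing; monotonicity is
    -- used instead.
    rcases (measureReal_nonneg (μ := ν) (s := Set.Ioi x)).eq_or_lt with h0 | h0
    · have : ν.real (Set.Ioi (2 * x)) ≤ ν.real (Set.Ioi x) :=
        measureReal_mono (Set.Ioi_subset_Ioi (by linarith))
      rw [← h0] at this ⊢
      simpa using this
    · exact ((div_lt_iff₀ h0).1 h).le
  have hiter : ∀ j : ℕ, ν.real (Set.Ioi (2 ^ j * x₀)) ≤ ((2 : ℝ) ^ (-r)) ^ j := by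
    intro j
    induction j with
    | zero => simp [measureReal_le_one]
    | succ j ih =>
      have h1 : x₀ ≤ 2 ^ j * x₀ := le_mul_of_one_le_left hx₀.le (one_le_pow₀ one_le_two)
      have h3 := hstep _ h1
      rw [pow_succ', mul_assoc, pow_succ']
      exact h3.trans (mul_le_mul_of_nonneg_left ih (by positivity))
  -- For `2 ^ j * x₀ ≤ x < 2 ^ (j + 1) * x₀` the dyadic bound equals `(2 * x₀) ^ r` times the power
  -- `-r` of the right endpoint.
  refine ⟨(2 * x₀) ^ r, x₀, hx₀, fun x hx => ?_⟩
  obtain ⟨j, hj1, hj2⟩ := exists_nat_pow_near ((one_le_div hx₀).2 hx) one_lt_two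
  rw [le_div_iff₀ hx₀] at hj1
  rw [div_lt_iff₀ hx₀] at hj2
  have hxpos : 0 < x := hx₀.trans_le hx
  have h3 : ν.real (Set.Ioi x) ≤ ((2 : ℝ) ^ (-r)) ^ j :=
    (measureReal_mono (Set.Ioi_subset_Ioi hj1)).trans (hiter j)
  refine h3.trans ?_
  have h4 : ((2 : ℝ) ^ (-r)) ^ j = (2 * x₀) ^ r * (2 ^ (j + 1) * x₀) ^ (-r) := by
    rw [show (2 : ℝ) ^ (j + 1) * x₀ = 2 ^ j * (2 * x₀) by ring,
      Real.mul_rpow (x := 2 ^ j) (by positivity) (by positivity), mul_left_comm,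
      ← Real.rpow_add (by positivity), add_neg_cancel, Real.rpow_zero, mul_one,
      ← Real.rpow_natCast, ← Real.rpow_mul two_pos.le, ← Real.rpow_natCast,
      ← Real.rpow_mul two_pos.le, mul_comm]
  rw [h4]
  exact mul_le_mul_of_nonneg_left
    (Real.rpow_le_rpow_of_nonpos hxpos hj2.le (by linarith)) (by positivity)

/-- Layer-cake formula with an exponent `r` between `q` and `a`: the integrand `t ^ (q - 1 - r)` is
integrable at infinity. This moment bound is all that is kept of regular variation. -/
theorem integrable_rpow_of_boundedByRegularlyVarying {p : PMF ℕ} {a q : ℝ}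
    (h : BoundedByRegularlyVarying p a) (hq : 1 ≤ q) (hqa : q < a) :
    Integrable (fun k : ℕ => (k : ℝ) ^ q) p.toMeasure := by
  obtain ⟨ν, hprob, hν, hle⟩ := h
  obtain ⟨r, hqr, hra⟩ := exists_between hqa
  obtain ⟨C, x₀, hx₀, hC⟩ := exists_tail_le_rpow (by linarith : 0 < r) hra hν
  refine ⟨(measurable_of_countable _).aestronglyMeasurable, ?_⟩
  rw [hasFiniteIntegral_iff_ofReal (Eventually.of_forall fun k => by positivity),
    lintegral_rpow_eq_lintegral_meas_lt_mul p.toMeasure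
      (Eventually.of_forall fun k => Nat.cast_nonneg k)
      (measurable_of_countable _).aemeasurable (by linarith)]
  refine ENNReal.mul_lt_top ENNReal.ofReal_lt_top ?_
  rw [← Set.Ioc_union_Ioi_eq_Ioi hx₀.le]
  refine (lintegral_union_le _ _ _).trans_lt (ENNReal.add_lt_top.2 ⟨?_, ?_⟩)
  · refine setLIntegral_lt_top_of_le_nnreal (by simp) ⟨(x₀ ^ (q - 1)).toNNReal, fun t ht => ?_⟩
    refine (mul_le_of_le_one_left zero_le prob_le_one).trans ?_
    exact ENNReal.ofReal_le_ofReal (Real.rpow_le_rpow ht.1.le ht.2 (by linarith))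
  · have hint : IntegrableOn (fun t : ℝ => C * t ^ (q - 1 - r)) (Set.Ioi x₀) :=
      (integrableOn_Ioi_rpow_of_lt (by linarith) hx₀).const_mul C
    refine lt_of_le_of_lt (setLIntegral_mono' measurableSet_Ioi fun t ht => ?_)
      hint.lintegral_lt_top
    have ht0 : 0 < t := hx₀.trans ht
    have h1 : p.toMeasure {k : ℕ | t < (k : ℝ)} ≤ ENNReal.ofReal (C * t ^ (-r)) := by
      refine (hle t).trans ?_
      rw [← ENNReal.ofReal_toReal (measure_ne_top ν _)]
      exact ENNReal.ofReal_le_ofReal (hC t (le_of_lt ht))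
    refine (mul_le_mul_left h1 _).trans ?_
    rw [← ENNReal.ofReal_mul' (by positivity), mul_assoc, ← Real.rpow_add ht0]
    exact ENNReal.ofReal_le_ofReal (le_of_eq (by ring_nf))

/-! ### Acceptance -/

section Deviation

variable (p : PMF ℕ) {q L : ℝ} (hq : 1 ≤ q) (hq2 : q ≤ 2) (hL : 0 < L)
  (hint : Integrable (fun k : ℕ => (k : ℝ) ^ q) p.toMeasure)

/-- Truncation at the level `L`. -/
noncomputable def truncate (L : ℝ) (k : ℕ) : ℝ := if (k : ℝ) ≤ L then k else 0

theorem truncate_mem (hL : 0 < L) (k : ℕ) : 0 ≤ truncate L k ∧ truncate L k ≤ L := by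
  unfold truncate
  split_ifs with h
  · exact ⟨Nat.cast_nonneg _, h⟩
  · exact ⟨le_rfl, hL.le⟩

theorem memLp_truncate (hL : 0 < L) : MemLp (truncate L) 2 p.toMeasure :=
  MemLp.of_bound (measurable_of_countable _).aestronglyMeasurable L
    (Eventually.of_forall fun k => by
      rw [Real.norm_of_nonneg (truncate_mem hL k).1]; exact (truncate_mem hL k).2)

include hL hint in
theorem measure_gt_le (hq : 1 ≤ q) : p.toMeasure {k : ℕ | L < (k : ℝ)}
    ≤ ENNReal.ofReal (L ^ (-q) * ∫ k, (k : ℝ) ^ q ∂p.toMeasure) := by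
  have h := mul_meas_ge_le_integral_of_nonneg (μ := p.toMeasure)
    (Eventually.of_forall fun k : ℕ => Real.rpow_nonneg (Nat.cast_nonneg k) q) hint (L ^ q)
  rw [← ENNReal.ofReal_toReal (measure_ne_top p.toMeasure _)]
  refine ENNReal.ofReal_le_ofReal ?_
  have hmono : p.toMeasure.real {k : ℕ | L < (k : ℝ)}
      ≤ p.toMeasure.real {k : ℕ | L ^ q ≤ (k : ℝ) ^ q} :=
    measureReal_mono fun k hk => Real.rpow_le_rpow hL.le (le_of_lt hk) (by linarith)
  refine hmono.trans ?_
  rw [Real.rpow_neg hL.le, ← div_eq_inv_mul, le_div_iff₀ (by positivity), mul_comm]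
  exact h

include hL hint in
-- Below the level `L`, `k² = k ^ (2 - q) * k ^ q ≤ L ^ (2 - q) * k ^ q`.
theorem variance_truncate_le (hq2 : q ≤ 2) :
    Var[truncate L; p.toMeasure] ≤ L ^ (2 - q) * ∫ k, (k : ℝ) ^ q ∂p.toMeasure := by
  refine (variance_le_expectation_sq (measurable_of_countable _).aestronglyMeasurable).trans ?_
  rw [← integral_const_mul]
  refine integral_mono_of_nonneg (Eventually.of_forall fun k => sq_nonneg _)
    (hint.const_mul _) (Eventually.of_forall fun k => ?_)
  change truncate L k ^ 2 ≤ L ^ (2 - q) * (k : ℝ) ^ q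
  unfold truncate
  split_ifs with h
  · rcases Nat.eq_zero_or_pos k with h0 | h0
    · subst h0
      simp only [Nat.cast_zero, ne_eq, OfNat.ofNat_ne_zero, not_false_eq_true, zero_pow]
      positivity
    · have hk : (0 : ℝ) < k := by exact_mod_cast h0
      have : (k : ℝ) ^ 2 = (k : ℝ) ^ (2 - q) * (k : ℝ) ^ q := by
        rw [← Real.rpow_add hk, sub_add_cancel]; norm_cast
      rw [this]
      exact mul_le_mul_of_nonneg_right (Real.rpow_le_rpow hk.le h (by linarith)) (by positivity)
  · simp only [ne_eq, OfNat.ofNat_ne_zero, not_false_eq_true, zero_pow]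
    positivity

include hint in
theorem integrable_natCast (hq : 1 ≤ q) : Integrable (fun k : ℕ => (k : ℝ)) p.toMeasure := by
  refine hint.mono' (measurable_of_countable _).aestronglyMeasurable
    (Eventually.of_forall fun k => ?_)
  rw [Real.norm_of_nonneg (Nat.cast_nonneg _)]
  rcases Nat.eq_zero_or_pos k with h0 | h0
  · subst h0; simpa using Real.rpow_nonneg le_rfl q
  · have hk : (1 : ℝ) ≤ k := by exact_mod_cast h0
    simpa using Real.rpow_le_rpow_of_exponent_le hk hq

include hL hint in
-- Above the level `L`, `k = k ^ (1 - q) * k ^ q ≤ L ^ (1 - q) * k ^ q`.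
theorem abs_integral_sub_truncate_le (hq : 1 ≤ q) :
    |∫ k, (k : ℝ) ∂p.toMeasure - ∫ k, truncate L k ∂p.toMeasure|
      ≤ L ^ (1 - q) * ∫ k, (k : ℝ) ^ q ∂p.toMeasure := by
  rw [← integral_sub (integrable_natCast p hint hq)
    ((memLp_truncate p hL).integrable one_le_two), ← integral_const_mul, ← Real.norm_eq_abs]
  refine norm_integral_le_of_norm_le (hint.const_mul _) (Eventually.of_forall fun k => ?_)
  unfold truncate
  split_ifs with h
  · rw [sub_self, norm_zero]; positivity
  · rw [sub_zero, Real.norm_of_nonneg (Nat.cast_nonneg _)]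
    rw [not_le] at h
    have hk : (0 : ℝ) < k := hL.trans h
    calc (k : ℝ) = (k : ℝ) ^ (1 - q) * (k : ℝ) ^ q := by
          rw [← Real.rpow_add hk, sub_add_cancel, Real.rpow_one]
      _ ≤ _ := mul_le_mul_of_nonneg_right
          (Real.rpow_le_rpow_of_nonpos hL h.le (by linarith)) (by positivity)

include hL hint hq hq2 in
/-- A deviation bound for sums of independent variables with a finite moment of order `q`. -/
theorem pi_deviation_le (n : ℕ)
    (hn : 4 * (n * (L ^ (-q) * ∫ k, (k : ℝ) ^ q ∂p.toMeasure)) ≤ 1) :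
    (Measure.pi fun _ : Fin n => p.toMeasure)
      {x | L / 2 < |∑ i, (x i : ℝ) - n * ∫ k, (k : ℝ) ∂p.toMeasure|}
      ≤ ENNReal.ofReal (17 * (n * (L ^ (-q) * ∫ k, (k : ℝ) ^ q ∂p.toMeasure))) := by
  set C := ∫ k, (k : ℝ) ^ q ∂p.toMeasure
  have hC : 0 ≤ C := integral_nonneg fun k => Real.rpow_nonneg (Nat.cast_nonneg _) _
  set m := ∫ k, (k : ℝ) ∂p.toMeasure
  set m' := ∫ k, truncate L k ∂p.toMeasure
  set Q := Measure.pi fun _ : Fin n => p.toMeasure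
  have hpow1 : L ^ (1 - q) = L * L ^ (-q) := by
    rw [sub_eq_add_neg, Real.rpow_add hL, Real.rpow_one]
  have hpow2 : L ^ (2 - q) = L ^ 2 * L ^ (-q) := by
    rw [sub_eq_add_neg, Real.rpow_add hL]; norm_cast
  have heval : ∀ i : Fin n, MeasurePreserving (Function.eval i) Q p.toMeasure :=
    fun i => measurePreserving_eval (fun _ : Fin n => p.toMeasure) i
  -- If no variable exceeds `L`, the sum equals the truncated sum, whose mean is off by at most `L /
  -- 4` by `hn`; so `L / 4` remains for Chebyshev. The union bound contributes `1` to the final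
  -- constant and Chebyshev `16`.
  have hsub : {x : Fin n → ℕ | L / 2 < |∑ i, (x i : ℝ) - n * m|}
      ⊆ (⋃ i, {x | L < (x i : ℝ)}) ∪ {x | L / 4 ≤ |∑ i, truncate L (x i) - n * m'|} := by
    intro x hx
    by_cases hbig : ∃ i, L < (x i : ℝ)
    · exact Or.inl (Set.mem_iUnion.2 hbig)
    push Not at hbig
    refine Or.inr ?_
    have h1 : ∑ i, (x i : ℝ) = ∑ i, truncate L (x i) :=
      Finset.sum_congr rfl fun i _ => (if_pos (hbig i)).symm
    have h2 := abs_integral_sub_truncate_le p hL hint hq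
    have h3 : |n * m' - n * m| ≤ L / 4 := by
      rw [← mul_sub, abs_mul, Nat.abs_cast, abs_sub_comm]
      refine (mul_le_mul_of_nonneg_left h2 (Nat.cast_nonneg _)).trans ?_
      rw [hpow1]
      nlinarith
    have h4 := abs_sub_le (∑ i, truncate L (x i)) (n * m') (n * m)
    simp only [Set.mem_ofPred_eq] at hx ⊢
    rw [h1] at hx
    linarith
  have hfirst : Q (⋃ i, {x | L < (x i : ℝ)}) ≤ ENNReal.ofReal (n * (L ^ (-q) * C)) := by
    refine (measure_iUnion_fintype_le _ _).trans ?_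
    have h1 : ∀ i : Fin n, Q {x | L < (x i : ℝ)} ≤ ENNReal.ofReal (L ^ (-q) * C) := by
      intro i
      have := (heval i).measure_preimage (s := {k : ℕ | L < (k : ℝ)})
        MeasurableSet.of_discrete.nullMeasurableSet
      exact this.le.trans (measure_gt_le p hL hint hq)
    refine (Finset.sum_le_sum fun i _ => h1 i).trans ?_
    rw [Finset.sum_const, Finset.card_univ, Fintype.card_fin, nsmul_eq_mul,
      ENNReal.ofReal_mul (Nat.cast_nonneg _), ENNReal.ofReal_natCast]
  have hmem : ∀ i : Fin n, MemLp (fun x : Fin n → ℕ => truncate L (x i)) 2 Q := fun i =>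
    (memLp_truncate p hL).comp_measurePreserving (heval i)
  have hind : iIndepFun (fun (i : Fin n) (x : Fin n → ℕ) => truncate L (x i)) Q :=
    iIndepFun_pi (X := fun _ => truncate L) fun _ => (measurable_of_countable _).aemeasurable
  have hmean : ∫ x, (∑ i, fun x : Fin n → ℕ => truncate L (x i)) x ∂Q = n * m' := by
    simp only [Finset.sum_apply]
    rw [integral_finsetSum _ fun i _ => (hmem i).integrable one_le_two]
    have h1 : ∀ i : Fin n, ∫ x, truncate L (x i) ∂Q = m' := fun i => by
      rw [show m' = ∫ k, truncate L k ∂p.toMeasure from rfl, ← (heval i).map_eq,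
        integral_map (measurable_pi_apply i).aemeasurable
        (measurable_of_countable _).aestronglyMeasurable]
    simp [h1]
  have hvar : Var[∑ i, fun x : Fin n → ℕ => truncate L (x i); Q]
      ≤ n * (L ^ (2 - q) * C) := by
    rw [IndepFun.variance_sum (fun i _ => hmem i) fun i _ j _ hij => hind.indepFun hij]
    have h1 : ∀ i : Fin n, Var[fun x : Fin n → ℕ => truncate L (x i); Q]
        ≤ L ^ (2 - q) * C := fun i => by
      have := (heval i).variance_fun_comp
        (f := truncate L) (measurable_of_countable _).aemeasurable
      refine le_trans (le_of_eq this) (variance_truncate_le p hL hint hq2)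
    refine (Finset.sum_le_sum fun i _ => h1 i).trans (le_of_eq ?_)
    simp
  have hsecond : Q {x | L / 4 ≤ |∑ i, truncate L (x i) - n * m'|}
      ≤ ENNReal.ofReal (16 * (n * (L ^ (-q) * C))) := by
    have h1 := meas_ge_le_variance_div_sq (memLp_finsetSum' Finset.univ fun i _ => hmem i)
      (c := L / 4) (by positivity)
    rw [hmean] at h1
    simp only [Finset.sum_apply] at h1
    refine h1.trans (ENNReal.ofReal_le_ofReal ?_)
    rw [div_le_iff₀ (by positivity)]
    refine hvar.trans (le_of_eq ?_)
    rw [hpow2]; ring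
  refine (measure_mono hsub).trans ((measure_union_le _ _).trans ?_)
  refine (add_le_add hfirst hsecond).trans (le_of_eq ?_)
  rw [← ENNReal.ofReal_add (by positivity) (by positivity)]
  congr 1
  ring

end Deviation

theorem tendsto_natCast_mul_rpow {θ q : ℝ} (h : 1 < θ * q) (C : ℝ) :
    Tendsto (fun n : ℕ => (n : ℝ) * (((n : ℝ) ^ θ) ^ (-q) * C)) atTop (𝓝 0) := by
  have h1 : Tendsto (fun n : ℕ => (n : ℝ) ^ (-(θ * q - 1)) * C) atTop (𝓝 0) := by
    have := ((tendsto_rpow_neg_atTop (sub_pos.2 h)).comp tendsto_natCast_atTop_atTop).mul_const C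
    simpa using this
  refine h1.congr' ?_
  filter_upwards [eventually_gt_atTop 0] with n hn
  have hn' : (0 : ℝ) < n := by exact_mod_cast hn
  rw [← Real.rpow_mul hn'.le, ← mul_assoc]
  congr 1
  nth_rewrite 2 [← Real.rpow_one (n : ℝ)]
  rw [← Real.rpow_add hn']
  congr 1
  ring

theorem tendsto_pi_deviation (p : PMF ℕ) {q θ : ℝ} (hq : 1 ≤ q) (hq2 : q ≤ 2) (hθ : 1 < θ * q)
    (hint : Integrable (fun k : ℕ => (k : ℝ) ^ q) p.toMeasure) :
    Tendsto (fun n : ℕ => (Measure.pi fun _ : Fin n => p.toMeasure)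
      {x | (n : ℝ) ^ θ / 2 < |∑ i, (x i : ℝ) - n * ∫ k, (k : ℝ) ∂p.toMeasure|}) atTop (𝓝 0) := by
  have h1 := tendsto_natCast_mul_rpow hθ (∫ k, (k : ℝ) ^ q ∂p.toMeasure)
  have h2 : Tendsto (fun n : ℕ => ENNReal.ofReal (17 * ((n : ℝ) * (((n : ℝ) ^ θ) ^ (-q)
      * ∫ k, (k : ℝ) ^ q ∂p.toMeasure)))) atTop (𝓝 0) := by
    simpa using ENNReal.tendsto_ofReal (h1.const_mul 17)
  refine tendsto_of_tendsto_of_tendsto_of_le_of_le' tendsto_const_nhds h2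
    (Eventually.of_forall fun _ => zero_le) ?_
  have h3 := h1.const_mul 4
  rw [mul_zero] at h3
  filter_upwards [(tendsto_order.1 h3).2 1 one_pos, eventually_gt_atTop 0] with n hn hn0
  have hn' : (0 : ℝ) < n := by exact_mod_cast hn0
  exact pi_deviation_le p hq hq2 (Real.rpow_pos_of_pos hn' θ) hint n hn.le

theorem eventually_abs_discrepancy_le (pIn pOut : PMF ℕ) {q θ : ℝ} (hq : 1 ≤ q) (hq2 : q ≤ 2)
    (hθ : 1 < θ * q) (hIn : Integrable (fun k : ℕ => (k : ℝ) ^ q) pIn.toMeasure)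
    (hOut : Integrable (fun k : ℕ => (k : ℝ) ^ q) pOut.toMeasure)
    (hmean : ∫ k, (k : ℝ) ∂pIn.toMeasure = ∫ k, (k : ℝ) ∂pOut.toMeasure) :
    ∀ᶠ z in whp atTop (iidLaw pIn pOut), |(discrepancy z.2 : ℝ)| ≤ (z.1 : ℝ) ^ θ := by
  have hfst : ∀ᶠ z in whp atTop (iidLaw pIn pOut), ¬ (z.1 : ℝ) ^ θ / 2
      < |∑ i, (z.2.1 i : ℝ) - z.1 * ∫ k, (k : ℝ) ∂pIn.toMeasure| := by
    rw [eventually_whp]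
    simp only [not_not]
    refine (tendsto_pi_deviation pIn hq hq2 hθ hIn).congr fun n => ?_
    exact (measurePreserving_fst (μ := Measure.pi fun _ : Fin n => pIn.toMeasure)
      (ν := Measure.pi fun _ : Fin n => pOut.toMeasure)).measure_preimage
      MeasurableSet.of_discrete.nullMeasurableSet |>.symm
  have hsnd : ∀ᶠ z in whp atTop (iidLaw pIn pOut), ¬ (z.1 : ℝ) ^ θ / 2
      < |∑ i, (z.2.2 i : ℝ) - z.1 * ∫ k, (k : ℝ) ∂pOut.toMeasure| := by
    rw [eventually_whp]
    simp only [not_not]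
    refine (tendsto_pi_deviation pOut hq hq2 hθ hOut).congr fun n => ?_
    exact (measurePreserving_snd (μ := Measure.pi fun _ : Fin n => pIn.toMeasure)
      (ν := Measure.pi fun _ : Fin n => pOut.toMeasure)).measure_preimage
      MeasurableSet.of_discrete.nullMeasurableSet |>.symm
  filter_upwards [hfst, hsnd] with z h1 h2
  rw [not_lt] at h1 h2
  have h3 : (discrepancy z.2 : ℝ) = (∑ i, (z.2.1 i : ℝ) - z.1 * ∫ k, (k : ℝ) ∂pIn.toMeasure)
      - (∑ i, (z.2.2 i : ℝ) - z.1 * ∫ k, (k : ℝ) ∂pOut.toMeasure) := by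
    rw [discrepancy, hmean]; push_cast; ring
  rw [h3]
  exact (abs_sub _ _).trans (by linarith)

/-! ### Limiting degree distributions -/

theorem mean_toReal {p : PMF ℕ} (hint : Integrable (fun k : ℕ => (k : ℝ)) p.toMeasure) :
    (mean p).toReal = ∫ k, (k : ℝ) ∂p.toMeasure := by
  rw [PMF.integral_eq_tsum p _ hint, mean,
    ENNReal.tsum_toReal_eq fun k => ENNReal.mul_ne_top (by simp) (p.apply_ne_top k)]
  refine tsum_congr fun k => ?_
  rw [ENNReal.toReal_mul, ENNReal.toReal_natCast, smul_eq_mul, mul_comm]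

theorem integral_ite_eq (p : PMF ℕ) (k : ℕ) (c : ℕ → ℝ) :
    ∫ j, (if j = k then c j else 0) ∂p.toMeasure = (p k).toReal * c k := by
  have h : (fun j => if j = k then c j else 0) = ({k} : Set ℕ).indicator fun _ => c k := by
    funext j
    by_cases hj : j = k <;> simp [hj]
  rw [h, integral_indicator_const _ (measurableSet_singleton k), measureReal_def,
    PMF.toMeasure_apply_singleton _ _ (measurableSet_singleton k), smul_eq_mul]

theorem tsum_sizeBiased {p : PMF ℕ} (h0 : mean p ≠ 0) (ht : mean p ≠ ∞) :
    ∑' k, sizeBiased p k = 1 := by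
  simp only [sizeBiased, ENNReal.div_eq_inv_mul]
  rw [ENNReal.tsum_mul_left]
  exact ENNReal.inv_mul_cancel h0 ht

section Limits

variable {pIn pOut : PMF ℕ} (hIn0 : mean pIn ≠ 0) (hIn : mean pIn ≠ ∞)
  (hOut0 : mean pOut ≠ 0) (hOut : mean pOut ≠ ∞)

include hOut0 hOut in
theorem tsum_sourceLimit (α : DegreeType) : ∑' k, sourceLimit pIn pOut α k = 1 := by
  cases α
  · exact tsum_sizeBiased hOut0 hOut
  · exact pIn.tsum_coe

include hIn0 hIn in
theorem tsum_targetLimit (β : DegreeType) : ∑' k, targetLimit pIn pOut β k = 1 := by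
  cases β
  · exact pOut.tsum_coe
  · exact tsum_sizeBiased hIn0 hIn

theorem hasSum_toReal_of_tsum_eq_one {f : ℕ → ℝ≥0∞} (h : ∑' k, f k = 1) :
    HasSum (fun k => (f k).toReal) 1 := by
  have h1 := ENNReal.hasSum_toReal (f := f) (by simp [h])
  rwa [← ENNReal.tsum_toReal_eq fun k => ENNReal.ne_top_of_tsum_ne_top (by simp [h]) k, h,
    ENNReal.toReal_one] at h1

/-- A random outbound stub sees its vertex with weight the out-degree: this biases the out-degree by
size, but leaves the independent in-degree unbiased. -/
theorem integral_source (pIn : PMF ℕ) (hOut0 : mean pOut ≠ 0) (hOut : mean pOut ≠ ∞)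
    (hi : Integrable (fun k : ℕ => (k : ℝ)) pOut.toMeasure) (k : ℕ) :
    ∫ x : ℕ × ℕ, (if x.2 = k then (x.2 : ℝ) else 0) ∂pairLaw pIn pOut
        = (∫ k, (k : ℝ) ∂pOut.toMeasure) * (sourceLimit pIn pOut .plus k).toReal ∧
      ∫ x : ℕ × ℕ, (if x.1 = k then (x.2 : ℝ) else 0) ∂pairLaw pIn pOut
        = (∫ k, (k : ℝ) ∂pOut.toMeasure) * (sourceLimit pIn pOut .minus k).toReal := by
  constructor
  · have h := integral_prod_mul (μ := pIn.toMeasure) (ν := pOut.toMeasure) (fun _ => (1 : ℝ))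
      (fun j => if j = k then (j : ℝ) else 0)
    simp only [one_mul] at h
    rw [h, integral_ite_eq, ← mean_toReal hi]
    simp only [integral_const, probReal_univ, sourceLimit, sizeBiased, ENNReal.toReal_div,
      ENNReal.toReal_mul, ENNReal.toReal_natCast, smul_eq_mul, mul_one, one_mul]
    have : (mean pOut).toReal ≠ 0 := ENNReal.toReal_ne_zero.2 ⟨hOut0, hOut⟩
    field_simp
  · have h := integral_prod_mul (μ := pIn.toMeasure) (ν := pOut.toMeasure)
      (fun j => if j = k then (1 : ℝ) else 0) (fun j => (j : ℝ))
    simp only [ite_mul, one_mul, zero_mul] at h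
    rw [h, integral_ite_eq pIn k fun _ => 1, mul_one, mul_comm]
    rfl

theorem integral_target (pOut : PMF ℕ) (hIn0 : mean pIn ≠ 0) (hIn : mean pIn ≠ ∞)
    (hi : Integrable (fun k : ℕ => (k : ℝ)) pIn.toMeasure) (k : ℕ) :
    ∫ x : ℕ × ℕ, (if x.2 = k then (x.1 : ℝ) else 0) ∂pairLaw pIn pOut
        = (∫ k, (k : ℝ) ∂pIn.toMeasure) * (targetLimit pIn pOut .plus k).toReal ∧
      ∫ x : ℕ × ℕ, (if x.1 = k then (x.1 : ℝ) else 0) ∂pairLaw pIn pOut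
        = (∫ k, (k : ℝ) ∂pIn.toMeasure) * (targetLimit pIn pOut .minus k).toReal := by
  have hswap : ∀ φ : ℕ × ℕ → ℝ, ∫ x, φ x ∂pairLaw pIn pOut
      = ∫ x : ℕ × ℕ, φ x.swap ∂pairLaw pOut pIn := fun φ => (integral_prod_swap φ).symm
  have h := integral_source (pOut := pIn) pOut hIn0 hIn hi k
  rw [hswap, hswap]
  exact ⟨h.2, h.1⟩

end Limits

theorem stubLaw_univ_le (pIn pOut : PMF ℕ) (a b δ : ℝ) (n : ℕ) :
    stubLaw pIn pOut a b δ n Set.univ ≤ 1 :=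
  bind_univ_le (cond_univ_le _ MeasurableSet.of_discrete) _ fun _ =>
    map_univ_le (cond_univ_le _ MeasurableSet.of_discrete) _

theorem graphLaw_univ_le (pIn pOut : PMF ℕ) (a b δ : ℝ) (n : ℕ) :
    graphLaw pIn pOut a b δ n Set.univ ≤ 1 :=
  bind_univ_le (stubLaw_univ_le pIn pOut a b δ n) _ fun _ =>
    map_univ_le (cond_univ_le _ MeasurableSet.of_discrete) _

/-- A limit for balanced sequences is a limit for stub sequences. -/
theorem tendsto_stubLaw {pIn pOut : PMF ℕ} {a b δ : ℝ} {R : Type*} {l : Filter R}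
    (F : ∀ n, BiDegrees n → R)
    (h : Tendsto (fun y : Σ z : (Σ n, BiDegrees n), Finset (Fin z.1) =>
      F y.1.1 (balance y.1.2 y.2)) (balanceWhp (acceptedLaw pIn pOut a b δ)) l) :
    Tendsto (fun z : Σ n, BiDegrees n => F z.1 z.2) (whp atTop (stubLaw pIn pOut a b δ)) l :=
  tendsto_whp_bind_map (X := fun n => BiDegrees n) (Y := fun n => BiDegrees n)
    (W := fun z : Σ n, BiDegrees n => Finset (Fin z.1)) (μ := acceptedLaw pIn pOut a b δ)
    (fun _ => cond_univ_le _ MeasurableSet.of_discrete)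
    (fun z => uniformOn {S : Finset (Fin z.1) | S.card = (discrepancy z.2).natAbs})
    (fun _ => cond_univ_le _ MeasurableSet.of_discrete) (fun z => balance z.2) F h

/-- A limit for random pairings is a limit for erased graphs. -/
theorem tendsto_graphLaw {pIn pOut : PMF ℕ} {a b δ : ℝ} {R : Type*} {l : Filter R}
    (F : ∀ n, Finset (Fin n × Fin n) → R)
    (h : Tendsto (fun y : Σ z : (Σ n, BiDegrees n), Pairing z.2 => F y.1.1 (erase y.1.2 y.2))
      (pairingWhp (stubLaw pIn pOut a b δ)) l) :
    Tendsto (fun z : Σ n, Finset (Fin n × Fin n) => F z.1 z.2)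
      (whp atTop (graphLaw pIn pOut a b δ)) l :=
  tendsto_whp_bind_map (X := fun n => BiDegrees n) (Y := fun n => Finset (Fin n × Fin n))
    (W := fun z : Σ n, BiDegrees n => Pairing z.2) (μ := stubLaw pIn pOut a b δ)
    (stubLaw_univ_le pIn pOut a b δ) (fun _ => uniformOn Set.univ)
    (fun _ => cond_univ_le _ MeasurableSet.of_discrete) (fun z => erase z.2) F h

theorem eventually_balanced {pIn pOut : PMF ℕ} {a b δ : ℝ} :
    ∀ᶠ z in whp atTop (stubLaw pIn pOut a b δ), ∑ v, z.2.1 v = ∑ v, z.2.2 v := by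
  have h := tendsto_stubLaw (pIn := pIn) (pOut := pOut) (a := a) (b := b) (δ := δ)
    -- Convergence of a proposition to the principal filter at `True` says that it holds with high
    -- probability.
    (l := 𝓟 {True}) (fun n d => ∑ v, d.1 v = ∑ v, d.2 v) ?_
  · simpa [tendsto_principal] using h
  · rw [tendsto_principal]
    filter_upwards [eventually_balanceWhp (acceptedLaw pIn pOut a b δ)] with y hy
    simpa using sum_balance_eq y.1.2 y.2 hy

/-! ### The joint degree law of the edges of an erased configuration model graph. -/

section Graph

variable {pIn pOut : PMF ℕ} {a b δ : ℝ} (ha : 1 < a) (hb : 1 < b)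
  (hIn : BoundedByRegularlyVarying pIn a) (hOut : BoundedByRegularlyVarying pOut b)
  (hmean : mean pIn = mean pOut) (hδ_pos : 0 < δ) (hδ_lt : δ < kappa a b)

include ha hb hδ_pos hδ_lt in
-- This is what the form of `κ` is for: with `θ = 1 - κ + δ` it gives `θ > 1/a`, `θ > 1/b` and `θ >
-- 1/2`, while `δ < κ` gives `θ < 1`. An exponent strictly between `θ⁻¹` and the least of `a`, `b`,
-- `2` therefore exists and exceeds one.
theorem exists_moment_exponent : ∃ q : ℝ, 1 ≤ q ∧ q ≤ 2 ∧ q < a ∧ q < b ∧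
    1 < (1 - kappa a b + δ) * q := by
  have h1 : kappa a b ≤ 1 - a⁻¹ := (min_le_left _ _).trans (min_le_left _ _)
  have h2 : kappa a b ≤ 1 - b⁻¹ := (min_le_left _ _).trans (min_le_right _ _)
  have h3 : kappa a b ≤ 1 / 2 := min_le_right _ _
  set θ := 1 - kappa a b + δ
  have hθ : 0 < θ := by linarith
  have ha' : θ⁻¹ < a := by
    rw [inv_lt_comm₀ hθ (by linarith)]; linarith
  have hb' : θ⁻¹ < b := by
    rw [inv_lt_comm₀ hθ (by linarith)]; linarith
  have h2' : θ⁻¹ < 2 := by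
    rw [inv_lt_comm₀ hθ (by norm_num)]; linarith
  have hθ1 : 1 < θ⁻¹ := (one_lt_inv₀ hθ).2 (by linarith)
  obtain ⟨q, hq1, hq2⟩ := exists_between (lt_min (lt_min ha' hb') h2')
  refine ⟨q, by linarith, (hq2.trans_le (min_le_right _ _)).le,
    hq2.trans_le ((min_le_left _ _).trans (min_le_left _ _)),
    hq2.trans_le ((min_le_left _ _).trans (min_le_right _ _)), ?_⟩
  rwa [inv_lt_iff_one_lt_mul₀' hθ] at hq1

include ha hb hIn hOut in
theorem integrable_natCast_in_out : Integrable (fun k : ℕ => (k : ℝ)) pIn.toMeasure ∧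
    Integrable (fun k : ℕ => (k : ℝ)) pOut.toMeasure := by
  constructor
  · simpa using integrable_rpow_of_boundedByRegularlyVarying hIn le_rfl ha
  · simpa using integrable_rpow_of_boundedByRegularlyVarying hOut le_rfl hb

include ha hb hIn hOut hmean hδ_pos hδ_lt

theorem eventually_accepted :
    ∀ᶠ z in whp atTop (iidLaw pIn pOut), z.2 ∈ accepted a b δ z.1 := by
  obtain ⟨q, hq1, hq2, hqa, hqb, hθ⟩ := exists_moment_exponent ha hb hδ_pos hδ_lt
  obtain ⟨i1, i2⟩ := integrable_natCast_in_out ha hb hIn hOut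
  exact eventually_abs_discrepancy_le pIn pOut hq1 hq2 hθ
    (integrable_rpow_of_boundedByRegularlyVarying hIn hq1 hqa)
    (integrable_rpow_of_boundedByRegularlyVarying hOut hq1 hqb)
    (by rw [← mean_toReal i1, ← mean_toReal i2, hmean])

theorem whp_acceptedLaw_le :
    whp atTop (acceptedLaw pIn pOut a b δ) ≤ whp atTop (iidLaw pIn pOut) :=
  whp_cond_le (fun n => accepted a b δ n) (fun _ => MeasurableSet.of_discrete)
    (fun _ => inferInstance) (eventually_accepted ha hb hIn hOut hmean hδ_pos hδ_lt)

theorem tendsto_discrepancy :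
    Tendsto (fun z : Σ n, BiDegrees n => |(discrepancy z.2 : ℝ)| / z.1)
      (whp atTop (acceptedLaw pIn pOut a b δ)) (𝓝 0) := by
  have hn : Tendsto (fun z : Σ n, BiDegrees n => (z.1 : ℝ))
    (whp atTop (acceptedLaw pIn pOut a b δ)) atTop := tendsto_natCast_fst_whp
  -- On accepted samples the discrepancy divided by `n` is at most `n ^ (-(κ - δ))`, which vanishes
  -- because `δ < κ`.
  have hlim := (tendsto_rpow_neg_atTop (sub_pos.2 hδ_lt)).comp hn
  refine squeeze_zero' (Eventually.of_forall fun z => by positivity) ?_ hlim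
  filter_upwards [whp_acceptedLaw_le ha hb hIn hOut hmean hδ_pos hδ_lt
    (eventually_accepted ha hb hIn hOut hmean hδ_pos hδ_lt), hn.eventually_gt_atTop 0] with z h1 h2
  have h3 : |(discrepancy z.2 : ℝ)| ≤ (z.1 : ℝ) ^ (1 - kappa a b + δ) := h1
  simp only [Function.comp_apply]
  rw [div_le_iff₀ h2]
  refine h3.trans (le_of_eq ?_)
  nth_rewrite 3 [← Real.rpow_one (z.1 : ℝ)]
  rw [← Real.rpow_add h2]
  congr 1
  ring

theorem tendsto_average_stubLaw {φ : ℕ × ℕ → ℝ} (hφ : ∀ x, |φ x| ≤ x.1 + x.2) :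
    Tendsto (fun z : Σ n, BiDegrees n => (∑ v, φ (z.2.1 v, z.2.2 v)) / z.1)
      (whp atTop (stubLaw pIn pOut a b δ)) (𝓝 (∫ x, φ x ∂pairLaw pIn pOut)) := by
  obtain ⟨i1, i2⟩ := integrable_natCast_in_out ha hb hIn hOut
  exact tendsto_stubLaw (fun n d => (∑ v, φ (d.1 v, d.2 v)) / (n : ℝ))
    (tendsto_average_balance (whp_acceptedLaw_le ha hb hIn hOut hmean hδ_pos hδ_lt)
      (tendsto_discrepancy ha hb hIn hOut hmean hδ_pos hδ_lt)
      ((i1.comp_fst pOut.toMeasure).add (i2.comp_snd pIn.toMeasure)) hφ)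

/-- All that the rank statistics need from the model. Each limit required of the stub sequences is a
law of large numbers for a function bounded by the sum of the two degrees. -/
theorem tendsto_graph_counts (hmean_pos : 0 < mean pIn) (hmean_fin : mean pIn < ∞)
    (α β : DegreeType) :
    Tendsto (fun z : Σ n, Finset (Fin n × Fin n) => (z.2.card : ℝ))
        (whp atTop (graphLaw pIn pOut a b δ)) atTop ∧
      ∀ x : ℕ × ℕ, Tendsto (fun z : Σ n, Finset (Fin n × Fin n) =>
        (edgeCount z.2 α β x : ℝ) / z.2.card) (whp atTop (graphLaw pIn pOut a b δ))
        (𝓝 ((sourceLimit pIn pOut α x.1).toReal * (targetLimit pIn pOut β x.2).toReal)) := by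
  obtain ⟨i1, i2⟩ := integrable_natCast_in_out ha hb hIn hOut
  have hμeq : ∫ k, (k : ℝ) ∂pOut.toMeasure = ∫ k, (k : ℝ) ∂pIn.toMeasure := by
    rw [← mean_toReal i1, ← mean_toReal i2, hmean]
  have hμ : 0 < ∫ k, (k : ℝ) ∂pIn.toMeasure := by
    rw [← mean_toReal i1]
    exact ENNReal.toReal_pos hmean_pos.ne' hmean_fin.ne
  have havg := fun {φ : ℕ × ℕ → ℝ} => tendsto_average_stubLaw (φ := φ) ha hb hIn hOut hmean
    hδ_pos hδ_lt
  have hM : Tendsto (fun z : Σ n, BiDegrees n => ((∑ v, z.2.2 v : ℕ) : ℝ) / z.1)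
      (whp atTop (stubLaw pIn pOut a b δ)) (𝓝 (∫ k, (k : ℝ) ∂pIn.toMeasure)) := by
    have h := havg (φ := fun x => (x.2 : ℝ)) fun x => by
      rw [Nat.abs_cast]; exact le_add_of_nonneg_left (Nat.cast_nonneg _)
    rw [integral_fun_snd (μ := pIn.toMeasure) (ν := pOut.toMeasure) fun k : ℕ => (k : ℝ),
      probReal_univ, one_smul, hμeq] at h
    refine h.congr fun z => ?_
    push_cast
    rfl
  have hS : ∀ k, Tendsto (fun z : Σ n, BiDegrees n =>
      ((∑ v with stubDegree z.2 α v = k, z.2.2 v : ℕ) : ℝ) / z.1)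
      (whp atTop (stubLaw pIn pOut a b δ))
      (𝓝 ((∫ k, (k : ℝ) ∂pIn.toMeasure) * (sourceLimit pIn pOut α k).toReal)) := by
    intro k
    have hsource := integral_source (pOut := pOut) pIn (hmean ▸ hmean_pos.ne')
      (hmean ▸ hmean_fin.ne) i2 k
    rw [hμeq] at hsource
    cases α
    · have h := havg (abs_ite_snd_le fun x => x.2 = k)
      rw [hsource.1] at h
      refine h.congr fun z => ?_
      rw [Finset.sum_filter]
      push_cast
      rfl
    · have h := havg (abs_ite_snd_le fun x => x.1 = k)
      rw [hsource.2] at h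
      refine h.congr fun z => ?_
      rw [Finset.sum_filter]
      push_cast
      rfl
  have hT : ∀ k, Tendsto (fun z : Σ n, BiDegrees n =>
      ((∑ v with stubDegree z.2 β v = k, z.2.1 v : ℕ) : ℝ) / z.1)
      (whp atTop (stubLaw pIn pOut a b δ))
      (𝓝 ((∫ k, (k : ℝ) ∂pIn.toMeasure) * (targetLimit pIn pOut β k).toReal)) := by
    intro k
    have htarget := integral_target (pIn := pIn) pOut hmean_pos.ne' hmean_fin.ne i1 k
    cases β
    · have h := havg (abs_ite_fst_le fun x => x.2 = k)
      rw [htarget.1] at h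
      refine h.congr fun z => ?_
      rw [Finset.sum_filter]
      push_cast
      rfl
    · have h := havg (abs_ite_fst_le fun x => x.1 = k)
      rw [htarget.2] at h
      refine h.congr fun z => ?_
      rw [Finset.sum_filter]
      push_cast
      rfl
  have htail : ∀ K, Tendsto (fun z : Σ n, BiDegrees n => (tailSum z.2 .plus K : ℝ) / z.1)
      (whp atTop (stubLaw pIn pOut a b δ)) (𝓝 (tailMean pIn pOut .plus K)) := fun K => by
    refine (havg (abs_ite_snd_le fun x => K < x.2)).congr fun z => ?_
    rw [tailSum, Finset.sum_filter]
    push_cast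
    rfl
  have htail' : ∀ K, Tendsto (fun z : Σ n, BiDegrees n => (tailSum z.2 .minus K : ℝ) / z.1)
      (whp atTop (stubLaw pIn pOut a b δ)) (𝓝 (tailMean pIn pOut .minus K)) := fun K => by
    refine (havg (abs_ite_fst_le fun x => K < x.1)).congr fun z => ?_
    rw [tailSum, Finset.sum_filter]
    push_cast
    rfl
  have hsum := (i1.comp_fst pOut.toMeasure).add (i2.comp_snd pIn.toMeasure)
  have hT0 := tendsto_tailMean (pIn := pIn) (pOut := pOut) hsum .plus
  have hT0' := tendsto_tailMean (pIn := pIn) (pOut := pOut) hsum .minus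
  exact ⟨tendsto_graphLaw (fun n E => (E.card : ℝ))
      (tendsto_card_erase_atTop hμ eventually_balanced hM htail htail' hT0 hT0'),
    fun x => tendsto_graphLaw (fun n E => (edgeCount E α β x : ℝ) / E.card)
      (tendsto_edgeCount_div_card hμ eventually_balanced hM hS hT htail htail' hT0 hT0' x)⟩

end Graph

end ECM

theorem mainTheorem5
    (pIn pOut : PMF ℕ) (a b δ : ℝ) (ha : 1 < a) (hb : 1 < b)
    (hIn : ECM.BoundedByRegularlyVarying pIn a) (hOut : ECM.BoundedByRegularlyVarying pOut b)
    (hmean : ECM.mean pIn = ECM.mean pOut) (hmean_pos : 0 < ECM.mean pIn)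
    (hmean_fin : ECM.mean pIn < ∞)
    (hδ_pos : 0 < δ) (hδ_lt : δ < ECM.kappa a b)
    {Ω : Type*} [MeasurableSpace Ω] (P : Measure Ω) [IsProbabilityMeasure P]
    (E : ∀ n : ℕ, Ω → Finset (Fin n × Fin n)) (U W : ∀ n : ℕ, Ω → Fin n × Fin n → ℝ)
    (hlaw : ∀ᶠ n : ℕ in atTop,
      HasLaw (fun ω => (E n ω, U n ω, W n ω))
        ((ECM.graphLaw pIn pOut a b δ n).prod ((ECM.tieLaw n).prod (ECM.tieLaw n))) P)
    (α β : ECM.DegreeType) :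
    TendstoInMeasure P (fun n ω => ECM.spearman (E n ω) (U n ω) (W n ω) α β) atTop
        (fun _ => (0 : ℝ)) ∧
      ((∀ k, ECM.sourceLimit pIn pOut α k ≠ 1) → (∀ k, ECM.targetLimit pIn pOut β k ≠ 1) →
        TendstoInMeasure P (fun n ω => ECM.spearmanAverage (E n ω) α β) atTop
          (fun _ => (0 : ℝ))) ∧
      TendstoInMeasure P (fun n ω => ECM.kendall (E n ω) α β) atTop (fun _ => (0 : ℝ)) := by
  obtain ⟨hcard, hlim⟩ := ECM.tendsto_graph_counts ha hb hIn hOut hmean hδ_pos hδ_lt hmean_pos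
    hmean_fin α β
  have hf1 := ECM.hasSum_toReal_of_tsum_eq_one (ECM.tsum_sourceLimit (pIn := pIn)
    (hmean ▸ hmean_pos.ne') (hmean ▸ hmean_fin.ne) α)
  have hg1 := ECM.hasSum_toReal_of_tsum_eq_one (ECM.tsum_targetLimit (pOut := pOut)
    hmean_pos.ne' hmean_fin.ne β)
  -- The last two statistics ignore the ties, so the first marginal suffices; it is `graphLaw`
  -- because the tie laws have mass one.
  have hgraph : ∀ᶠ n : ℕ in atTop, HasLaw (E n) (ECM.graphLaw pIn pOut a b δ n) P := by
    filter_upwards [hlaw] with n hn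
    refine ⟨hn.aemeasurable.fst, ?_⟩
    have h1 : P.map (E n) = (P.map fun ω => (E n ω, U n ω, W n ω)).map Prod.fst := by
      rw [AEMeasurable.map_map_of_aemeasurable measurable_fst.aemeasurable hn.aemeasurable]
      rfl
    rw [h1, hn.map_eq, Measure.map_fst_prod]
    simp
  have hne : ∀ {f : ℕ → ℝ≥0∞}, (∀ k, f k ≠ 1) → ∀ k, (f k).toReal ≠ 1 := fun h k hk =>
    h k ((ENNReal.toReal_eq_one_iff _).1 hk)
  refine ⟨?_, fun hsource htarget => ?_, ?_⟩
  · exact ECM.tendstoInMeasure_of_whp _ hlaw (fun n z => ECM.spearman z.1 z.2.1 z.2.2 α β) 0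
      (ECM.tendsto_spearman_of_averageRank _ (ECM.graphLaw_univ_le pIn pOut a b δ) α β hcard
        (ECM.tendsto_averageRank_spearman (fun z : Σ n, Finset (Fin n × Fin n) => z.2) α β
          (fun _ => ENNReal.toReal_nonneg) hf1 (fun _ => ENNReal.toReal_nonneg) hg1 hcard hlim))
  · exact ECM.tendstoInMeasure_of_whp E hgraph (fun n G => ECM.spearmanAverage G α β) 0
      (ECM.tendsto_spearmanAverage (fun z : Σ n, Finset (Fin n × Fin n) => z.2) α β
        (fun _ => ENNReal.toReal_nonneg) hf1 (fun _ => ENNReal.toReal_nonneg) hg1 hcard hlim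
        (hne hsource) (hne htarget))
  · exact ECM.tendstoInMeasure_of_whp E hgraph (fun n G => ECM.kendall G α β) 0
      (ECM.tendsto_kendall (fun z : Σ n, Finset (Fin n × Fin n) => z.2) α β
        (fun _ => ENNReal.toReal_nonneg) hf1 (fun _ => ENNReal.toReal_nonneg) hg1 hcard hlim)
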